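/- Let $d_A,d_B,d_C\ge 1$ be integers with $d_A\ge d_C$, let $\mathcal A,\mathcal B,\mathcal C$ be alphabets of these sizes, and let $\varepsilon>0$. For a distribution $P=P_{ABC}$ on $\mathcal A\times\mathcal B\times\mathcal C$ let $P_{AB}P_{C|B}$ be the distribution $(a,b,c)\mapsto P_{AB}(a,b)\,P_{BC}(b,c)/P_B(b)$ (read as $0$ where $P_B(b)=0$). For a distance measure $\Delta$, let $\mathrm{SC}_{\Delta}(\varepsilon,d_A,d_B,d_C)$ be the least $N$ for which there is a (possibly randomized) tester that, given $N$ i.i.d. samples from an unknown $P$, answers "Yes" with probability at least $2/3$ whenever $\Delta(P\|P_{AB}P_{C|B})=0$ and "No" with probability at least $2/3$ whenever $\Delta(P\|P_{AB}P_{C|B})\ge\varepsilon$. Write $\mathrm{SC}_{\mathrm{CI},H}$ for $\Delta=D_H^2$, $D_H^2(P,Q)=\frac12\sum_x(\sqrt{P(x)}-\sqrt{Q(x)})^2$ (conditional independence testing in squared Hellinger distance), and $\mathrm{SC}_{\mathrm{CMI}}$ for $\Delta=D$, $D(P\|Q)=\sum_x P(x)\log\frac{P(x)}{Q(x)}$ (CMI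 testing, as $D(P\|P_{AB}P_{C|B})=I(A:C|B)_P$). Put $$f_{\mathrm{sym}}=\max\left\{\frac{d_A^{1/2}d_B^{3/4}d_C^{1/2}}{\varepsilon},\ \min\left\{\frac{d_A^{1/4}d_B^{7/8}d_C^{1/4}}{\varepsilon},\frac{d_A^{2/7}d_B^{6/7}d_C^{2/7}}{\varepsilon^{8/7}}\right\}\right\},\qquad f_{\mathrm{asym}}=\min\left\{\frac{d_A^{3/4}d_B^{3/4}d_C^{1/4}}{\varepsilon},\frac{d_A^{2/3}d_B^{2/3}d_C^{1/3}}{\varepsilon^{4/3}}\right\}.$$ There are absolute constants $K>0$ and $k\in\mathbb N$ such that, for all such $d_A,d_B,d_C,\varepsilon$, 1. $\mathrm{SC}_{\mathrm{CI},H}(\varepsilon,d_A,d_B,d_C)\le K\log^k\!\left(2+\frac{d_Ad_Bd_C}{\varepsilon}\right)\max\{f_{\mathrm{sym}},f_{\mathrm{asym}}\}$; 2. $\mathrm{SC}_{\mathrm{CMI}}(\varepsilon,d_A,d_B,d_C)\le K\log^k\!\left(2+\frac{d_Ad_Bd_C}{\varepsilon}\right)\max\{f_{\mathrm{sym}},f_{\mathrm{asym}}\}$;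 3. $\mathrm{SC}_{\mathrm{CMI}}(\varepsilon,d_A,d_B,d_C)\le \mathrm{SC}_{\mathrm{CI},H}(\nu,d_A,d_B,d_C)$ with $\nu=\varepsilon\big/\left(K\log\left(2+\frac{d_Ad_C}{\varepsilon}\right)\right)$. -/

import Mathlib

open scoped ENNReal

noncomputable section

namespace CMITest

/-- Kullback-Leibler divergence `∑ P log (P / Q)` (natural logarithm, `0 log 0 = 0`) of two
distributions on a finite set. It is only used where the support of `Q` contains that of `P`. -/
def klDivergence {X : Type} [Fintype X] (P Q : X → ℝ) : ℝ :=
  ∑ x, P x * Real.log (P x / Q x)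

/-- Squared Hellinger distance, with the normalization `1 / 2`. -/
def hellingerSq {X : Type} [Fintype X] (P Q : X → ℝ) : ℝ :=
  (1 / 2) * ∑ x, (Real.sqrt (P x) - Real.sqrt (Q x)) ^ 2

section Marginals

variable {A B C : Type} [Fintype A] [Fintype B] [Fintype C]

/-- The marginal `P_{AB}`. -/
def margAB (P : A × B × C → ℝ) (a : A) (b : B) : ℝ := ∑ c, P (a, b, c)

/-- The marginal `P_{BC}`. -/
def margBC (P : A × B × C → ℝ) (b : B) (c : C) : ℝ := ∑ a, P (a, b, c)

/-- The marginal `P_B`. -/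
def margB (P : A × B × C → ℝ) (b : B) : ℝ := ∑ a, ∑ c, P (a, b, c)

/-- The conditional distribution `P_{C|B}(c|b)`; its value where `P_B(b) = 0` is immaterial. -/
def condCB (P : A × B × C → ℝ) (c : C) (b : B) : ℝ := margBC P b c / margB P b

/-- The Markov reference distribution `P_{AB} P_{C|B}` built from `P_{ABC}`. -/
def markovRef (P : A × B × C → ℝ) : A × B × C → ℝ :=
  fun x => margAB P x.1 x.2.1 * condCB P x.2.2 x.2.1

end Marginals

/-- A randomized tester using `N` samples from `X`: to every list of samples it assigns the
probability (over its internal randomness) with which it answers `Yes`. -/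
abbrev Tester (N : ℕ) (X : Type) : Type := (Fin N → X) → unitInterval

/-- Probability that the tester answers `Yes` on `N` i.i.d. samples from `P`. -/
def yesProb {N : ℕ} {X : Type} [Fintype X] (P : X → ℝ) (T : Tester N X) : ℝ :=
  ∑ s : Fin N → X, (∏ i, P (s i)) * (T s : ℝ)

/-- The tester solves conditional independence testing with respect to `Δ` and threshold `ε`: for
every distribution `P` on `A × B × C`, it answers `Yes` with probability at least `2/3` if
`Δ(P_{ABC} ‖ P_{AB} P_{C|B}) = 0`, and `No` with probability at least `2/3` if
`Δ(P_{ABC} ‖ P_{AB} P_{C|B}) ≥ ε`. -/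
def SolvesCIndep {A B C : Type} [Fintype A] [Fintype B] [Fintype C]
    (Δ : (A × B × C → ℝ) → (A × B × C → ℝ) → ℝ) (ε : ℝ) {N : ℕ}
    (T : Tester N (A × B × C)) : Prop :=
  ∀ P ∈ stdSimplex ℝ (A × B × C),
    (Δ P (markovRef P) = 0 → 2 / 3 ≤ yesProb P T) ∧
    (ε ≤ Δ P (markovRef P) → 2 / 3 ≤ 1 - yesProb P T)

/-- Sample complexity of conditional independence testing: the least number `N` of samples for
which some tester solves the problem (`⊤` if there is none). -/
def scCIndep {A B C : Type} [Fintype A] [Fintype B] [Fintype C]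
    (Δ : (A × B × C → ℝ) → (A × B × C → ℝ) → ℝ) (ε : ℝ) : ℕ∞ :=
  sInf {n : ℕ∞ | ∃ N : ℕ, n = N ∧ ∃ T : Tester N (A × B × C), SolvesCIndep Δ ε T}

/-- Sample complexity of conditional independence testing in squared Hellinger distance. -/
def scHellinger (ε : ℝ) (dA dB dC : ℕ) : ℕ∞ :=
  scCIndep (A := Fin dA) (B := Fin dB) (C := Fin dC) hellingerSq ε

/-- Sample complexity of CMI testing; here `I(A:C|B) = D(P_{ABC} ‖ P_{AB} P_{C|B})`. -/
def scCMI (ε : ℝ) (dA dB dC : ℕ) : ℕ∞ :=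
  scCIndep (A := Fin dA) (B := Fin dB) (C := Fin dC) klDivergence ε

/-- The term that is symmetric in `A` and `C`. -/
def fSym (ε a b c : ℝ) : ℝ :=
  max (a ^ (1 / 2 : ℝ) * b ^ (3 / 4 : ℝ) * c ^ (1 / 2 : ℝ) / ε)
    (min (a ^ (1 / 4 : ℝ) * b ^ (7 / 8 : ℝ) * c ^ (1 / 4 : ℝ) / ε)
      (a ^ (2 / 7 : ℝ) * b ^ (6 / 7 : ℝ) * c ^ (2 / 7 : ℝ) / ε ^ (8 / 7 : ℝ)))

/-- The term that is not symmetric in `A` and `C`. -/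
def fAsym (ε a b c : ℝ) : ℝ :=
  min (a ^ (3 / 4 : ℝ) * b ^ (3 / 4 : ℝ) * c ^ (1 / 4 : ℝ) / ε)
    (a ^ (2 / 3 : ℝ) * b ^ (2 / 3 : ℝ) * c ^ (1 / 3 : ℝ) / ε ^ (4 / 3 : ℝ))

/-- `max {f_sym, f_asym}` times `K` and the polylogarithmic factor
`log (2 + d_A d_B d_C / ε) ^ k`. -/
def rate (K : ℝ) (k : ℕ) (ε a b c : ℝ) : ℝ :=
  K * Real.log (2 + a * b * c / ε) ^ k * max (fSym ε a b c) (fAsym ε a b c)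

end CMITest

end

open scoped ENNReal

noncomputable section

set_option linter.unusedSectionVars false

namespace CMITest

/-! Regard `P` as a mixture of bins `b` with weights `q b` and conditional laws `p b` on `A × C`
(`exists_joint`). Twice the squared Hellinger distance to the Markov reference is the `q`-average of
`∑ z, cellHell (p b) z`, so the task is to detect `depend (p b)`, the difference between `p b` and
the product of its marginals.

Two samples of one bin give, at every cell, an unbiased estimate of twice `depend`
(`expect_interaction`). Multiplying the estimates of two disjoint pairs, and summing over pairs and
cells, estimates the sum of `depend ^ 2`. Its variance is governed by the sum of squares of the
product of the marginals (`expect_cellStat_sub_sq_le`). This noise is reduced by flattening: rows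
and columns that occur among extra selecting samples are deleted. Heavy ones are then likely to
disappear, while cells with light row and column mostly survive (`expect_noise_le`,
`le_prob_cellStat_ge`). The samples are arranged in blocks, one per role, and a bin is used when
every block hits it. One sample per used bin and role is kept, the choice depending on the bin
labels only, so the kept samples are independent (`exists_rejection`).

Fix a base number `m` of samples. Bins with `m * q b ≥ 1` are sorted by the dyadic scale of `m * q
b`, and their cells by the dyadic levels of both marginals. One of polylogarithmically many classes
carries its share of the distance (`exists_isScaleCells`). At scale `k` about `k` samples per bin
serve as pairs, and the flattening matches the levels. Within a class the Hellinger measure is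
compared with the quadratic one, by Cauchy-Schwarz over the cells or by dividing by the marginals.
`noise_mul_le_of_signal` shows that the signal wins under a balanced and an asymmetric condition on
`m`; they produce the first term of `fSym` and `fAsym`. A bin with `m * q b < 1` is useful only if
it gets the four samples of two pairs, for which a lower bound of order `(m * q b) ^ 4` on the
probability is available; a power mean over the bins then yields the second term of `fSym`
(`le_light_signal`). The minima in the rates reflect that the number of used bins is bounded both by
`dB` and by the block length. The tester rejects when the test of one class rejects
(`scHellinger_le`).

For CMI, each cell of the Kullback-Leibler sum, corrected by `- p + r`, is at most a logarithm times
its Hellinger contribution plus a small error (`log_le_cellHell`). A Hellinger tester with threshold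
smaller by a logarithm therefore tests CMI as well (`scCMI_le_scHellinger`), and the second bound
follows from the first. -/

/-- Expectation of `f` under the weights `w` on a finite set. -/
def expect {Ω : Type} [Fintype Ω] (w f : Ω → ℝ) : ℝ := ∑ ω, w ω * f ω

/-- Product weights on a finite product. -/
def piWeight {ι X : Type} [Fintype ι] (p : ι → X → ℝ) (x : ι → X) : ℝ := ∏ i, p i (x i)

open Classical in
/-- Probability of an event under the weights `w`. -/
def prob {Ω : Type} [Fintype Ω] (w : Ω → ℝ) (S : Ω → Prop) : ℝ :=
  expect w fun ω => if S ω then 1 else 0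

/-! ### Expectation and probability on finite spaces -/

section Basic

variable {Ω : Type} [Fintype Ω] {w : Ω → ℝ}

lemma expect_add (w f g : Ω → ℝ) :
    expect w (fun ω => f ω + g ω) = expect w f + expect w g := by
  simp [expect, mul_add, Finset.sum_add_distrib]

lemma expect_sub (w f g : Ω → ℝ) :
    expect w (fun ω => f ω - g ω) = expect w f - expect w g := by
  simp [expect, mul_sub, Finset.sum_sub_distrib]

lemma expect_const_mul (w f : Ω → ℝ) (c : ℝ) :
    expect w (fun ω => c * f ω) = c * expect w f := by
  simp only [expect, Finset.mul_sum]
  exact Finset.sum_congr rfl fun ω _ => by ring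

lemma expect_mul_const (w f : Ω → ℝ) (c : ℝ) :
    expect w (fun ω => f ω * c) = expect w f * c := by
  simp only [expect, Finset.sum_mul]
  exact Finset.sum_congr rfl fun ω _ => by ring

lemma expect_sum {κ : Type} (w : Ω → ℝ) (s : Finset κ) (f : κ → Ω → ℝ) :
    expect w (fun ω => ∑ i ∈ s, f i ω) = ∑ i ∈ s, expect w (f i) := by
  simp only [expect, Finset.mul_sum]
  exact Finset.sum_comm

lemma expect_const (hw : w ∈ stdSimplex ℝ Ω) (c : ℝ) : expect w (fun _ => c) = c := by
  simp [expect, ← Finset.sum_mul, hw.2]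

lemma expect_mono (hw : w ∈ stdSimplex ℝ Ω) {f g : Ω → ℝ} (h : ∀ ω, f ω ≤ g ω) :
    expect w f ≤ expect w g :=
  Finset.sum_le_sum fun ω _ => mul_le_mul_of_nonneg_left (h ω) (hw.1 ω)

lemma expect_nonneg (hw : w ∈ stdSimplex ℝ Ω) {f : Ω → ℝ} (h : ∀ ω, 0 ≤ f ω) :
    0 ≤ expect w f :=
  Finset.sum_nonneg fun ω _ => mul_nonneg (hw.1 ω) (h ω)

lemma expect_comm {Ω' : Type} [Fintype Ω'] (w : Ω → ℝ) (w' : Ω' → ℝ) (f : Ω → Ω' → ℝ) :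
    expect w (fun ω => expect w' (f ω)) = expect w' (fun ω' => expect w fun ω => f ω ω') := by
  simp only [expect, Finset.mul_sum]
  rw [Finset.sum_comm]
  exact Finset.sum_congr rfl fun _ _ => Finset.sum_congr rfl fun _ _ => by ring

lemma expect_prod {Ω' : Type} [Fintype Ω'] (w : Ω → ℝ) (w' : Ω' → ℝ) (f : Ω × Ω' → ℝ) :
    expect (fun x : Ω × Ω' => w x.1 * w' x.2) f =
      expect w (fun ω => expect w' fun ω' => f (ω, ω')) := by
  simp only [expect, Finset.mul_sum, Fintype.sum_prod_type]
  exact Finset.sum_congr rfl fun _ _ => Finset.sum_congr rfl fun _ _ => by ring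

lemma prod_mem_stdSimplex {Ω' : Type} [Fintype Ω'] {w' : Ω' → ℝ} (hw : w ∈ stdSimplex ℝ Ω)
    (hw' : w' ∈ stdSimplex ℝ Ω') :
    (fun x : Ω × Ω' => w x.1 * w' x.2) ∈ stdSimplex ℝ (Ω × Ω') := by
  refine ⟨fun x => mul_nonneg (hw.1 _) (hw'.1 _), ?_⟩
  rw [Fintype.sum_prod_type]
  simp [← Finset.mul_sum, hw.2, hw'.2]

lemma prob_nonneg (hw : w ∈ stdSimplex ℝ Ω) (S : Ω → Prop) : 0 ≤ prob w S :=
  expect_nonneg hw fun ω => by split_ifs <;> norm_num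

lemma prob_le_one (hw : w ∈ stdSimplex ℝ Ω) (S : Ω → Prop) : prob w S ≤ 1 := by
  calc prob w S ≤ expect w (fun _ => (1 : ℝ)) :=
        expect_mono hw fun ω => by split_ifs <;> norm_num
    _ = 1 := expect_const hw 1

lemma prob_mono (hw : w ∈ stdSimplex ℝ Ω) {S S' : Ω → Prop} (h : ∀ ω, S ω → S' ω) :
    prob w S ≤ prob w S' :=
  expect_mono hw fun ω => by
    by_cases hS : S ω
    · simp [hS, h ω hS]
    · simp only [hS, if_false]; split_ifs <;> norm_num

lemma prob_not (hw : w ∈ stdSimplex ℝ Ω) (S : Ω → Prop) :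
    prob w (fun ω => ¬ S ω) = 1 - prob w S := by
  rw [eq_sub_iff_add_eq, prob, prob, ← expect_add]
  refine Eq.trans ?_ (expect_const hw (1 : ℝ))
  congr 1; ext ω; by_cases h : S ω <;> simp [h]

lemma prob_exists_le {κ : Type} (hw : w ∈ stdSimplex ℝ Ω) (s : Finset κ) (S : κ → Ω → Prop) :
    prob w (fun ω => ∃ i ∈ s, S i ω) ≤ ∑ i ∈ s, prob w (S i) := by
  classical
  simp only [prob]
  rw [← expect_sum]
  refine expect_mono hw fun ω => ?_
  split_ifs with h
  · obtain ⟨i, hi, hS⟩ := h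
    refine le_trans ?_ (Finset.single_le_sum (f := fun i => if S i ω then (1 : ℝ) else 0)
      (fun j _ => by split_ifs <;> norm_num) hi)
    simp [hS]
  · exact Finset.sum_nonneg fun j _ => by split_ifs <;> norm_num

/-- Markov's inequality. -/
lemma prob_le_expect_div (hw : w ∈ stdSimplex ℝ Ω) {f : Ω → ℝ} (hf : ∀ ω, 0 ≤ f ω) {t : ℝ}
    (ht : 0 < t) : prob w (fun ω => t ≤ f ω) ≤ expect w f / t := by
  rw [div_eq_mul_inv, ← expect_mul_const]
  refine expect_mono hw fun ω => ?_
  split_ifs with h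
  · rw [← div_eq_mul_inv, le_div_iff₀ ht]; linarith
  · exact mul_nonneg (hf ω) (by positivity)

/-- Splitting an expectation according to a bad event. -/
lemma expect_le_prob_add (hw : w ∈ stdSimplex ℝ Ω) {f : Ω → ℝ} (S : Ω → Prop) {c : ℝ}
    (hc : 0 ≤ c) (h1 : ∀ ω, f ω ≤ 1) (h : ∀ ω, ¬ S ω → f ω ≤ c) :
    expect w f ≤ prob w S + c := by
  have hcc := expect_const hw c
  rw [prob, ← hcc, ← expect_add]
  refine expect_mono hw fun ω => ?_
  by_cases hS : S ω
  · simp only [hS, if_true]; linarith [h1 ω]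
  · simp only [hS, if_false]; linarith [h ω hS]

lemma sub_prob_le_expect (hw : w ∈ stdSimplex ℝ Ω) {f : Ω → ℝ} (S : Ω → Prop) {c : ℝ}
    (hc : c ≤ 1) (h0 : ∀ ω, 0 ≤ f ω) (h : ∀ ω, ¬ S ω → c ≤ f ω) :
    c - prob w S ≤ expect w f := by
  have h1 := expect_le_prob_add hw (f := fun ω => 1 - f ω) S (sub_nonneg.2 hc)
    (fun ω => by linarith [h0 ω]) (fun ω hω => by linarith [h ω hω])
  rw [expect_sub, expect_const hw] at h1
  linarith

end Basic

/-! ### Independent coordinates -/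

section Product

variable {ι X : Type} [Fintype ι] [DecidableEq ι] [Fintype X]

/-- The expectation of a product of functions of the coordinates. -/
lemma expect_piWeight_prod (p : ι → X → ℝ) (g : ι → X → ℝ) :
    expect (piWeight p) (fun x => ∏ i, g i (x i)) = ∏ i, expect (p i) (g i) := by
  simp only [expect, piWeight, ← Finset.prod_mul_distrib]
  rw [Finset.prod_univ_sum]
  simp

lemma piWeight_mem_stdSimplex {p : ι → X → ℝ} (hp : ∀ i, p i ∈ stdSimplex ℝ X) :
    piWeight p ∈ stdSimplex ℝ (ι → X) := by
  refine ⟨fun x => Finset.prod_nonneg fun i _ => (hp i).1 _, ?_⟩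
  have := expect_piWeight_prod p (fun _ _ => 1)
  simp only [Finset.prod_const_one, expect, mul_one] at this
  rw [this]
  exact Finset.prod_eq_one fun i _ => (hp i).2

lemma expect_piWeight_equiv {κ : Type} [Fintype κ] [DecidableEq κ] (e : κ ≃ ι) (p : ι → X → ℝ)
    (G : (κ → X) → ℝ) :
    expect (piWeight p) (fun x => G (x ∘ e)) = expect (piWeight fun j => p (e j)) G := by
  refine Fintype.sum_equiv (Equiv.arrowCongr e.symm (Equiv.refl X)) _ _ fun x => ?_
  have : (Equiv.arrowCongr e.symm (Equiv.refl X)) x = x ∘ e := by ext j; simp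
  rw [this, piWeight, piWeight]
  congr 1
  exact (Fintype.prod_equiv e _ _ fun j => rfl).symm

lemma expect_piWeight_sum {κ : Type} [Fintype κ] [DecidableEq κ] (p : ι ⊕ κ → X → ℝ)
    (G : (ι → X) → (κ → X) → ℝ) :
    expect (piWeight p) (fun x => G (x ∘ Sum.inl) (x ∘ Sum.inr)) =
      expect (piWeight fun i => p (Sum.inl i)) (fun y =>
        expect (piWeight fun j => p (Sum.inr j)) fun z => G y z) := by
  rw [← expect_prod _ _ (fun yz => G yz.1 yz.2)]
  refine Fintype.sum_equiv (Equiv.sumArrowEquivProdArrow ι κ X) _ _ fun x => ?_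
  simp only [piWeight, Fintype.prod_sum_type]
  rfl

/-- Only the coordinates in the range of an injection matter. -/
lemma expect_piWeight_comp {κ : Type} [Fintype κ] [DecidableEq κ] {e : κ → ι}
    (he : Function.Injective e) {p : ι → X → ℝ} (hp : ∀ i, p i ∈ stdSimplex ℝ X)
    (G : (κ → X) → ℝ) :
    expect (piWeight p) (fun x => G (x ∘ e)) = expect (piWeight fun j => p (e j)) G := by
  classical
  let e' : κ ⊕ {i // i ∉ Set.range e} ≃ ι :=
    (Equiv.sumCongr (Equiv.ofInjective e he) (Equiv.refl _)).trans
      (Equiv.sumCompl fun i => i ∈ Set.range e)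
  have h1 := expect_piWeight_equiv e' p (fun x => G (x ∘ Sum.inl))
  have h2 : ∀ x : ι → X, (x ∘ e') ∘ Sum.inl = x ∘ e := fun x => by
    ext j; simp [e']
  simp only [h2] at h1
  rw [h1, expect_piWeight_sum (fun j => p (e' j)) (fun y _ => G y)]
  have h3 : ∀ c : ℝ, expect (piWeight fun j => p (e' (Sum.inr j))) (fun _ => c) = c :=
    fun c => expect_const (piWeight_mem_stdSimplex fun j => hp _) c
  simp only [h3]
  rfl

/-- Disjoint groups of coordinates are independent. -/
lemma expect_piWeight_comp₂ {κ κ' : Type} [Fintype κ] [DecidableEq κ] [Fintype κ']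
    [DecidableEq κ'] {e : κ → ι} {e' : κ' → ι} (he : Function.Injective (Sum.elim e e'))
    {p : ι → X → ℝ} (hp : ∀ i, p i ∈ stdSimplex ℝ X) (G : (κ → X) → (κ' → X) → ℝ) :
    expect (piWeight p) (fun x => G (x ∘ e) (x ∘ e')) =
      expect (piWeight fun j => p (e j)) (fun y =>
        expect (piWeight fun j => p (e' j)) fun z => G y z) := by
  have h := expect_piWeight_comp he hp (fun x => G (x ∘ Sum.inl) (x ∘ Sum.inr))
  rw [expect_piWeight_sum] at h
  exact h

lemma expect_piWeight_unit (p : Unit → X → ℝ) (G : X → ℝ) :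
    expect (piWeight p) (fun x => G (x ())) = expect (p ()) G := by
  refine Fintype.sum_equiv (Equiv.funUnique Unit X) _ _ fun x => ?_
  simp [piWeight]

lemma expect_piWeight_apply {p : ι → X → ℝ} (hp : ∀ i, p i ∈ stdSimplex ℝ X) (i : ι)
    (f : X → ℝ) : expect (piWeight p) (fun x => f (x i)) = expect (p i) f := by
  rw [← expect_piWeight_unit (fun _ => p i),
    ← expect_piWeight_comp (e := fun _ : Unit => i) (fun _ _ _ => rfl) hp (fun y => f (y ()))]
  rfl

lemma expect_piWeight_apply_mul {p : ι → X → ℝ} (hp : ∀ i, p i ∈ stdSimplex ℝ X) {i j : ι}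
    (hij : i ≠ j) (f g : X → ℝ) :
    expect (piWeight p) (fun x => f (x i) * g (x j)) = expect (p i) f * expect (p j) g := by
  have he : Function.Injective (Sum.elim (fun _ : Unit => i) (fun _ : Unit => j)) := by
    rintro (⟨⟩ | ⟨⟩) (⟨⟩ | ⟨⟩) h <;> simp_all
  have h := expect_piWeight_comp₂ he hp (fun y z => f (y ()) * g (z ()))
  simp only [Function.comp_apply] at h
  rw [h]
  simp only [expect_const_mul]
  rw [expect_mul_const (f := fun y : Unit → X => f (y ())), expect_piWeight_unit,
    expect_piWeight_unit]

/-- Second moment, about any point, of a sum of functions of independent coordinates. -/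
lemma expect_sq_sum_sub_le {p : ι → X → ℝ} (hp : ∀ i, p i ∈ stdSimplex ℝ X) (f : ι → X → ℝ)
    (c : ℝ) :
    expect (piWeight p) (fun x => (∑ i, f i (x i) - c) ^ 2) ≤
      ∑ i, expect (p i) (fun x => f i x ^ 2) + (∑ i, expect (p i) (f i) - c) ^ 2 := by
  have hpi := piWeight_mem_stdSimplex hp
  have hexp : ∀ x : ι → X, (∑ i, f i (x i) - c) ^ 2 =
      ∑ i, ∑ j, f i (x i) * f j (x j) - 2 * c * ∑ i, f i (x i) + c ^ 2 := fun x => by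
    rw [← Finset.sum_mul_sum]; ring
  simp only [hexp]
  rw [expect_add, expect_sub, expect_const_mul, expect_const hpi, expect_sum, expect_sum]
  simp only [expect_sum, expect_piWeight_apply hp]
  -- The diagonal bound keeps the square of the mean as a surplus, so that the product terms over
  -- all pairs add up to the square of the total mean.
  have hpair : ∀ i j, expect (piWeight p) (fun x => f i (x i) * f j (x j)) ≤
      expect (p i) (f i) * expect (p j) (f j) +
        if i = j then expect (p i) (fun x => f i x ^ 2) else 0 := fun i j => by
    by_cases hij : i = j
    · subst hij
      have h := expect_piWeight_apply hp i (fun x => f i x ^ 2)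
      simp only [pow_two] at h ⊢
      rw [h, if_pos trivial]
      nlinarith [mul_self_nonneg (expect (p i) (f i))]
    · rw [expect_piWeight_apply_mul hp hij, if_neg hij, add_zero]
  have hsum := Finset.sum_le_sum fun i (_ : i ∈ Finset.univ) =>
    Finset.sum_le_sum fun j (_ : j ∈ Finset.univ) => hpair i j
  simp only [Finset.sum_add_distrib, Finset.sum_ite_eq, Finset.mem_univ, if_true,
    ← Finset.sum_mul_sum] at hsum
  nlinarith [hsum]

lemma expect_piWeight_curry {κ : Type} [Fintype κ] [DecidableEq κ] (p : ι × κ → X → ℝ)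
    (G : (ι → κ → X) → ℝ) :
    expect (piWeight p) (fun x => G fun i j => x (i, j)) =
      expect (piWeight fun i => piWeight fun j => p (i, j)) G := by
  refine Fintype.sum_equiv (Equiv.curry ι κ X) _ _ fun x => ?_
  simp only [piWeight, Fintype.prod_prod_type]
  rfl

/-- Coordinates with values in pairs, where the second component depends on the first. -/
lemma expect_piWeight_pair {Y : Type} [Fintype Y] (p : ι → X → ℝ) (p' : ι → X → Y → ℝ)
    (G : (ι → X) → (ι → Y) → ℝ) :
    expect (piWeight fun i => fun xy : X × Y => p i xy.1 * p' i xy.1 xy.2)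
        (fun z => G (fun i => (z i).1) fun i => (z i).2) =
      expect (piWeight p) (fun y => expect (piWeight fun i => p' i (y i)) fun z => G y z) := by
  have h : ∀ y : ι → X, ∀ z : ι → Y, piWeight p y * (piWeight (fun i => p' i (y i)) z * G y z) =
      (∏ i, p i (y i) * p' i (y i) (z i)) * G y z := fun y z => by
    rw [Finset.prod_mul_distrib, piWeight, piWeight, mul_assoc]
  simp only [expect, Finset.mul_sum, h]
  rw [← Fintype.sum_prod_type' (f := fun (y : ι → X) (z : ι → Y) =>
    (∏ i, p i (y i) * p' i (y i) (z i)) * G y z)]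
  exact Fintype.sum_equiv (Equiv.arrowProdEquivProdArrow ι (fun _ => X) (fun _ => Y)) _ _
    fun x => rfl

lemma expect_piWeight_map {Y : Type} [Fintype Y] (e : Y ≃ X) (p : ι → X → ℝ)
    (G : (ι → X) → ℝ) :
    expect (piWeight fun i y => p i (e y)) (fun s => G fun i => e (s i)) =
      expect (piWeight p) G :=
  Fintype.sum_equiv (Equiv.piCongrRight fun _ => e) _ _ fun _ => rfl

end Product

/-! ### Moments of bilinear statistics -/

section Kernel

variable {I Θ : Type} [Fintype I] [DecidableEq I] [Fintype Θ]

/-- The bilinear statistic `∑ g_b(ξ_{b,i}, η_{b,j})` over all pairs of samples of every bin. -/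
def kernelStat {k : ℕ} (g : I → Θ → Θ → ℝ) (ξ η : I × Fin k → Θ) : ℝ :=
  ∑ b, ∑ j, ∑ i, g b (ξ (b, i)) (η (b, j))

/-- Variance of the bilinear statistic for symmetric kernels. -/
lemma expect_kernelStat_sub_sq_le {k : ℕ} {π : I → Θ → ℝ} (hπ : ∀ b, π b ∈ stdSimplex ℝ Θ)
    (g : I → Θ → Θ → ℝ) (hg : ∀ b θ θ', g b θ θ' = g b θ' θ) :
    expect (piWeight fun bi : I × Fin k => π bi.1) (fun ξ =>
      expect (piWeight fun bi : I × Fin k => π bi.1) fun η =>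
        (kernelStat g ξ η -
          (k : ℝ) ^ 2 * ∑ b, expect (π b) fun θ => expect (π b) fun θ' => g b θ θ') ^ 2) ≤
      (k : ℝ) ^ 2 * (∑ b, expect (π b) fun θ => expect (π b) fun θ' => g b θ θ' ^ 2) +
      2 * (k : ℝ) ^ 3 * ∑ b, expect (π b) fun θ => (expect (π b) fun θ' => g b θ θ') ^ 2 := by
  set w := piWeight fun bi : I × Fin k => π bi.1 with hw
  have hp : ∀ bi : I × Fin k, π bi.1 ∈ stdSimplex ℝ Θ := fun bi => hπ _
  have hws : w ∈ stdSimplex ℝ (I × Fin k → Θ) := piWeight_mem_stdSimplex hp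
  set gm : I → Θ → ℝ := fun b θ => expect (π b) fun θ' => g b θ θ' with hgm
  set c := (k : ℝ) ^ 2 * ∑ b, expect (π b) (gm b) with hc
  -- For fixed `ξ` the statistic is a sum of independent functions of the samples `η`. Its second
  -- moment about `c` is bounded by their second moments plus the squared deviation of the
  -- conditional mean, which is `k` times a sum over `ξ`.
  have hstep : ∀ ξ, expect w (fun η => (kernelStat g ξ η - c) ^ 2) ≤
      (k : ℝ) * (∑ b, expect (π b) fun θ => (∑ i, g b (ξ (b, i)) θ) ^ 2) +
        (k : ℝ) ^ 2 * (∑ bi : I × Fin k, gm bi.1 (ξ bi) - k * ∑ b, expect (π b) (gm b)) ^ 2 := by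
    intro ξ
    have h := expect_sq_sum_sub_le hp (fun bj θ => ∑ i, g bj.1 (ξ (bj.1, i)) θ) c
    have e1 : ∀ η : I × Fin k → Θ, ∑ bj : I × Fin k, ∑ i, g bj.1 (ξ (bj.1, i)) (η bj) =
        kernelStat g ξ η := fun η => by rw [Fintype.sum_prod_type]; rfl
    simp only [e1] at h
    refine h.trans (le_of_eq ?_)
    simp only [expect_sum, Fintype.sum_prod_type, Finset.sum_const, Finset.card_univ,
      Fintype.card_fin, nsmul_eq_mul, ← Finset.mul_sum, hc]
    simp only [hgm]
    ring
  have hcross : ∀ b θ, expect w (fun ξ => (∑ i, g b (ξ (b, i)) θ) ^ 2) ≤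
      k * expect (π b) (fun θ' => g b θ θ' ^ 2) + (k : ℝ) ^ 2 * gm b θ ^ 2 := by
    intro b θ
    have h := expect_sq_sum_sub_le hp
      (fun bi θ' => if bi.1 = b then g b θ' θ else 0) 0
    have e1 : ∀ ξ : I × Fin k → Θ, ∑ bi : I × Fin k, (if bi.1 = b then g b (ξ bi) θ else 0) =
        ∑ i, g b (ξ (b, i)) θ := fun ξ => by
      rw [Fintype.sum_prod_type, Finset.sum_eq_single b]
      · simp
      · intro b' _ hb'; simp [hb']
      · simp
    simp only [e1, sub_zero] at h
    refine h.trans (le_of_eq ?_)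
    congr 1
    · rw [Fintype.sum_prod_type, Finset.sum_eq_single b]
      · simp [hg b θ]
      · intro b' _ hb'; simp [hb', expect]
      · simp
    · rw [Fintype.sum_prod_type, Finset.sum_eq_single b]
      · simp [hgm, hg b θ, mul_pow]
      · intro b' _ hb'; simp [hb', expect]
      · simp
  -- Here the centre is the exact mean, so only the second moments of the summands remain.
  have hmean : expect w (fun ξ =>
      (∑ bi : I × Fin k, gm bi.1 (ξ bi) - k * ∑ b, expect (π b) (gm b)) ^ 2) ≤
      k * ∑ b, expect (π b) (fun θ => gm b θ ^ 2) := by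
    refine (expect_sq_sum_sub_le hp (fun bi => gm bi.1) _).trans (le_of_eq ?_)
    simp only [Fintype.sum_prod_type, Finset.sum_const, Finset.card_univ,
      Fintype.card_fin, nsmul_eq_mul, ← Finset.mul_sum]
    ring
  have hfirst : expect w (fun ξ => ∑ b, expect (π b) fun θ => (∑ i, g b (ξ (b, i)) θ) ^ 2) ≤
      ∑ b, (k * expect (π b) (fun θ => expect (π b) fun θ' => g b θ θ' ^ 2) +
        (k : ℝ) ^ 2 * expect (π b) fun θ => gm b θ ^ 2) := by
    rw [expect_sum]
    refine Finset.sum_le_sum fun b _ => ?_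
    rw [expect_comm]
    refine (expect_mono (hπ b) (hcross b)).trans (le_of_eq ?_)
    rw [expect_add, expect_const_mul, expect_const_mul]
  refine (expect_mono hws hstep).trans ?_
  rw [expect_add, expect_const_mul, expect_const_mul]
  have hk : (0 : ℝ) ≤ k := Nat.cast_nonneg k
  have h1 := mul_le_mul_of_nonneg_left hfirst hk
  have h2 := mul_le_mul_of_nonneg_left hmean (sq_nonneg (k : ℝ))
  rw [Finset.sum_add_distrib, ← Finset.mul_sum, ← Finset.mul_sum] at h1
  linarith

/-- Cauchy-Schwarz bound of the off-diagonal term for a kernel with features `φ` and weights `ω`. -/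
lemma sq_expect_sq_le {Z : Type} [Fintype Z] (π : Θ → ℝ) {ω : Z → ℝ} (hω : ∀ z, 0 ≤ ω z)
    (φ : Θ → Z → ℝ) :
    (expect π fun θ => (∑ z, ω z * φ θ z * expect π fun θ' => φ θ' z) ^ 2) ^ 2 ≤
      (∑ z, ω z * (expect π fun θ' => φ θ' z) ^ 2) ^ 2 *
        expect π (fun θ => expect π fun θ' => (∑ z, ω z * φ θ z * φ θ' z) ^ 2) := by
  set μ : Z → ℝ := fun z => expect π fun θ' => φ θ' z with hμ
  -- `M` is the second moment matrix of the features. The left side pairs it with the rank-one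
  -- matrix of means, and the second moment of the kernel is its weighted Hilbert-Schmidt norm
  -- squared; the weights are shared out as square roots for Cauchy-Schwarz.
  set M : Z × Z → ℝ := fun y => expect π fun θ => φ θ y.1 * φ θ y.2 with hM
  have e1 : (expect π fun θ => (∑ z, ω z * φ θ z * μ z) ^ 2) =
      ∑ y : Z × Z, (Real.sqrt (ω y.1 * ω y.2) * (μ y.1 * μ y.2)) *
        (Real.sqrt (ω y.1 * ω y.2) * M y) := by
    have : ∀ θ, (∑ z, ω z * φ θ z * μ z) ^ 2 =
        ∑ y : Z × Z, (ω y.1 * ω y.2 * (μ y.1 * μ y.2)) * (φ θ y.1 * φ θ y.2) := fun θ => by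
      rw [pow_two, Finset.sum_mul_sum, Fintype.sum_prod_type]
      exact Finset.sum_congr rfl fun _ _ => Finset.sum_congr rfl fun _ _ => by ring
    simp only [this, expect_sum, expect_const_mul]
    refine Finset.sum_congr rfl fun y _ => ?_
    have hs := Real.mul_self_sqrt (mul_nonneg (hω y.1) (hω y.2))
    change ω y.1 * ω y.2 * (μ y.1 * μ y.2) * M y = _
    linear_combination (-(μ y.1 * μ y.2 * M y)) * hs
  have e2 : ∑ y : Z × Z, (Real.sqrt (ω y.1 * ω y.2) * (μ y.1 * μ y.2)) ^ 2 =
      (∑ z, ω z * μ z ^ 2) ^ 2 := by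
    rw [pow_two (∑ z, _), Finset.sum_mul_sum, Fintype.sum_prod_type]
    refine Finset.sum_congr rfl fun y _ => Finset.sum_congr rfl fun z _ => ?_
    rw [mul_pow, Real.sq_sqrt (mul_nonneg (hω _) (hω _))]; ring
  have e3 : ∑ y : Z × Z, (Real.sqrt (ω y.1 * ω y.2) * M y) ^ 2 =
      expect π (fun θ => expect π fun θ' => (∑ z, ω z * φ θ z * φ θ' z) ^ 2) := by
    have : ∀ θ θ', (∑ z, ω z * φ θ z * φ θ' z) ^ 2 =
        ∑ y : Z × Z, (ω y.1 * ω y.2 * (φ θ y.1 * φ θ y.2)) * (φ θ' y.1 * φ θ' y.2) :=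
      fun θ θ' => by
        rw [pow_two, Finset.sum_mul_sum, Fintype.sum_prod_type]
        exact Finset.sum_congr rfl fun _ _ => Finset.sum_congr rfl fun _ _ => by ring
    simp only [this, expect_sum, expect_const_mul]
    refine Finset.sum_congr rfl fun y _ => ?_
    rw [mul_pow, Real.sq_sqrt (mul_nonneg (hω _) (hω _)), expect_mul_const, expect_const_mul]
    simp only [hM]
    ring
  rw [e1, ← e2, ← e3]
  exact Finset.sum_mul_sq_le_sq_mul_sq _ _ _

end Kernel

/-! ### The interaction of two samples -/

section Features

variable {A C : Type} [Fintype A] [Fintype C]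

/-- First marginal of a distribution on pairs. -/
def margFst (p : A × C → ℝ) (a : A) : ℝ := ∑ c, p (a, c)

/-- Second marginal of a distribution on pairs. -/
def margSnd (p : A × C → ℝ) (c : C) : ℝ := ∑ a, p (a, c)

/-- Deviation of a distribution on pairs from the product of its marginals. -/
def depend (p : A × C → ℝ) (z : A × C) : ℝ := p z - margFst p z.1 * margSnd p z.2

lemma margFst_mem {p : A × C → ℝ} (hp : p ∈ stdSimplex ℝ (A × C)) :
    margFst p ∈ stdSimplex ℝ A :=
  ⟨fun _ => Finset.sum_nonneg fun _ _ => hp.1 _, by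
    simp only [margFst]; rw [← Fintype.sum_prod_type]; exact hp.2⟩

lemma margSnd_mem {p : A × C → ℝ} (hp : p ∈ stdSimplex ℝ (A × C)) :
    margSnd p ∈ stdSimplex ℝ C :=
  ⟨fun _ => Finset.sum_nonneg fun _ _ => hp.1 _, by
    simp only [margSnd]; rw [← Fintype.sum_prod_type_right]; exact hp.2⟩

lemma expect_fst (p : A × C → ℝ) (f : A → ℝ) :
    expect p (fun z => f z.1) = expect (margFst p) f := by
  simp [expect, margFst, Fintype.sum_prod_type, Finset.sum_mul]

lemma expect_snd (p : A × C → ℝ) (f : C → ℝ) :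
    expect p (fun z => f z.2) = expect (margSnd p) f := by
  simp [expect, margSnd, Fintype.sum_prod_type_right, Finset.sum_mul]

/-- Weights of an independent pair of samples. -/
def pairWeight {X : Type} (p : X → ℝ) (x : X × X) : ℝ := p x.1 * p x.2

lemma pairWeight_mem {X : Type} [Fintype X] {p : X → ℝ} (hp : p ∈ stdSimplex ℝ X) :
    pairWeight p ∈ stdSimplex ℝ (X × X) := prod_mem_stdSimplex hp hp

/-- Expectation over two samples of a function of the four cells they span. -/
lemma expect_pairWeight_cells {p : A × C → ℝ} (hp : p ∈ stdSimplex ℝ (A × C)) (f : A × C → ℝ)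
    (s t : ℝ) :
    expect (pairWeight p) (fun x => s * f (x.1.1, x.1.2) + t * f (x.1.1, x.2.2) +
      t * f (x.2.1, x.1.2) + s * f (x.2.1, x.2.2)) =
      2 * ∑ z, (s * p z + t * (margFst p z.1 * margSnd p z.2)) * f z := by
  have h1 : expect (pairWeight p) (fun x => f (x.1.1, x.1.2)) = ∑ z, p z * f z := by
    refine (expect_prod p p _).trans ?_
    simp only [expect_const hp]; rfl
  have h2 : expect (pairWeight p) (fun x => f (x.2.1, x.2.2)) = ∑ z, p z * f z := by
    refine (expect_prod p p _).trans ?_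
    exact expect_const hp (∑ z, p z * f z)
  have h3 : expect (pairWeight p) (fun x => f (x.1.1, x.2.2)) =
      ∑ z : A × C, margFst p z.1 * margSnd p z.2 * f z := by
    refine (expect_prod p p _).trans ?_
    have hs : ∀ a, expect p (fun z => f (a, z.2)) = expect (margSnd p) fun c => f (a, c) :=
      fun a => expect_snd p fun c => f (a, c)
    simp only [hs]
    rw [expect_fst p (fun a => expect (margSnd p) fun c => f (a, c))]
    simp only [expect, Finset.mul_sum, Fintype.sum_prod_type]
    exact Finset.sum_congr rfl fun _ _ => Finset.sum_congr rfl fun _ _ => by ring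
  have h4 : expect (pairWeight p) (fun x => f (x.2.1, x.1.2)) =
      ∑ z : A × C, margFst p z.1 * margSnd p z.2 * f z := by
    rw [← h3]
    refine (expect_prod p p _).trans (Eq.trans ?_ (expect_prod p p _).symm)
    exact expect_comm _ _ _
  simp only [expect_add, expect_const_mul, h1, h2, h3, h4, Finset.mul_sum]
  simp only [← Finset.sum_add_distrib]
  exact Finset.sum_congr rfl fun z _ => by ring

variable [DecidableEq A] [DecidableEq C]

/-- The indicator of equality, as a real number. -/
def delta {X : Type} [DecidableEq X] (x y : X) : ℝ := if x = y then 1 else 0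

/-- The interaction of two samples at the cell `z`; its mean is twice `depend`. -/
def interaction (x : (A × C) × (A × C)) (z : A × C) : ℝ :=
  (delta x.1.1 z.1 - delta x.2.1 z.1) * (delta x.1.2 z.2 - delta x.2.2 z.2)

/-- The product of differences expands into signed indicators of the two sampled cells and of the
two cells obtained by exchanging second components. The former have law `p` and the latter the
product of the marginals, which is why the mean measures dependence. -/
lemma interaction_eq {A C : Type} [DecidableEq A] [DecidableEq C]
    (x : (A × C) × (A × C)) (z : A × C) :
    interaction x z = delta (x.1.1, x.1.2) z - delta (x.1.1, x.2.2) z - delta (x.2.1, x.1.2) z +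
      delta (x.2.1, x.2.2) z := by
  obtain ⟨⟨a, c⟩, ⟨a', c'⟩⟩ := x
  obtain ⟨a₀, c₀⟩ := z
  simp only [interaction, delta, Prod.mk.injEq]
  by_cases h1 : a = a₀ <;> by_cases h2 : a' = a₀ <;> by_cases h3 : c = c₀ <;>
    by_cases h4 : c' = c₀ <;> simp [h1, h2, h3, h4]

lemma interaction_sq_le {A C : Type} [DecidableEq A] [DecidableEq C]
    (x : (A × C) × (A × C)) (z : A × C) :
    interaction x z ^ 2 ≤ delta (x.1.1, x.1.2) z + delta (x.1.1, x.2.2) z +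
      delta (x.2.1, x.1.2) z + delta (x.2.1, x.2.2) z := by
  obtain ⟨⟨a, c⟩, ⟨a', c'⟩⟩ := x
  obtain ⟨a₀, c₀⟩ := z
  simp only [interaction, delta, Prod.mk.injEq]
  by_cases h1 : a = a₀ <;> by_cases h2 : a' = a₀ <;> by_cases h3 : c = c₀ <;>
    by_cases h4 : c' = c₀ <;> (simp [h1, h2, h3, h4]; try norm_num)

lemma expect_interaction {p : A × C → ℝ} (hp : p ∈ stdSimplex ℝ (A × C)) (z : A × C) :
    expect (pairWeight p) (fun x => interaction x z) = 2 * depend p z := by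
  have h := expect_pairWeight_cells hp (fun y => delta y z) 1 (-1)
  have e : ∀ x : (A × C) × (A × C), interaction x z =
      1 * delta (x.1.1, x.1.2) z + -1 * delta (x.1.1, x.2.2) z +
      -1 * delta (x.2.1, x.1.2) z + 1 * delta (x.2.1, x.2.2) z := fun x => by
    rw [interaction_eq]; ring
  simp only [e]
  rw [h]
  simp [delta, depend, sub_eq_add_neg]

lemma expect_interaction_sq_le {p : A × C → ℝ} (hp : p ∈ stdSimplex ℝ (A × C)) (z : A × C) :
    expect (pairWeight p) (fun x => interaction x z ^ 2) ≤
      2 * (p z + margFst p z.1 * margSnd p z.2) := by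
  have h := expect_pairWeight_cells hp (fun y => delta y z) 1 1
  refine (expect_mono (pairWeight_mem hp) fun x => interaction_sq_le x z).trans (le_of_eq ?_)
  simp only [one_mul] at h
  rw [h]
  simp [delta]

/-- Second moment of the weighted kernel of interactions, for 0-1 weights. -/
lemma expect_kernel_sq_le {p : A × C → ℝ} (hp : p ∈ stdSimplex ℝ (A × C)) {ω : A × C → ℝ}
    (hω : ∀ z, ω z = 0 ∨ ω z = 1) :
    expect (pairWeight p) (fun x => expect (pairWeight p) fun y =>
        (∑ z, ω z * interaction x z * interaction y z) ^ 2) ≤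
      8 * (∑ z, ω z * (expect (pairWeight p) fun x => interaction x z) ^ 2) +
        128 * ∑ z : A × C, ω z * (margFst p z.1 * margSnd p z.2) ^ 2 := by
  have hpp := pairWeight_mem hp
  have hωsq : ∀ z, ω z ^ 2 = ω z := fun z => by rcases hω z with h | h <;> simp [h]
  have hω0 : ∀ z, 0 ≤ ω z := fun z => by rcases hω z with h | h <;> simp [h]
  have hq0 : ∀ z : A × C, 0 ≤ margFst p z.1 * margSnd p z.2 := fun z =>
    mul_nonneg ((margFst_mem hp).1 _) ((margSnd_mem hp).1 _)
  rw [expect_comm]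
  -- With `y` fixed the sum over `z` collapses to the four cells spanned by `x`; the square of a sum
  -- of four terms costs a factor `4`, and 0-1 weights are their own squares.
  have hinner : ∀ y : (A × C) × (A × C), expect (pairWeight p) (fun x =>
      (∑ z, ω z * interaction x z * interaction y z) ^ 2) ≤
      8 * ∑ z : A × C, (p z + margFst p z.1 * margSnd p z.2) * (ω z * interaction y z ^ 2) := by
    intro y
    have hsq : ∀ x : (A × C) × (A × C), (∑ z, ω z * interaction x z * interaction y z) ^ 2 ≤
        4 * (ω (x.1.1, x.1.2) * interaction y (x.1.1, x.1.2) ^ 2) +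
        4 * (ω (x.1.1, x.2.2) * interaction y (x.1.1, x.2.2) ^ 2) +
        4 * (ω (x.2.1, x.1.2) * interaction y (x.2.1, x.1.2) ^ 2) +
        4 * (ω (x.2.1, x.2.2) * interaction y (x.2.1, x.2.2) ^ 2) := by
      intro x
      have e : ∑ z, ω z * interaction x z * interaction y z =
          ω (x.1.1, x.1.2) * interaction y (x.1.1, x.1.2) -
          ω (x.1.1, x.2.2) * interaction y (x.1.1, x.2.2) -
          ω (x.2.1, x.1.2) * interaction y (x.2.1, x.1.2) +
          ω (x.2.1, x.2.2) * interaction y (x.2.1, x.2.2) := by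
        have : ∀ z, ω z * interaction x z * interaction y z =
            delta (x.1.1, x.1.2) z * (ω z * interaction y z) -
            delta (x.1.1, x.2.2) z * (ω z * interaction y z) -
            delta (x.2.1, x.1.2) z * (ω z * interaction y z) +
            delta (x.2.1, x.2.2) z * (ω z * interaction y z) := fun z => by
          rw [interaction_eq x z]; ring
        simp only [this, Finset.sum_add_distrib, Finset.sum_sub_distrib]
        simp [delta]
      rw [e]
      have hs : ∀ z, ω z * interaction y z ^ 2 = (ω z * interaction y z) ^ 2 := fun z => by
        rw [mul_pow, hωsq]
      simp only [hs]
      generalize ω (x.1.1, x.1.2) * interaction y (x.1.1, x.1.2) = s₁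
      generalize ω (x.1.1, x.2.2) * interaction y (x.1.1, x.2.2) = s₂
      generalize ω (x.2.1, x.1.2) * interaction y (x.2.1, x.1.2) = s₃
      generalize ω (x.2.1, x.2.2) * interaction y (x.2.1, x.2.2) = s₄
      nlinarith [sq_nonneg (s₁ + s₂), sq_nonneg (s₁ + s₃), sq_nonneg (s₁ - s₄),
        sq_nonneg (s₂ - s₃), sq_nonneg (s₂ + s₄), sq_nonneg (s₃ + s₄)]
    refine (expect_mono hpp hsq).trans (le_of_eq ?_)
    rw [expect_pairWeight_cells hp (fun z => ω z * interaction y z ^ 2) 4 4, Finset.mul_sum,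
      Finset.mul_sum]
    exact Finset.sum_congr rfl fun z _ => by ring
  refine (expect_mono hpp hinner).trans ?_
  rw [expect_const_mul, expect_sum]
  simp only [expect_const_mul, expect_interaction hp]
  rw [Finset.mul_sum, Finset.mul_sum, Finset.mul_sum, ← Finset.sum_add_distrib]
  refine Finset.sum_le_sum fun z _ => ?_
  have h1 := expect_interaction_sq_le hp z
  set q := margFst p z.1 * margSnd p z.2 with hq
  have hr : p z = depend p z + q := by rw [depend, ← hq]; ring
  have hpq : 0 ≤ p z + q := add_nonneg (hp.1 z) (hq0 z)
  have h2 : ω z * expect (pairWeight p) (fun x => interaction x z ^ 2) ≤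
      ω z * (2 * (p z + q)) := mul_le_mul_of_nonneg_left h1 (hω0 z)
  have h3 := mul_le_mul_of_nonneg_left h2 hpq
  -- As `p z = depend p z + q`, the left side contains `2 * (depend + 2 * q) ^ 2`; the constants `4`
  -- and `16`, multiplied by the outer `8`, become `8` times the squared mean `2 * depend` and
  -- `128`.
  have h4 : (p z + q) * (ω z * (2 * (p z + q))) ≤
      ω z * (4 * depend p z ^ 2 + 16 * q ^ 2) := by
    have : (p z + q) * (2 * (p z + q)) ≤ 4 * depend p z ^ 2 + 16 * q ^ 2 := by
      rw [hr]; nlinarith [sq_nonneg (depend p z - 2 * q)]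
    nlinarith [mul_le_mul_of_nonneg_left this (hω0 z)]
  linarith

end Features

/-! ### Flattening a distribution by deleting the points already seen -/

lemma mul_one_sub_pow_le {x : ℝ} (h0 : 0 ≤ x) (h1 : x ≤ 1) (K : ℕ) (hK : 1 ≤ K) :
    x * (1 - x) ^ (K - 1) ≤ 1 / K := by
  obtain ⟨n, rfl⟩ : ∃ n, K = n + 1 := ⟨K - 1, by omega⟩
  simp only [Nat.add_sub_cancel]
  have hb : 1 + (n : ℝ) * x ≤ (1 + x) ^ n := one_add_mul_le_pow (by linarith) n
  have hx : (0 : ℝ) ≤ 1 - x := by linarith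
  have hm : (1 + x) ^ n * (1 - x) ^ n ≤ 1 := by
    rw [← mul_pow]; exact pow_le_one₀ (by nlinarith) (by nlinarith)
  -- Bernoulli's inequality bounds `1 + n * x` by `(1 + x) ^ n`, and the product with `(1 - x) ^ n`
  -- is a power of `1 - x ^ 2`.
  have hp : 0 ≤ (1 - x) ^ n := pow_nonneg hx n
  have h2 : (1 + n * x) * (1 - x) ^ n ≤ 1 := (mul_le_mul_of_nonneg_right hb hp).trans hm
  have hle : (1 - x) ^ n ≤ 1 := pow_le_one₀ hx (by linarith)
  rw [le_div_iff₀ (by positivity)]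
  push_cast
  nlinarith [mul_nonneg (sub_nonneg.2 h1) hp]

/-- Upper bound for the squared `ℓ²` norm of a distribution on `d` points after deleting all points
that occur among `2 (K - 1)` samples. -/
def flatNorm (d K : ℕ) : ℝ := min (1 / (K : ℝ)) (d / (K : ℝ) ^ 2)

lemma flatNorm_nonneg (d K : ℕ) : 0 ≤ flatNorm d K := le_min (by positivity) (by positivity)

/-- Each summand is the square of `p x * (1 - p x) ^ (K - 1)`, and `mul_one_sub_pow_le` applies to
one factor (leaving total mass one) or to both. The even number `2 * (K - 1)` of samples makes the
summand a perfect square. -/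
lemma sum_sq_mul_pow_le {X : Type} [Fintype X] {p : X → ℝ} (hp : p ∈ stdSimplex ℝ X) {K : ℕ}
    (hK : 1 ≤ K) :
    ∑ x, p x ^ 2 * (1 - p x) ^ (2 * (K - 1)) ≤ flatNorm (Fintype.card X) K := by
  have hp1 : ∀ x, p x ≤ 1 := fun x => by
    rw [← hp.2]; exact Finset.single_le_sum (fun y _ => hp.1 y) (Finset.mem_univ x)
  have hb := fun x => mul_one_sub_pow_le (hp.1 x) (hp1 x) K hK
  have hle : ∀ x, (1 - p x) ^ (K - 1) ≤ 1 := fun x =>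
    pow_le_one₀ (by linarith [hp1 x]) (by linarith [hp.1 x])
  have h0 : ∀ x, 0 ≤ (1 - p x) ^ (K - 1) := fun x => pow_nonneg (by linarith [hp1 x]) _
  have he : ∀ x, p x ^ 2 * (1 - p x) ^ (2 * (K - 1)) = (p x * (1 - p x) ^ (K - 1)) ^ 2 :=
    fun x => by rw [mul_pow, ← pow_mul, mul_comm (K - 1) 2]
  simp only [he]
  refine le_min ?_ ?_
  · calc ∑ x, (p x * (1 - p x) ^ (K - 1)) ^ 2 ≤ ∑ x, p x * (1 / (K : ℝ)) := by
          refine Finset.sum_le_sum fun x _ => ?_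
          rw [pow_two]
          refine mul_le_mul ?_ (hb x) (mul_nonneg (hp.1 x) (h0 x)) (hp.1 x)
          nlinarith [hp.1 x, hle x]
      _ = 1 / K := by rw [← Finset.sum_mul, hp.2, one_mul]
  · calc ∑ x, (p x * (1 - p x) ^ (K - 1)) ^ 2 ≤ ∑ _x : X, (1 / (K : ℝ)) ^ 2 :=
          Finset.sum_le_sum fun x _ =>
            pow_le_pow_left₀ (mul_nonneg (hp.1 x) (h0 x)) (hb x) 2
      _ = _ := by simp; ring

/-! ### Selection of cells, mean and variance of the statistic -/

section Inner

variable {I A C : Type} [Fintype I] [DecidableEq I] [Fintype A] [Fintype C] [DecidableEq A]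
  [DecidableEq C]

/-- Indicator that `x` is not among the values `h (y (b, i))`. -/
def unseen {Y X : Type} [DecidableEq X] {n : ℕ} (h : Y → X) (y : I × Fin n → Y) (b : I) (x : X) :
    ℝ := ∏ i, if h (y (b, i)) = x then 0 else 1

lemma unseen_eq_zero_or_one {I Y X : Type} [DecidableEq X] {n : ℕ} (h : Y → X)
    (y : I × Fin n → Y) (b : I) (x : X) : unseen h y b x = 0 ∨ unseen h y b x = 1 := by
  unfold unseen
  by_cases hx : ∃ i, h (y (b, i)) = x
  · obtain ⟨i, hi⟩ := hx
    exact Or.inl (Finset.prod_eq_zero (Finset.mem_univ i) (if_pos hi))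
  · push Not at hx
    exact Or.inr (Finset.prod_eq_one fun i _ => if_neg (hx i))

lemma expect_unseen {Y X : Type} [Fintype Y] [DecidableEq X] {n : ℕ} (h : Y → X)
    {p : I → Y → ℝ} (hp : ∀ b, p b ∈ stdSimplex ℝ Y) (b : I) (x : X) :
    expect (piWeight fun bi : I × Fin n => p bi.1) (fun y => unseen h y b x) =
      (1 - expect (p b) fun y => delta (h y) x) ^ n := by
  have e : ∀ y : I × Fin n → Y, unseen h y b x =
      ∏ bi : I × Fin n, if bi.1 = b then (if h (y bi) = x then 0 else 1) else 1 := fun y => by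
    rw [Fintype.prod_prod_type, Finset.prod_eq_single b]
    · simp [unseen]
    · intro b' _ hb'; simp [hb']
    · simp
  simp only [e]
  rw [expect_piWeight_prod (fun bi : I × Fin n => p bi.1)
    (fun bi y => if bi.1 = b then (if h y = x then 0 else 1) else 1), Fintype.prod_prod_type,
    Finset.prod_eq_single b]
  · have h1 : expect (p b) (fun y => if h y = x then (0 : ℝ) else 1) =
        1 - expect (p b) fun y => delta (h y) x := by
      rw [eq_sub_iff_add_eq, ← expect_add]
      refine Eq.trans ?_ (expect_const (hp b) (1 : ℝ))
      congr 1; ext y; by_cases hy : h y = x <;> simp [delta, hy]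
    simp [h1]
  · intro b' _ hb'
    simp [hb', expect_const (hp b')]
  · simp

lemma expect_unseen_fst {n : ℕ} {p : I → A × C → ℝ} (hp : ∀ b, p b ∈ stdSimplex ℝ (A × C))
    (b : I) (a : A) :
    expect (piWeight fun bi : I × Fin n => p bi.1) (fun y => unseen Prod.fst y b a) =
      (1 - margFst (p b) a) ^ n := by
  rw [expect_unseen _ hp]
  have := expect_fst (p b) (fun a' => delta a' a)
  rw [this]; simp [expect, delta]

lemma expect_unseen_snd {n : ℕ} {p : I → A × C → ℝ} (hp : ∀ b, p b ∈ stdSimplex ℝ (A × C))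
    (b : I) (c : C) :
    expect (piWeight fun bi : I × Fin n => p bi.1) (fun y => unseen Prod.snd y b c) =
      (1 - margSnd (p b) c) ^ n := by
  rw [expect_unseen _ hp]
  have := expect_snd (p b) (fun c' => delta c' c)
  rw [this]; simp [expect, delta]

/-- The statistic with cell weights `ω`. -/
def cellStat {k : ℕ} (ω : I → A × C → ℝ) (ξη : (I × Fin k → (A × C) × (A × C)) ×
    (I × Fin k → (A × C) × (A × C))) : ℝ :=
  kernelStat (fun b x y => ∑ z, ω b z * interaction x z * interaction y z) ξη.1 ξη.2

/-- Weights of two independent groups of pairs of samples. -/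
def groupsWeight (k : ℕ) (p : I → A × C → ℝ)
    (ξη : (I × Fin k → (A × C) × (A × C)) × (I × Fin k → (A × C) × (A × C))) : ℝ :=
  piWeight (fun bi : I × Fin k => pairWeight (p bi.1)) ξη.1 *
    piWeight (fun bi : I × Fin k => pairWeight (p bi.1)) ξη.2

lemma groupsWeight_mem (k : ℕ) {p : I → A × C → ℝ} (hp : ∀ b, p b ∈ stdSimplex ℝ (A × C)) :
    groupsWeight k p ∈ stdSimplex ℝ _ :=
  prod_mem_stdSimplex (piWeight_mem_stdSimplex fun bi => pairWeight_mem (hp bi.1))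
    (piWeight_mem_stdSimplex fun bi => pairWeight_mem (hp bi.1))

/-- Mean and variance of the statistic for 0-1 cell weights. -/
lemma expect_cellStat_sub_sq_le {k : ℕ} {p : I → A × C → ℝ}
    (hp : ∀ b, p b ∈ stdSimplex ℝ (A × C)) {ω : I → A × C → ℝ}
    (hω : ∀ b z, ω b z = 0 ∨ ω b z = 1) {S G : ℝ}
    (hS : S = (k : ℝ) ^ 2 * ∑ b, ∑ z, ω b z * (2 * depend (p b) z) ^ 2)
    (hG : G = (k : ℝ) ^ 2 * ∑ b, ∑ z : A × C,
      ω b z * (margFst (p b) z.1 * margSnd (p b) z.2) ^ 2) :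
    expect (groupsWeight k p) (fun ξη => (cellStat ω ξη - S) ^ 2) ≤
      8 * S + 128 * G + 2 * S * (3 * Real.sqrt S + 12 * Real.sqrt G) := by
  have hpp := fun b => pairWeight_mem (hp b)
  have hω0 : ∀ b z, 0 ≤ ω b z := fun b z => by rcases hω b z with h | h <;> simp [h]
  set g : I → (A × C) × (A × C) → (A × C) × (A × C) → ℝ :=
    fun b x y => ∑ z, ω b z * interaction x z * interaction y z with hg
  have hsymm : ∀ b x y, g b x y = g b y x := fun b x y =>
    Finset.sum_congr rfl fun z _ => by ring
  have h := expect_kernelStat_sub_sq_le (k := k) hpp g hsymm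
  have hgm : ∀ b x, expect (pairWeight (p b)) (fun y => g b x y) =
      ∑ z, ω b z * interaction x z * expect (pairWeight (p b)) fun y => interaction y z :=
    fun b x => by simp only [hg, expect_sum, expect_const_mul]
  set m : I → ℝ := fun b => ∑ z, ω b z * (2 * depend (p b) z) ^ 2 with hm
  set N : I → ℝ := fun b => ∑ z : A × C, ω b z * (margFst (p b) z.1 * margSnd (p b) z.2) ^ 2
    with hN
  have hm0 : ∀ b, 0 ≤ m b := fun b => Finset.sum_nonneg fun z _ =>
    mul_nonneg (hω0 b z) (sq_nonneg _)
  have hN0 : ∀ b, 0 ≤ N b := fun b => Finset.sum_nonneg fun z _ =>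
    mul_nonneg (hω0 b z) (sq_nonneg _)
  have hmean : ∀ b, expect (pairWeight (p b)) (fun x =>
      expect (pairWeight (p b)) fun y => g b x y) = m b := fun b => by
    simp only [hgm, expect_sum, expect_mul_const, expect_const_mul, expect_interaction (hp b), hm]
    exact Finset.sum_congr rfl fun z _ => by ring
  simp only [hmean] at h
  set τ : I → ℝ := fun b => expect (pairWeight (p b)) fun x =>
    expect (pairWeight (p b)) fun y => g b x y ^ 2 with hτ
  set κ : I → ℝ := fun b => expect (pairWeight (p b)) fun x =>
    (expect (pairWeight (p b)) fun y => g b x y) ^ 2 with hκ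
  have hτle : ∀ b, τ b ≤ 8 * m b + 128 * N b := fun b => by
    have := expect_kernel_sq_le (hp b) (hω b)
    simp only [expect_interaction (hp b)] at this
    exact this
  have hκsq : ∀ b, κ b ^ 2 ≤ m b ^ 2 * τ b := fun b => by
    have := sq_expect_sq_le (pairWeight (p b)) (hω0 b) (interaction (A := A) (C := C))
    simp only [hκ, hgm]
    refine this.trans (le_of_eq ?_)
    simp only [expect_interaction (hp b), hm, hτ, hg]
  -- The square root of `8 * m b + 128 * N b` is at most `3 * √(m b) + 12 * √(N b)`, since `8 ≤ 3 ^
  -- 2` and `128 ≤ 12 ^ 2`.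
  have hκle : ∀ b, κ b ≤ m b * (3 * Real.sqrt (m b) + 12 * Real.sqrt (N b)) := fun b => by
    refine abs_le_of_sq_le_sq' ?_ (mul_nonneg (hm0 b) (by positivity)) |>.2
    refine (hκsq b).trans ?_
    rw [mul_pow]
    refine mul_le_mul_of_nonneg_left ((hτle b).trans ?_) (sq_nonneg _)
    nlinarith [Real.sq_sqrt (hm0 b), Real.sq_sqrt (hN0 b), Real.sqrt_nonneg (m b),
      Real.sqrt_nonneg (N b), mul_nonneg (Real.sqrt_nonneg (m b)) (Real.sqrt_nonneg (N b)), hm0 b,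
      hN0 b]
  have hk0 : (0 : ℝ) ≤ k := Nat.cast_nonneg k
  have hSb : ∀ b, (k : ℝ) ^ 2 * m b ≤ S := fun b => by
    rw [hS]
    exact mul_le_mul_of_nonneg_left
      (Finset.single_le_sum (fun b _ => hm0 b) (Finset.mem_univ b)) (sq_nonneg _)
  have hGb : ∀ b, (k : ℝ) ^ 2 * N b ≤ G := fun b => by
    rw [hG]
    exact mul_le_mul_of_nonneg_left
      (Finset.single_le_sum (fun b _ => hN0 b) (Finset.mem_univ b)) (sq_nonneg _)
  have hsS : ∀ b, (k : ℝ) * Real.sqrt (m b) ≤ Real.sqrt S := fun b => by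
    refine Real.le_sqrt_of_sq_le ?_
    rw [mul_pow, Real.sq_sqrt (hm0 b)]; exact hSb b
  have hsG : ∀ b, (k : ℝ) * Real.sqrt (N b) ≤ Real.sqrt G := fun b => by
    refine Real.le_sqrt_of_sq_le ?_
    rw [mul_pow, Real.sq_sqrt (hN0 b)]; exact hGb b
  -- One factor `k` goes into the square roots, where a single bin is dominated by the totals `S`
  -- and `G`; what is left sums to `S`.
  have hκ3 : ∀ b, (k : ℝ) ^ 3 * κ b ≤
      (k : ℝ) ^ 2 * m b * (3 * Real.sqrt S + 12 * Real.sqrt G) := fun b => by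
    calc (k : ℝ) ^ 3 * κ b ≤ (k : ℝ) ^ 3 * (m b * (3 * Real.sqrt (m b) + 12 * Real.sqrt (N b))) :=
          mul_le_mul_of_nonneg_left (hκle b) (by positivity)
      _ = (k : ℝ) ^ 2 * m b * (3 * (k * Real.sqrt (m b)) + 12 * (k * Real.sqrt (N b))) := by ring
      _ ≤ _ := by
        refine mul_le_mul_of_nonneg_left ?_ (mul_nonneg (sq_nonneg _) (hm0 b))
        linarith [hsS b, hsG b]
  have h1 : (k : ℝ) ^ 2 * ∑ b, τ b ≤ 8 * S + 128 * G := by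
    rw [hS, hG]
    calc (k : ℝ) ^ 2 * ∑ b, τ b ≤ (k : ℝ) ^ 2 * ∑ b, (8 * m b + 128 * N b) :=
          mul_le_mul_of_nonneg_left (Finset.sum_le_sum fun b _ => hτle b) (sq_nonneg _)
      _ = _ := by rw [Finset.sum_add_distrib, ← Finset.mul_sum, ← Finset.mul_sum]; ring
  have h2 : (k : ℝ) ^ 3 * ∑ b, κ b ≤ S * (3 * Real.sqrt S + 12 * Real.sqrt G) := by
    rw [Finset.mul_sum]
    refine (Finset.sum_le_sum fun b _ => hκ3 b).trans (le_of_eq ?_)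
    rw [← Finset.sum_mul, ← Finset.mul_sum, ← hS]
  have e : expect (groupsWeight k p) (fun ξη => (cellStat ω ξη - S) ^ 2) =
      expect (piWeight fun bi : I × Fin k => pairWeight (p bi.1)) (fun ξ =>
        expect (piWeight fun bi : I × Fin k => pairWeight (p bi.1)) fun η =>
          (kernelStat g ξ η - S) ^ 2) := expect_prod _ _ _
  rw [e]
  rw [← hS] at h
  linarith

/-- Weights of the two groups of samples that select the cells. -/
def selectWeight (s t : ℕ) (p : I → A × C → ℝ)
    (yz : (I × Fin s → A × C) × (I × Fin t → A × C)) : ℝ :=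
  piWeight (fun bi : I × Fin s => p bi.1) yz.1 * piWeight (fun bi : I × Fin t => p bi.1) yz.2

lemma selectWeight_mem (s t : ℕ) {p : I → A × C → ℝ} (hp : ∀ b, p b ∈ stdSimplex ℝ (A × C)) :
    selectWeight s t p ∈ stdSimplex ℝ _ :=
  prod_mem_stdSimplex (piWeight_mem_stdSimplex fun bi => hp bi.1)
    (piWeight_mem_stdSimplex fun bi => hp bi.1)

/-- The 0-1 cell weights: delete rows and columns seen in the selecting samples. -/
def selectCells {s t : ℕ} (yz : (I × Fin s → A × C) × (I × Fin t → A × C)) (b : I)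
    (z : A × C) : ℝ :=
  unseen Prod.fst yz.1 b z.1 * unseen Prod.snd yz.2 b z.2

lemma selectCells_eq_zero_or_one {I A C : Type} [DecidableEq A] [DecidableEq C] {s t : ℕ}
    (yz : (I × Fin s → A × C) × (I × Fin t → A × C)) (b : I) (z : A × C) :
    selectCells yz b z = 0 ∨ selectCells yz b z = 1 := by
  unfold selectCells
  rcases unseen_eq_zero_or_one Prod.fst yz.1 b z.1 with h | h <;>
    rcases unseen_eq_zero_or_one Prod.snd yz.2 b z.2 with h' | h' <;> simp [h, h']

lemma expect_selectCells {s t : ℕ} {p : I → A × C → ℝ} (hp : ∀ b, p b ∈ stdSimplex ℝ (A × C))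
    (b : I) (z : A × C) :
    expect (selectWeight s t p) (fun yz => selectCells yz b z) =
      (1 - margFst (p b) z.1) ^ s * (1 - margSnd (p b) z.2) ^ t := by
  refine (expect_prod _ _ _).trans ?_
  simp only [selectCells]
  simp only [expect_const_mul, expect_mul_const, expect_unseen_fst hp, expect_unseen_snd hp]

/-- Rows and columns are deleted by independent groups of samples, so in every bin the expected
remaining sum of squares factors into a row part and a column part, each bounded by `flatNorm`. -/
lemma expect_noise_le {KA KC : ℕ} (hKA : 1 ≤ KA) (hKC : 1 ≤ KC) {p : I → A × C → ℝ}
    (hp : ∀ b, p b ∈ stdSimplex ℝ (A × C)) :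
    expect (selectWeight (2 * (KA - 1)) (2 * (KC - 1)) p) (fun yz => ∑ b, ∑ z : A × C,
      selectCells yz b z * (margFst (p b) z.1 * margSnd (p b) z.2) ^ 2) ≤
      Fintype.card I * (flatNorm (Fintype.card A) KA * flatNorm (Fintype.card C) KC) := by
  simp only [expect_sum, expect_mul_const, expect_selectCells hp]
  calc _ ≤ ∑ _b : I, flatNorm (Fintype.card A) KA * flatNorm (Fintype.card C) KC := by
        refine Finset.sum_le_sum fun b _ => ?_
        have e : ∑ z : A × C, (1 - margFst (p b) z.1) ^ (2 * (KA - 1)) *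
            (1 - margSnd (p b) z.2) ^ (2 * (KC - 1)) *
              (margFst (p b) z.1 * margSnd (p b) z.2) ^ 2 =
            (∑ a, margFst (p b) a ^ 2 * (1 - margFst (p b) a) ^ (2 * (KA - 1))) *
            ∑ c, margSnd (p b) c ^ 2 * (1 - margSnd (p b) c) ^ (2 * (KC - 1)) := by
          rw [Finset.sum_mul_sum, Fintype.sum_prod_type]
          exact Finset.sum_congr rfl fun _ _ => Finset.sum_congr rfl fun _ _ => by ring
        rw [e]
        refine mul_le_mul (sum_sq_mul_pow_le (margFst_mem (hp b)) hKA)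
          (sum_sq_mul_pow_le (margSnd_mem (hp b)) hKC) ?_ (flatNorm_nonneg _ _)
        refine Finset.sum_nonneg fun c _ => mul_nonneg (sq_nonneg _) ?_
        rw [pow_mul]; exact pow_nonneg (sq_nonneg _) _
    _ = _ := by simp

end Inner

/-! ### Error probabilities of the threshold test on given bins -/

section Inner

variable {I A C : Type} [Fintype I] [DecidableEq I] [Fintype A] [Fintype C] [DecidableEq A]
  [DecidableEq C]

/-- Under independence the statistic rarely exceeds the threshold. -/
lemma prob_cellStat_ge_le_of_depend_eq_zero {k KA KC : ℕ} (hKA : 1 ≤ KA) (hKC : 1 ≤ KC)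
    {p : I → A × C → ℝ} (hp : ∀ b, p b ∈ stdSimplex ℝ (A × C))
    (hind : ∀ b z, depend (p b) z = 0) {ρ T : ℝ} (hT : 0 < T)
    (hρ : (k : ℝ) ^ 2 * (Fintype.card I *
      (flatNorm (Fintype.card A) KA * flatNorm (Fintype.card C) KC)) ≤ ρ ^ 2) :
    expect (selectWeight (2 * (KA - 1)) (2 * (KC - 1)) p) (fun yz =>
      prob (groupsWeight k p) fun ξη => T ≤ cellStat (selectCells yz) ξη) ≤
      128 * ρ ^ 2 / T ^ 2 := by
  have hw := selectWeight_mem (2 * (KA - 1)) (2 * (KC - 1)) hp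
  have hg := groupsWeight_mem k hp
  have hstep : ∀ yz : (I × Fin (2 * (KA - 1)) → A × C) × (I × Fin (2 * (KC - 1)) → A × C),
      prob (groupsWeight k p) (fun ξη => T ≤ cellStat (selectCells yz) ξη) ≤
        128 * (k : ℝ) ^ 2 / T ^ 2 * ∑ b, ∑ z : A × C,
          selectCells yz b z * (margFst (p b) z.1 * margSnd (p b) z.2) ^ 2 := fun yz => by
    -- Under independence the mean `S` vanishes, and of the variance bound only `128 * G` survives,
    -- ready for Chebyshev.
    have hv := expect_cellStat_sub_sq_le (k := k) hp (selectCells_eq_zero_or_one yz) rfl rfl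
    simp only [hind, mul_zero, ne_eq, OfNat.ofNat_ne_zero, not_false_eq_true, zero_pow,
      Finset.sum_const_zero, sub_zero, zero_mul, zero_add, add_zero] at hv
    calc _ ≤ prob (groupsWeight k p) (fun ξη => T ^ 2 ≤ cellStat (selectCells yz) ξη ^ 2) :=
          prob_mono hg fun ξη h => pow_le_pow_left₀ hT.le h 2
      _ ≤ _ := prob_le_expect_div hg (fun _ => sq_nonneg _) (by positivity)
      _ ≤ _ := by
        rw [div_mul_eq_mul_div]
        exact div_le_div_of_nonneg_right (by linarith) (by positivity)
  refine (expect_mono hw hstep).trans ?_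
  rw [expect_const_mul, div_mul_eq_mul_div]
  refine div_le_div_of_nonneg_right ?_ (by positivity)
  have h := mul_le_mul_of_nonneg_left (expect_noise_le hKA hKC hp) (sq_nonneg (k : ℝ))
  linarith

lemma one_sub_pow_le {x : ℝ} (h1 : x ≤ 1) (n : ℕ) : 1 - (1 - x) ^ n ≤ n * x := by
  have := one_add_mul_le_pow (a := -x) (by linarith) n
  have e : 1 + -x = 1 - x := by ring
  rw [e] at this
  linarith

/-- If the dependence is strong on cells with light rows and columns, then the statistic exceeds the
threshold with probability at least `4/5`. -/
lemma le_prob_cellStat_ge {k KA KC : ℕ} (hKA : 1 ≤ KA) (hKC : 1 ≤ KC)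
    {p : I → A × C → ℝ} (hp : ∀ b, p b ∈ stdSimplex ℝ (A × C)) (cells : I → Finset (A × C))
    (hA : ∀ b, ∀ z ∈ cells b, ((KA : ℝ) - 1) * margFst (p b) z.1 ≤ 1 / 80)
    (hC : ∀ b, ∀ z ∈ cells b, ((KC : ℝ) - 1) * margSnd (p b) z.2 ≤ 1 / 80) {ρ T Y : ℝ}
    (hρ1 : 1 ≤ ρ) (hρ : (k : ℝ) ^ 2 * (Fintype.card I *
      (flatNorm (Fintype.card A) KA * flatNorm (Fintype.card C) KC)) ≤ ρ ^ 2)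
    (hY : Y = (k : ℝ) ^ 2 * ∑ b, ∑ z ∈ cells b, depend (p b) z ^ 2)
    (hYρ : 10 ^ 6 * ρ ≤ Y) (hTY : T ≤ Y) :
    4 / 5 ≤ expect (selectWeight (2 * (KA - 1)) (2 * (KC - 1)) p) (fun yz =>
      prob (groupsWeight k p) fun ξη => T ≤ cellStat (selectCells yz) ξη) := by
  have hw := selectWeight_mem (2 * (KA - 1)) (2 * (KC - 1)) hp
  have hg := groupsWeight_mem k hp
  have hY0 : 0 < Y := by linarith
  set lost : (I × Fin (2 * (KA - 1)) → A × C) × (I × Fin (2 * (KC - 1)) → A × C) → ℝ :=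
    fun yz => (k : ℝ) ^ 2 * ∑ b, ∑ z ∈ cells b, (1 - selectCells yz b z) * depend (p b) z ^ 2
    with hlost
  set G : (I × Fin (2 * (KA - 1)) → A × C) × (I × Fin (2 * (KC - 1)) → A × C) → ℝ :=
    fun yz => (k : ℝ) ^ 2 * ∑ b, ∑ z : A × C,
      selectCells yz b z * (margFst (p b) z.1 * margSnd (p b) z.2) ^ 2 with hG
  have hsc0 : ∀ yz : (I × Fin (2 * (KA - 1)) → A × C) × (I × Fin (2 * (KC - 1)) → A × C),
      ∀ b z, 0 ≤ selectCells yz b z ∧ selectCells yz b z ≤ 1 := fun yz b z => by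
    rcases selectCells_eq_zero_or_one yz b z with h | h <;> simp [h]
  have hlost0 : ∀ yz, 0 ≤ lost yz := fun yz => mul_nonneg (sq_nonneg _) <|
    Finset.sum_nonneg fun b _ => Finset.sum_nonneg fun z _ =>
      mul_nonneg (by linarith [(hsc0 yz b z).2]) (sq_nonneg _)
  have hG0 : ∀ yz, 0 ≤ G yz := fun yz => mul_nonneg (sq_nonneg _) <|
    Finset.sum_nonneg fun b _ => Finset.sum_nonneg fun z _ =>
      mul_nonneg (hsc0 yz b z).1 (sq_nonneg _)
  -- Twice `1 / 80` for the row and twice `1 / 80` for the column, by Bernoulli's inequality.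
  have hmiss : ∀ b, ∀ z ∈ cells b, expect (selectWeight (2 * (KA - 1)) (2 * (KC - 1)) p)
      (fun yz => 1 - selectCells yz b z) ≤ 1 / 20 := fun b z hz => by
    rw [expect_sub, expect_const hw, expect_selectCells hp]
    have hm1 : margFst (p b) z.1 ≤ 1 := by
      rw [← (margFst_mem (hp b)).2]
      exact Finset.single_le_sum (fun y _ => (margFst_mem (hp b)).1 y) (Finset.mem_univ _)
    have hm2 : margSnd (p b) z.2 ≤ 1 := by
      rw [← (margSnd_mem (hp b)).2]
      exact Finset.single_le_sum (fun y _ => (margSnd_mem (hp b)).1 y) (Finset.mem_univ _)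
    have h1 := one_sub_pow_le hm1 (2 * (KA - 1))
    have h2 := one_sub_pow_le hm2 (2 * (KC - 1))
    have h3 : (1 - margFst (p b) z.1) ^ (2 * (KA - 1)) ≤ 1 :=
      pow_le_one₀ (by linarith) (by linarith [(margFst_mem (hp b)).1 z.1])
    have h4 : (1 - margSnd (p b) z.2) ^ (2 * (KC - 1)) ≤ 1 :=
      pow_le_one₀ (by linarith) (by linarith [(margSnd_mem (hp b)).1 z.2])
    push_cast [Nat.cast_sub hKA, Nat.cast_sub hKC] at h1 h2
    have h5 := hA b z hz
    have h6 := hC b z hz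
    nlinarith [mul_nonneg (sub_nonneg.2 h3) (sub_nonneg.2 h4)]
  have hElost : expect (selectWeight (2 * (KA - 1)) (2 * (KC - 1)) p) lost ≤ Y / 20 := by
    simp only [hlost, expect_const_mul, expect_sum, expect_mul_const]
    rw [hY, mul_div_assoc]
    refine mul_le_mul_of_nonneg_left ?_ (sq_nonneg _)
    rw [Finset.sum_div]
    refine Finset.sum_le_sum fun b _ => ?_
    rw [Finset.sum_div]
    refine Finset.sum_le_sum fun z hz => ?_
    have := mul_le_mul_of_nonneg_right (hmiss b z hz) (sq_nonneg (depend (p b) z))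
    linarith
  have hEG : expect (selectWeight (2 * (KA - 1)) (2 * (KC - 1)) p) G ≤ ρ ^ 2 := by
    simp only [hG, expect_const_mul]
    exact (mul_le_mul_of_nonneg_left (expect_noise_le hKA hKC hp) (sq_nonneg _)).trans hρ
  -- Markov's inequality twice: losing half of the signal costs `1 / 10`, excess noise `1 / 20`.
  -- With the final Chebyshev error `1 / 20` the total failure probability is `1 / 5`.
  have hbad : prob (selectWeight (2 * (KA - 1)) (2 * (KC - 1)) p)
      (fun yz => ∃ i ∈ (Finset.univ : Finset Bool),
        cond i (Y / 2 ≤ lost yz) (20 * ρ ^ 2 ≤ G yz)) ≤ 3 / 20 := by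
    refine (prob_exists_le hw _ _).trans ?_
    rw [Fintype.sum_bool]
    simp only [cond_true, cond_false]
    have h1 := prob_le_expect_div hw hlost0 (half_pos hY0)
    have h2 := prob_le_expect_div hw hG0 (show 0 < 20 * ρ ^ 2 by positivity)
    have h3 : expect (selectWeight (2 * (KA - 1)) (2 * (KC - 1)) p) lost / (Y / 2) ≤ 1 / 10 := by
      rw [div_le_iff₀ (half_pos hY0)]; linarith
    have h4 : expect (selectWeight (2 * (KA - 1)) (2 * (KC - 1)) p) G / (20 * ρ ^ 2) ≤ 1 / 20 := by
      rw [div_le_iff₀ (by positivity)]; linarith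
    linarith
  have hgood : ∀ yz, ¬ (∃ i ∈ (Finset.univ : Finset Bool),
      cond i (Y / 2 ≤ lost yz) (20 * ρ ^ 2 ≤ G yz)) →
      prob (groupsWeight k p) (fun ξη => ¬ T ≤ cellStat (selectCells yz) ξη) ≤ 1 / 20 := by
    intro yz hyz
    have h1 : lost yz < Y / 2 := by
      by_contra h; exact hyz ⟨true, Finset.mem_univ _, not_lt.1 h⟩
    have h2 : G yz < 20 * ρ ^ 2 := by
      by_contra h; exact hyz ⟨false, Finset.mem_univ _, not_lt.1 h⟩
    set S := (k : ℝ) ^ 2 * ∑ b, ∑ z, selectCells yz b z * (2 * depend (p b) z) ^ 2 with hS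
    -- The interactions have mean `2 * depend`, so the surviving half of `Y` counts four times.
    -- Hence `T ≤ Y ≤ S / 2`, and a miss is a deviation of at least `S / 2`.
    have hSY : 2 * Y ≤ S := by
      have h3 : Y - lost yz ≤ (k : ℝ) ^ 2 * ∑ b, ∑ z, selectCells yz b z * depend (p b) z ^ 2 := by
        rw [hY, hlost, ← mul_sub, ← Finset.sum_sub_distrib]
        refine mul_le_mul_of_nonneg_left (Finset.sum_le_sum fun b _ => ?_) (sq_nonneg _)
        rw [← Finset.sum_sub_distrib]
        calc _ = ∑ z ∈ cells b, selectCells yz b z * depend (p b) z ^ 2 :=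
              Finset.sum_congr rfl fun z _ => by ring
          _ ≤ _ := Finset.sum_le_sum_of_subset_of_nonneg (Finset.subset_univ _)
              fun z _ _ => mul_nonneg (hsc0 yz b z).1 (sq_nonneg _)
      have h4 : S = 4 * ((k : ℝ) ^ 2 * ∑ b, ∑ z, selectCells yz b z * depend (p b) z ^ 2) := by
        rw [hS, mul_left_comm, Finset.mul_sum (a := (4 : ℝ))]
        congr 1
        refine Finset.sum_congr rfl fun b _ => ?_
        rw [Finset.mul_sum]
        exact Finset.sum_congr rfl fun z _ => by ring
      linarith
    have hv := expect_cellStat_sub_sq_le hp (selectCells_eq_zero_or_one yz) hS (hG ▸ rfl : G yz = _)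
    have hS0 : 0 < S := by linarith
    calc _ ≤ prob (groupsWeight k p)
          (fun ξη => (S / 2) ^ 2 ≤ (cellStat (selectCells yz) ξη - S) ^ 2) :=
          prob_mono hg fun ξη h => by
            have : cellStat (selectCells yz) ξη < T := not_le.1 h
            nlinarith
      _ ≤ _ := prob_le_expect_div hg (fun _ => sq_nonneg _) (by positivity)
      _ ≤ 1 / 20 := by
        rw [div_le_iff₀ (by positivity)]
        refine hv.trans ?_
        have hsG : Real.sqrt (G yz) ≤ 5 * ρ := by
          rw [Real.sqrt_le_left (by linarith)]
          nlinarith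
        have hsS : Real.sqrt S ≤ S / 1000 := by
          rw [Real.sqrt_le_left (by linarith)]
          nlinarith
        have hρS : ρ ≤ S / 10 ^ 6 := by rw [le_div_iff₀ (by norm_num)]; linarith
        have hS1 : 10 ^ 6 ≤ S := by linarith
        have a1 : S * Real.sqrt S ≤ S * (S / 1000) := mul_le_mul_of_nonneg_left hsS hS0.le
        have a2 : S * Real.sqrt (G yz) ≤ S * (5 * (S / 10 ^ 6)) :=
          mul_le_mul_of_nonneg_left (by linarith) hS0.le
        have a3 : ρ ^ 2 ≤ (S / 10 ^ 6) ^ 2 := pow_le_pow_left₀ (by linarith) hρS 2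
        nlinarith
  have hfin := expect_le_prob_add hw _ (by norm_num : (0 : ℝ) ≤ 1 / 20)
    (fun yz => prob_le_one hg (fun ξη => ¬ T ≤ cellStat (selectCells yz) ξη)) hgood
  simp only [prob_not hg] at hfin
  rw [expect_sub, expect_const hw] at hfin
  linarith

end Inner

/-! ### From i.i.d. samples to one sample per role and used bin -/

section Sampling

variable {A B C Role : Type} [Fintype A] [Fintype B] [Fintype C] [Fintype Role] [DecidableEq B]
  [DecidableEq Role]

/-- The bins that are hit in every block. -/
def usedBins {n : ℕ} (β : Role → Fin n → B) : Finset B :=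
  Finset.univ.filter fun b => ∀ r, ∃ i, β r i = b

lemma usedBins_spec {n : ℕ} (β : Role → Fin n → B) (b : usedBins β) (r : Role) :
    ∃ i, β r i = b := (Finset.mem_filter.1 b.2).2 r

lemma card_usedBins_le {n : ℕ} [Nonempty Role] (β : Role → Fin n → B) :
    (usedBins β).card ≤ n := by
  obtain ⟨r⟩ := ‹Nonempty Role›
  have h : usedBins β ⊆ Finset.univ.image (β r) := fun b hb => by
    obtain ⟨i, hi⟩ := (Finset.mem_filter.1 hb).2 r
    exact Finset.mem_image.2 ⟨i, Finset.mem_univ _, hi⟩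
  refine (Finset.card_le_card h).trans (Finset.card_image_le.trans ?_)
  simp

/-- The sample taken from the block `r` for the bin `b`. -/
def usedSample {n : ℕ} (β : Role → Fin n → B) (br : usedBins β × Role) : Role × Fin n :=
  (br.2, (usedBins_spec β br.1 br.2).choose)

lemma usedSample_spec {n : ℕ} (β : Role → Fin n → B) (br : usedBins β × Role) :
    β (usedSample β br).1 (usedSample β br).2 = br.1 :=
  (usedBins_spec β br.1 br.2).choose_spec

lemma usedSample_injective {n : ℕ} (β : Role → Fin n → B) :
    Function.Injective (usedSample β) := by
  intro x y h
  have h1 := usedSample_spec β x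
  rw [h, usedSample_spec β y] at h1
  exact Prod.ext (Subtype.ext h1.symm) (congrArg Prod.fst h)

/-- Moving the second component of a triple to the front. -/
def binFirst (A B C : Type) : A × B × C ≃ B × (A × C) where
  toFun x := (x.2.1, (x.1, x.2.2))
  invFun y := (y.2.1, y.1, y.2.2)
  left_inv _ := rfl
  right_inv _ := rfl

/-- A test for samples with one sample per role and used bin, run on `N` i.i.d. samples. -/
lemma exists_rejection {N n : ℕ} (hN : Fintype.card Role * n ≤ N)
    (R : (U : Finset B) → (U × Role → A × C) → Prop) :
    ∃ Rej : (Fin N → A × B × C) → Prop, ∀ q ∈ stdSimplex ℝ B, ∀ p : B → A × C → ℝ,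
      (∀ b, p b ∈ stdSimplex ℝ (A × C)) →
      prob (piWeight fun _ : Fin N => fun x : A × B × C => q x.2.1 * p x.2.1 (x.1, x.2.2)) Rej =
        expect (piWeight fun _ : Role => piWeight fun _ : Fin n => q) fun β =>
          prob (piWeight fun br : usedBins β × Role => p br.1) (R (usedBins β)) := by
  classical
  obtain ⟨ι⟩ : Nonempty (Role × Fin n ↪ Fin N) :=
    Function.Embedding.nonempty_of_card_le (by simpa using hN)
  -- Both the used bins and the representative samples are functions of the bin labels `β` alone.
  -- Conditionally on `β` the kept samples are therefore independent with laws `p b`.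
  let F : (Role × Fin n → B) → (Role × Fin n → A × C) → Prop := fun β x =>
    R (usedBins fun r i => β (r, i)) (x ∘ usedSample fun r i => β (r, i))
  refine ⟨fun s => F (fun j => (s (ι j)).2.1) (fun j => ((s (ι j)).1, (s (ι j)).2.2)),
    fun q hq p hp => ?_⟩
  have hP : (fun x : A × B × C => q x.2.1 * p x.2.1 (x.1, x.2.2)) ∈ stdSimplex ℝ (A × B × C) := by
    refine ⟨fun x => mul_nonneg (hq.1 _) ((hp _).1 _), ?_⟩
    refine (Fintype.sum_equiv (binFirst A B C) _ (fun y => q y.1 * p y.1 y.2)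
      fun _ => rfl).trans ?_
    rw [Fintype.sum_prod_type]
    simp [← Finset.mul_sum, (hp _).2, hq.2]
  let ind : Prop → ℝ := fun S => if S then 1 else 0
  -- Surplus samples are dropped, bins are moved to the front, the labels are conditioned upon, and
  -- finally only the representatives are kept.
  have h1 := expect_piWeight_comp ι.injective (fun _ : Fin N => hP) (fun s =>
    ind (F (fun j => (s j).2.1) fun j => ((s j).1, (s j).2.2)))
  have h2 := expect_piWeight_map (ι := Role × Fin n) (binFirst A B C)
    (fun _ => fun y : B × (A × C) => q y.1 * p y.1 y.2)
    (fun z => ind (F (fun j => (z j).1) fun j => (z j).2))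
  have h3 := expect_piWeight_pair (fun _ : Role × Fin n => q) (fun _ => p)
    (fun β x => ind (F β x))
  have h4 : ∀ β : Role × Fin n → B, expect (piWeight fun j => p (β j)) (fun x => ind (F β x)) =
      prob (piWeight fun br : (usedBins fun r i => β (r, i)) × Role => p br.1)
        (R (usedBins fun r i => β (r, i))) := fun β => by
    have h := expect_piWeight_comp (usedSample_injective fun r i => β (r, i))
      (fun j => hp (β j)) (fun y => ind (R (usedBins fun r i => β (r, i)) y))
    have hs : ∀ br, β (usedSample (fun r i => β (r, i)) br) = br.1 :=
      usedSample_spec fun r i => β (r, i)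
    simp only [hs] at h
    exact h
  simp only [h4] at h3
  have h5 := expect_piWeight_curry (fun _ : Role × Fin n => q) (fun β =>
    prob (piWeight fun br : usedBins β × Role => p br.1) (R (usedBins β)))
  exact h1.trans (h2.trans (h3.trans h5))

end Sampling

/-! ### Independence of the roles -/

section Roles

variable {I A C : Type} [Fintype I] [DecidableEq I] [Fintype A] [Fintype C] [DecidableEq A]
  [DecidableEq C]

/-- The roles of the samples of a bin: two groups that select cells, and two groups of pairs. -/
abbrev Role (s t k : ℕ) : Type := (Fin s ⊕ Fin t) ⊕ ((Fin k ⊕ Fin k) ⊕ (Fin k ⊕ Fin k))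

/-- The selecting samples. -/
def selecting {s t k : ℕ} (y : I × Role s t k → A × C) :
    (I × Fin s → A × C) × (I × Fin t → A × C) :=
  (fun bi => y (bi.1, Sum.inl (Sum.inl bi.2)), fun bi => y (bi.1, Sum.inl (Sum.inr bi.2)))

/-- The two groups of pairs of samples. -/
def groups {s t k : ℕ} (y : I × Role s t k → A × C) :
    (I × Fin k → (A × C) × (A × C)) × (I × Fin k → (A × C) × (A × C)) :=
  (fun bi => (y (bi.1, Sum.inr (Sum.inl (Sum.inl bi.2))),
    y (bi.1, Sum.inr (Sum.inl (Sum.inr bi.2)))),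
   fun bi => (y (bi.1, Sum.inr (Sum.inr (Sum.inl bi.2))),
    y (bi.1, Sum.inr (Sum.inr (Sum.inr bi.2)))))

lemma expect_split {X R R' : Type} [Fintype X] [Fintype R] [DecidableEq R] [Fintype R']
    [DecidableEq R'] {p : I → X → ℝ} (hp : ∀ b, p b ∈ stdSimplex ℝ X)
    (G : (I × R → X) → (I × R' → X) → ℝ) :
    expect (piWeight fun br : I × (R ⊕ R') => p br.1) (fun y =>
      G (fun br => y (br.1, Sum.inl br.2)) fun br => y (br.1, Sum.inr br.2)) =
      expect (piWeight fun br : I × R => p br.1) fun y =>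
        expect (piWeight fun br : I × R' => p br.1) fun z => G y z := by
  have he : Function.Injective (Sum.elim
      (fun br : I × R => ((br.1, Sum.inl br.2) : I × (R ⊕ R')))
      (fun br : I × R' => ((br.1, Sum.inr br.2) : I × (R ⊕ R')))) := by
    rintro (⟨b, r⟩ | ⟨b, r⟩) (⟨b', r'⟩ | ⟨b', r'⟩) h <;> simp_all
  exact expect_piWeight_comp₂ he (fun br : I × (R ⊕ R') => hp br.1) G

lemma expect_split_pair {R : Type} [Fintype R] [DecidableEq R] {p : I → A × C → ℝ}
    (hp : ∀ b, p b ∈ stdSimplex ℝ (A × C)) (G : (I × R → (A × C) × (A × C)) → ℝ) :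
    expect (piWeight fun br : I × (R ⊕ R) => p br.1) (fun y =>
      G fun br => (y (br.1, Sum.inl br.2), y (br.1, Sum.inr br.2))) =
      expect (piWeight fun br : I × R => pairWeight (p br.1)) G := by
  have h1 := expect_split (R := R) (R' := R) hp (fun y z => G fun br => (y br, z br))
  have h2 := expect_piWeight_pair (fun br : I × R => p br.1) (fun br _ => p br.1)
    (fun y z => G fun br => (y br, z br))
  exact h1.trans h2.symm

/-- The samples of the different roles are independent. -/
lemma expect_roles {s t k : ℕ} {p : I → A × C → ℝ} (hp : ∀ b, p b ∈ stdSimplex ℝ (A × C))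
    (G : (I × Fin s → A × C) × (I × Fin t → A × C) →
      (I × Fin k → (A × C) × (A × C)) × (I × Fin k → (A × C) × (A × C)) → ℝ) :
    expect (piWeight fun br : I × Role s t k => p br.1) (fun y => G (selecting y) (groups y)) =
      expect (selectWeight s t p) fun yz => expect (groupsWeight k p) (G yz) := by
  let pr : (I × (Fin k ⊕ Fin k) → A × C) → I × Fin k → (A × C) × (A × C) :=
    fun y br => (y (br.1, Sum.inl br.2), y (br.1, Sum.inr br.2))
  have h1 := expect_split (R := Fin s ⊕ Fin t) (R' := (Fin k ⊕ Fin k) ⊕ (Fin k ⊕ Fin k)) hp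
    (fun y z => G (fun bi => y (bi.1, Sum.inl bi.2), fun bi => y (bi.1, Sum.inr bi.2))
      (pr fun bi => z (bi.1, Sum.inl bi.2), pr fun bi => z (bi.1, Sum.inr bi.2)))
  have h2 : ∀ yz, expect (piWeight fun br : I × ((Fin k ⊕ Fin k) ⊕ (Fin k ⊕ Fin k)) => p br.1)
      (fun z => G yz (pr fun bi => z (bi.1, Sum.inl bi.2), pr fun bi => z (bi.1, Sum.inr bi.2))) =
      expect (groupsWeight k p) (G yz) := fun yz => by
    have h3 := expect_split (R := Fin k ⊕ Fin k) (R' := Fin k ⊕ Fin k) hp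
      (fun y z => G yz (pr y, pr z))
    have h4 : ∀ ξ, expect (piWeight fun br : I × (Fin k ⊕ Fin k) => p br.1)
        (fun z => G yz (ξ, pr z)) =
        expect (piWeight fun br : I × Fin k => pairWeight (p br.1)) fun η => G yz (ξ, η) :=
      fun ξ => expect_split_pair hp (fun η => G yz (ξ, η))
    simp only [h4] at h3
    have h5 := expect_split_pair hp (fun ξ : I × Fin k → (A × C) × (A × C) =>
      expect (piWeight fun br : I × Fin k => pairWeight (p br.1)) fun η => G yz (ξ, η))
    have h6 := expect_prod (piWeight fun br : I × Fin k => pairWeight (p br.1))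
      (piWeight fun br : I × Fin k => pairWeight (p br.1)) (G yz)
    exact h3.trans (h5.trans h6.symm)
  have h7 := expect_split (R := Fin s) (R' := Fin t) hp
    (fun y z => expect (groupsWeight k p) (G (y, z)))
  have h8 := expect_prod (piWeight fun br : I × Fin s => p br.1)
      (piWeight fun br : I × Fin t => p br.1) (fun yz => expect (groupsWeight k p) (G yz))
  refine Eq.trans ?_ (h7.trans h8.symm)
  refine h1.trans ?_
  simp only [h2]

end Roles

/-! ### The random set of used bins -/

section Hits

variable {B Role : Type} [Fintype B] [Fintype Role] [DecidableEq B] [DecidableEq Role]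

/-- Weights of the bins of i.i.d. samples arranged in blocks. -/
def blockWeight (Role : Type) [Fintype Role] (n : ℕ) (q : B → ℝ) : (Role → Fin n → B) → ℝ :=
  piWeight fun _ : Role => piWeight fun _ : Fin n => q

lemma blockWeight_mem (n : ℕ) {q : B → ℝ} (hq : q ∈ stdSimplex ℝ B) :
    blockWeight Role n q ∈ stdSimplex ℝ (Role → Fin n → B) :=
  piWeight_mem_stdSimplex fun _ => piWeight_mem_stdSimplex fun _ => hq

/-- Indicator that a bin is used. -/
def hit {n : ℕ} (β : Role → Fin n → B) (b : B) : ℝ := if b ∈ usedBins β then 1 else 0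

/-- Indicator that a block misses a bin. -/
def miss {n : ℕ} (γ : Fin n → B) (b : B) : ℝ := ∏ i, (1 - delta (γ i) b)

lemma one_sub_miss {n : ℕ} (γ : Fin n → B) (b : B) :
    1 - miss γ b = if ∃ i, γ i = b then 1 else 0 := by
  unfold miss delta
  split_ifs with h
  · obtain ⟨i, hi⟩ := h
    rw [Finset.prod_eq_zero (Finset.mem_univ i) (by simp [hi]), sub_zero]
  · push Not at h
    rw [Finset.prod_eq_one fun i _ => by simp [h i], sub_self]

/-- A bin is used when no block misses it. The blocks are independent, so this product turns moments
of `hit` into powers of moments for a single block. -/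
lemma hit_eq {n : ℕ} (β : Role → Fin n → B) (b : B) : hit β b = ∏ r, (1 - miss (β r) b) := by
  simp only [one_sub_miss, hit, usedBins, Finset.mem_filter, Finset.mem_univ, true_and]
  rw [Finset.prod_ite_zero]
  simp

lemma expect_one_sub_delta {q : B → ℝ} (hq : q ∈ stdSimplex ℝ B) (b : B) :
    expect q (fun x => 1 - delta x b) = 1 - q b := by
  rw [expect_sub, expect_const hq]; simp [expect, delta]

lemma expect_miss {n : ℕ} {q : B → ℝ} (hq : q ∈ stdSimplex ℝ B) (b : B) :
    expect (piWeight fun _ : Fin n => q) (fun γ => miss γ b) = (1 - q b) ^ n := by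
  have h := expect_piWeight_prod (fun _ : Fin n => q) (fun _ x => 1 - delta x b)
  simp only [expect_one_sub_delta hq] at h
  simpa [miss] using h

lemma expect_miss_mul {n : ℕ} {q : B → ℝ} (hq : q ∈ stdSimplex ℝ B) {b b' : B} (hb : b ≠ b') :
    expect (piWeight fun _ : Fin n => q) (fun γ => miss γ b * miss γ b') =
      (1 - q b - q b') ^ n := by
  have h := expect_piWeight_prod (fun _ : Fin n => q)
    (fun _ x => (1 - delta x b) * (1 - delta x b'))
  have e : expect q (fun x => (1 - delta x b) * (1 - delta x b')) = 1 - q b - q b' := by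
    have : ∀ x, (1 - delta x b) * (1 - delta x b') = (1 - delta x b) - delta x b' := fun x => by
      by_cases h1 : x = b
      · subst h1; simp [delta, hb]
      · simp [delta, h1]
    simp only [this]
    rw [expect_sub, expect_one_sub_delta hq]; simp [expect, delta]
  simp only [e, Finset.prod_mul_distrib] at h
  simpa [miss] using h

/-- Probability that a bin is used. -/
def hitProb (R n : ℕ) (x : ℝ) : ℝ := (1 - (1 - x) ^ n) ^ R

lemma expect_hit {n : ℕ} {q : B → ℝ} (hq : q ∈ stdSimplex ℝ B) (b : B) :
    expect (blockWeight Role n q) (fun β => hit β b) = hitProb (Fintype.card Role) n (q b) := by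
  simp only [hit_eq]
  have h := expect_piWeight_prod (fun _ : Role => piWeight fun _ : Fin n => q)
    (fun _ γ => 1 - miss γ b)
  rw [blockWeight, h, expect_sub, expect_const (piWeight_mem_stdSimplex fun _ => hq),
    expect_miss hq]
  simp [hitProb]

/-- Different bins are negatively correlated. -/
lemma expect_hit_mul_le {n : ℕ} {q : B → ℝ} (hq : q ∈ stdSimplex ℝ B) {b b' : B} (hb : b ≠ b') :
    expect (blockWeight Role n q) (fun β => hit β b * hit β b') ≤
      hitProb (Fintype.card Role) n (q b) * hitProb (Fintype.card Role) n (q b') := by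
  simp only [hit_eq, ← Finset.prod_mul_distrib]
  have h := expect_piWeight_prod (fun _ : Role => piWeight fun _ : Fin n => q)
    (fun _ γ => (1 - miss γ b) * (1 - miss γ b'))
  have hpi := piWeight_mem_stdSimplex (ι := Fin n) (fun _ => hq)
  have hle : q b + q b' ≤ 1 := by
    rw [← hq.2, ← Finset.sum_pair hb]
    exact Finset.sum_le_sum_of_subset_of_nonneg (Finset.subset_univ _) fun i _ _ => hq.1 i
  -- Within a block, missing both bins has probability `(1 - q b - q b') ^ n`, at most the product
  -- of the two separate probabilities.
  have e : expect (piWeight fun _ : Fin n => q) (fun γ => (1 - miss γ b) * (1 - miss γ b')) ≤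
      (1 - (1 - q b) ^ n) * (1 - (1 - q b') ^ n) := by
    have : ∀ γ : Fin n → B, (1 - miss γ b) * (1 - miss γ b') =
        1 - miss γ b - miss γ b' + miss γ b * miss γ b' := fun γ => by ring
    simp only [this]
    rw [expect_add, expect_sub, expect_sub, expect_const hpi, expect_miss hq, expect_miss hq,
      expect_miss_mul hq hb]
    have h1 : (1 - q b - q b') ^ n ≤ ((1 - q b) * (1 - q b')) ^ n :=
      pow_le_pow_left₀ (by linarith) (by nlinarith [mul_nonneg (hq.1 b) (hq.1 b')]) n
    rw [mul_pow] at h1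
    nlinarith
  rw [blockWeight, h, Finset.prod_const, hitProb, hitProb, ← mul_pow]
  refine pow_le_pow_left₀ (expect_nonneg hpi fun γ => mul_nonneg ?_ ?_) e _
  · rw [one_sub_miss]; split_ifs <;> norm_num
  · rw [one_sub_miss]; split_ifs <;> norm_num

lemma sum_usedBins_eq {n : ℕ} (β : Role → Fin n → B) (Q : B → ℝ) :
    ∑ b ∈ usedBins β, Q b = ∑ b, Q b * hit β b := by
  simp [hit, Finset.sum_ite_mem]

/-- Second moment bound for the total of a nonnegative function over the used bins. -/
lemma prob_sum_usedBins_lt_le {n : ℕ} {q : B → ℝ} (hq : q ∈ stdSimplex ℝ B) {Q : B → ℝ}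
    (hQ0 : ∀ b, 0 ≤ Q b) {D E : ℝ} (hQD : ∀ b, Q b ≤ D)
    (hE : E = ∑ b, Q b * hitProb (Fintype.card Role) n (q b)) (hED : 40 * D ≤ E) (hE0 : 0 < E) :
    prob (blockWeight Role n q) (fun β => ∑ b ∈ usedBins β, Q b < E / 2) ≤ 1 / 10 := by
  have hw := blockWeight_mem (Role := Role) n hq
  set P : B → ℝ := fun b => hitProb (Fintype.card Role) n (q b) with hP
  have hvar : expect (blockWeight Role n q) (fun β => (∑ b, Q b * hit β b - E) ^ 2) ≤
      ∑ b, Q b ^ 2 * P b := by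
    have hexp : ∀ β : Role → Fin n → B, (∑ b, Q b * hit β b - E) ^ 2 =
        ∑ b, ∑ b', Q b * Q b' * (hit β b * hit β b') - 2 * E * ∑ b, Q b * hit β b + E ^ 2 :=
      fun β => by
        have : ∑ b, ∑ b', Q b * Q b' * (hit β b * hit β b') =
            (∑ b, Q b * hit β b) * ∑ b, Q b * hit β b := by
          rw [Finset.sum_mul_sum]
          exact Finset.sum_congr rfl fun _ _ => Finset.sum_congr rfl fun _ _ => by ring
        rw [this]; ring
    simp only [hexp]
    rw [expect_add, expect_sub, expect_const_mul, expect_const hw, expect_sum, expect_sum]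
    simp only [expect_sum, expect_const_mul, expect_hit hq]
    have hpair : ∀ b b', Q b * Q b' * expect (blockWeight Role n q)
        (fun β => hit β b * hit β b') ≤ Q b * P b * (Q b' * P b') +
          if b = b' then Q b ^ 2 * P b else 0 := fun b b' => by
      by_cases hb : b = b'
      · subst hb
        have hh : ∀ β : Role → Fin n → B, hit β b * hit β b = hit β b := fun β => by
          unfold hit; split_ifs <;> norm_num
        simp only [hh, expect_hit hq, if_true]
        nlinarith [mul_self_nonneg (Q b * P b)]
      · have := mul_le_mul_of_nonneg_left (expect_hit_mul_le (Role := Role) (n := n) hq hb)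
          (mul_nonneg (hQ0 b) (hQ0 b'))
        rw [if_neg hb, add_zero]
        linarith
    have hsum := Finset.sum_le_sum fun i (_ : i ∈ Finset.univ) =>
      Finset.sum_le_sum fun j (_ : j ∈ Finset.univ) => hpair i j
    simp only [Finset.sum_add_distrib, Finset.sum_ite_eq, Finset.mem_univ, if_true,
      ← Finset.sum_mul_sum] at hsum
    rw [← hE]
    nlinarith [hsum]
  have hP0 : ∀ b, 0 ≤ P b := fun b => by
    simp only [hP, ← expect_hit (Role := Role) (n := n) hq b]
    exact expect_nonneg hw fun β => by unfold hit; split_ifs <;> norm_num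
  -- Then Chebyshev at distance `E / 2` gives `4 * D / E ≤ 1 / 10`.
  have hvar2 : ∑ b, Q b ^ 2 * P b ≤ D * E := by
    rw [hE, Finset.mul_sum]
    refine Finset.sum_le_sum fun b _ => ?_
    nlinarith [mul_nonneg (mul_nonneg (sub_nonneg.2 (hQD b)) (hQ0 b)) (hP0 b)]
  calc _ ≤ prob (blockWeight Role n q)
        (fun β => (E / 2) ^ 2 ≤ (∑ b, Q b * hit β b - E) ^ 2) :=
        prob_mono hw fun β h => by
          rw [sum_usedBins_eq] at h
          nlinarith
    _ ≤ _ := prob_le_expect_div hw (fun _ => sq_nonneg _) (by positivity)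
    _ ≤ 1 / 10 := by
      rw [div_le_iff₀ (by positivity)]
      nlinarith

/-- First moment bound for the total over the used bins when most bins are used. -/
lemma prob_sum_usedBins_lt_le' {n : ℕ} {q : B → ℝ} (hq : q ∈ stdSimplex ℝ B) {Q : B → ℝ}
    (hQ0 : ∀ b, 0 ≤ Q b) (hQ : 0 < ∑ b, Q b)
    (hhit : ∀ b, Q b ≠ 0 → 19 / 20 ≤ hitProb (Fintype.card Role) n (q b)) :
    prob (blockWeight Role n q) (fun β => ∑ b ∈ usedBins β, Q b < (∑ b, Q b) / 2) ≤ 1 / 10 := by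
  have hw := blockWeight_mem (Role := Role) n hq
  have hh : ∀ β : Role → Fin n → B, ∀ b, hit β b ≤ 1 := fun β b => by
    unfold hit; split_ifs <;> norm_num
  calc _ ≤ prob (blockWeight Role n q)
        (fun β => (∑ b, Q b) / 2 ≤ ∑ b, Q b * (1 - hit β b)) :=
        prob_mono hw fun β h => by
          rw [sum_usedBins_eq] at h
          simp only [mul_sub, Finset.sum_sub_distrib, mul_one]
          linarith
    _ ≤ _ := prob_le_expect_div hw (fun β => Finset.sum_nonneg fun b _ =>
        mul_nonneg (hQ0 b) (by linarith [hh β b])) (by positivity)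
    _ ≤ 1 / 10 := by
      rw [div_le_iff₀ (by positivity), expect_sum]
      simp only [expect_const_mul, expect_sub, expect_const hw, expect_hit hq]
      have : ∑ b, Q b * (1 - hitProb (Fintype.card Role) n (q b)) ≤ ∑ b, Q b * (1 / 20) := by
        refine Finset.sum_le_sum fun b _ => ?_
        by_cases hb : Q b = 0
        · simp [hb]
        · exact mul_le_mul_of_nonneg_left (by linarith [hhit b hb]) (hQ0 b)
      rw [← Finset.sum_mul] at this
      linarith

end Hits

/-! ### The test at one scale -/

section Scale

variable {A B C : Type} [Fintype A] [Fintype B] [Fintype C] [DecidableEq A] [DecidableEq B]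
  [DecidableEq C]

/-- The distribution with bin weights `q` and conditional distributions `p`. -/
def joint (q : B → ℝ) (p : B → A × C → ℝ) (x : A × B × C) : ℝ := q x.2.1 * p x.2.1 (x.1, x.2.2)

/-- The test at a given scale. -/
lemma exists_scale_test {N n k KA KC : ℕ} (hk : 1 ≤ k) (hKA : 1 ≤ KA) (hKC : 1 ≤ KC)
    (hN : (2 * (KA - 1) + 2 * (KC - 1) + 4 * k) * n ≤ N) {ρ T : ℝ} (hT : 0 < T) (hρ1 : 1 ≤ ρ)
    (hρ : (k : ℝ) ^ 2 * (min (Fintype.card B : ℝ) n *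
      (flatNorm (Fintype.card A) KA * flatNorm (Fintype.card C) KC)) ≤ ρ ^ 2) :
    ∃ Rej : (Fin N → A × B × C) → Prop, ∀ q ∈ stdSimplex ℝ B, ∀ p : B → A × C → ℝ,
      (∀ b, p b ∈ stdSimplex ℝ (A × C)) →
      ((∀ b z, depend (p b) z = 0) →
        prob (piWeight fun _ : Fin N => joint q p) Rej ≤ 128 * ρ ^ 2 / T ^ 2) ∧
      ∀ cells : B → Finset (A × C),
        (∀ b, ∀ z ∈ cells b, ((KA : ℝ) - 1) * margFst (p b) z.1 ≤ 1 / 80) →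
        (∀ b, ∀ z ∈ cells b, ((KC : ℝ) - 1) * margSnd (p b) z.2 ≤ 1 / 80) →
        ∀ Y, 10 ^ 6 * ρ ≤ Y → T ≤ Y →
        prob (blockWeight (Role (2 * (KA - 1)) (2 * (KC - 1)) k) n q) (fun β =>
          ∑ b ∈ usedBins β, (k : ℝ) ^ 2 * ∑ z ∈ cells b, depend (p b) z ^ 2 < Y) ≤ 1 / 10 →
        2 / 3 ≤ prob (piWeight fun _ : Fin N => joint q p) Rej := by
  have hcard : Fintype.card (Role (2 * (KA - 1)) (2 * (KC - 1)) k) * n ≤ N := by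
    refine le_trans (le_of_eq ?_) hN
    simp only [Fintype.card_sum, Fintype.card_fin]; ring
  have : Nonempty (Role (2 * (KA - 1)) (2 * (KC - 1)) k) := ⟨Sum.inr (Sum.inl (Sum.inl ⟨0, hk⟩))⟩
  obtain ⟨Rej, hRej⟩ := exists_rejection (A := A) (B := B) (C := C) hcard
    (fun U y => T ≤ cellStat (selectCells (selecting y)) (groups y))
  refine ⟨Rej, fun q hq p hp => ?_⟩
  have hw := blockWeight_mem (Role := Role (2 * (KA - 1)) (2 * (KC - 1)) k) n hq
  have hRej' := hRej q hq p hp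
  have hrole : ∀ U : Finset B, prob (piWeight fun br : U × Role (2 * (KA - 1)) (2 * (KC - 1)) k =>
      p br.1) (fun y => T ≤ cellStat (selectCells (selecting y)) (groups y)) =
      expect (selectWeight (2 * (KA - 1)) (2 * (KC - 1)) fun b : U => p b) (fun yz =>
        prob (groupsWeight k fun b : U => p b) fun ξη => T ≤ cellStat (selectCells yz) ξη) :=
    fun U => expect_roles (p := fun b : U => p b) (fun b => hp b) (fun yz ξη =>
      @ite ℝ (T ≤ cellStat (selectCells yz) ξη) (Classical.propDecidable _) 1 0)
  have hcardU : ∀ β : Role (2 * (KA - 1)) (2 * (KC - 1)) k → Fin n → B, (k : ℝ) ^ 2 *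
      ((Fintype.card (usedBins β) : ℝ) *
      (flatNorm (Fintype.card A) KA * flatNorm (Fintype.card C) KC)) ≤ ρ ^ 2 := fun β => by
    refine le_trans ?_ hρ
    refine mul_le_mul_of_nonneg_left (mul_le_mul_of_nonneg_right ?_
      (mul_nonneg (flatNorm_nonneg _ _) (flatNorm_nonneg _ _))) (sq_nonneg _)
    rw [Fintype.card_coe]
    -- Used bins number at most `dB`, and at most `n` because a single block must hit all of them.
    -- The minima in the rates originate here.
    exact le_min (by exact_mod_cast Finset.card_le_univ _)
      (by exact_mod_cast card_usedBins_le β)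
  simp only [hrole] at hRej'
  change prob (piWeight fun _ : Fin N => joint q p) Rej = expect (blockWeight _ n q) _ at hRej'
  rw [hRej']
  refine ⟨fun hind => ?_, fun cells hA hC Y hYρ hTY hβ => ?_⟩
  · refine (expect_mono hw fun β => prob_cellStat_ge_le_of_depend_eq_zero hKA hKC
      (fun b : usedBins β => hp b) (fun b z => hind b z) hT (hcardU β)).trans (le_of_eq ?_)
    exact expect_const hw _
  · have hsum : ∀ β : Role (2 * (KA - 1)) (2 * (KC - 1)) k → Fin n → B,
        ¬ (∑ b ∈ usedBins β, (k : ℝ) ^ 2 * ∑ z ∈ cells b, depend (p b) z ^ 2 < Y) →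
        Y ≤ (k : ℝ) ^ 2 * ∑ b : usedBins β, ∑ z ∈ cells b, depend (p b) z ^ 2 := fun β hYβ => by
      rw [Finset.mul_sum]
      rw [not_lt, ← Finset.sum_coe_sort] at hYβ
      exact hYβ
    -- Success `4 / 5` given enough signal in the used bins, minus `1 / 10` for too little signal,
    -- exceeds `2 / 3`.
    have h := sub_prob_le_expect hw _ (by norm_num : (4 / 5 : ℝ) ≤ 1) (fun β =>
      expect_nonneg (selectWeight_mem (2 * (KA - 1)) (2 * (KC - 1))
        fun b : usedBins β => hp b) fun yz => prob_nonneg (groupsWeight_mem k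
          fun b : usedBins β => hp b) fun ξη => T ≤ cellStat (selectCells yz) ξη) (fun β hYβ =>
      le_prob_cellStat_ge hKA hKC (fun b : usedBins β => hp b) (fun b => cells b)
          (fun b z hz => hA b z hz) (fun b z hz => hC b z hz) hρ1 (hcardU β) rfl
          (hYρ.trans (hsum β hYβ)) (hTY.trans (hsum β hYβ)))
    linarith

end Scale

/-! ### Hellinger contributions against quadratic dependence, cell by cell -/

lemma sq_sqrt_sub_sqrt_le_abs {x y : ℝ} (hx : 0 ≤ x) (hy : 0 ≤ y) :
    (Real.sqrt x - Real.sqrt y) ^ 2 ≤ |x - y| := by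
  have h : x - y = (Real.sqrt x - Real.sqrt y) * (Real.sqrt x + Real.sqrt y) := by
    nlinarith [Real.mul_self_sqrt hx, Real.mul_self_sqrt hy]
  rw [h, abs_mul, ← sq_abs, pow_two]
  refine mul_le_mul_of_nonneg_left ?_ (abs_nonneg _)
  rw [abs_of_nonneg (add_nonneg (Real.sqrt_nonneg x) (Real.sqrt_nonneg y)), abs_le]
  constructor <;> linarith [Real.sqrt_nonneg x, Real.sqrt_nonneg y]

lemma mul_sq_sqrt_sub_sqrt_le {x y : ℝ} (hx : 0 ≤ x) (hy : 0 ≤ y) :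
    y * (Real.sqrt x - Real.sqrt y) ^ 2 ≤ (x - y) ^ 2 := by
  have h : (x - y) ^ 2 = (Real.sqrt x + Real.sqrt y) ^ 2 * (Real.sqrt x - Real.sqrt y) ^ 2 := by
    have : x - y = (Real.sqrt x + Real.sqrt y) * (Real.sqrt x - Real.sqrt y) := by
      nlinarith [Real.mul_self_sqrt hx, Real.mul_self_sqrt hy]
    rw [this, mul_pow]
  rw [h]
  refine mul_le_mul_of_nonneg_right ?_ (sq_nonneg _)
  nlinarith [Real.sq_sqrt hy, Real.sqrt_nonneg x, Real.sqrt_nonneg y,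
    mul_nonneg (Real.sqrt_nonneg x) (Real.sqrt_nonneg y), sq_nonneg (Real.sqrt x)]

section Cells

variable {A C : Type} [Fintype A] [Fintype C]

/-- Contribution of a cell to twice the squared Hellinger distance from the product of marginals. -/
def cellHell (p : A × C → ℝ) (z : A × C) : ℝ :=
  (Real.sqrt (p z) - Real.sqrt (margFst p z.1 * margSnd p z.2)) ^ 2

lemma cellHell_nonneg (p : A × C → ℝ) (z : A × C) : 0 ≤ cellHell p z := sq_nonneg _

/-- Valid for cells of any size; used with Cauchy-Schwarz when only the number of cells is under
control. -/
lemma cellHell_le_abs {p : A × C → ℝ} (hp : p ∈ stdSimplex ℝ (A × C)) (z : A × C) :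
    cellHell p z ≤ |depend p z| :=
  sq_sqrt_sub_sqrt_le_abs (hp.1 z) (mul_nonneg ((margFst_mem hp).1 _) ((margSnd_mem hp).1 _))

/-- Stronger than the absolute bound when the marginals are bounded below, since it compares with
`depend ^ 2` linearly. -/
lemma mul_cellHell_le {p : A × C → ℝ} (hp : p ∈ stdSimplex ℝ (A × C)) (z : A × C) :
    margFst p z.1 * margSnd p z.2 * cellHell p z ≤ depend p z ^ 2 :=
  mul_sq_sqrt_sub_sqrt_le (hp.1 z) (mul_nonneg ((margFst_mem hp).1 _) ((margSnd_mem hp).1 _))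

lemma sum_margFst_mul_margSnd {p : A × C → ℝ} (hp : p ∈ stdSimplex ℝ (A × C)) :
    ∑ z : A × C, margFst p z.1 * margSnd p z.2 = 1 :=
  (prod_mem_stdSimplex (margFst_mem hp) (margSnd_mem hp)).2

lemma sum_abs_depend_le {p : A × C → ℝ} (hp : p ∈ stdSimplex ℝ (A × C)) :
    ∑ z, |depend p z| ≤ 2 := by
  have h : ∀ z, |depend p z| ≤ p z + margFst p z.1 * margSnd p z.2 := fun z => by
    have h1 := hp.1 z
    have h2 := mul_nonneg ((margFst_mem hp).1 z.1) ((margSnd_mem hp).1 z.2)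
    rw [depend, abs_le]; constructor <;> linarith
  refine (Finset.sum_le_sum fun z _ => h z).trans ?_
  rw [Finset.sum_add_distrib, hp.2, sum_margFst_mul_margSnd hp]; norm_num

lemma sum_cellHell_le {p : A × C → ℝ} (hp : p ∈ stdSimplex ℝ (A × C)) :
    ∑ z, cellHell p z ≤ 2 :=
  (Finset.sum_le_sum fun z _ => cellHell_le_abs hp z).trans (sum_abs_depend_le hp)

lemma sum_depend_sq_le {p : A × C → ℝ} (hp : p ∈ stdSimplex ℝ (A × C)) :
    ∑ z, depend p z ^ 2 ≤ 4 := by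
  have h0 : 0 ≤ ∑ z, |depend p z| := Finset.sum_nonneg fun z _ => abs_nonneg _
  calc ∑ z, depend p z ^ 2 = ∑ z, |depend p z| ^ 2 := by simp
    _ ≤ (∑ z, |depend p z|) ^ 2 :=
      Finset.sum_sq_le_sq_sum_of_nonneg fun z _ => abs_nonneg _
    _ ≤ 4 := by nlinarith [sum_abs_depend_le hp]

/-- Cauchy-Schwarz over a set of cells. -/
lemma sq_sum_cellHell_le {I : Type} [Fintype I] {p : I → A × C → ℝ}
    (hp : ∀ b, p b ∈ stdSimplex ℝ (A × C)) (cells : I → Finset (A × C)) {J : ℝ}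
    (hJ : ∑ b, ((cells b).card : ℝ) ≤ J) :
    (∑ b, ∑ z ∈ cells b, cellHell (p b) z) ^ 2 ≤
      J * ∑ b, ∑ z ∈ cells b, depend (p b) z ^ 2 := by
  rw [Finset.sum_sigma', Finset.sum_sigma']
  set s := Finset.univ.sigma cells with hs
  have hcard : (s.card : ℝ) ≤ J := by
    rw [hs, Finset.card_sigma]; push_cast; exact hJ
  calc (∑ x ∈ s, cellHell (p x.1) x.2) ^ 2
      ≤ s.card * ∑ x ∈ s, cellHell (p x.1) x.2 ^ 2 := sq_sum_le_card_mul_sum_sq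
    _ ≤ J * ∑ x ∈ s, depend (p x.1) x.2 ^ 2 := by
      refine mul_le_mul hcard (Finset.sum_le_sum fun x _ => ?_)
        (Finset.sum_nonneg fun x _ => sq_nonneg _) (le_trans (Nat.cast_nonneg _) hcard)
      rw [← sq_abs (depend _ _)]
      exact pow_le_pow_left₀ (cellHell_nonneg _ _) (cellHell_le_abs (hp _) _) 2

end Cells

/-! ### Decomposition into bins -/

section Factor

variable {A B C : Type} [Fintype A] [Fintype B] [Fintype C]

/-- Every distribution is a mixture of its conditional distributions. -/
lemma exists_joint [Nonempty A] [Nonempty C] {P : A × B × C → ℝ}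
    (hP : P ∈ stdSimplex ℝ (A × B × C)) :
    ∃ q ∈ stdSimplex ℝ B, ∃ p : B → A × C → ℝ, (∀ b, p b ∈ stdSimplex ℝ (A × C)) ∧
      P = joint q p ∧
      (∀ x, markovRef P x = q x.2.1 * (margFst (p x.2.1) x.1 * margSnd (p x.2.1) x.2.2)) ∧
      ∀ b, q b = 0 → ∀ z, depend (p b) z = 0 := by
  classical
  obtain ⟨a₀⟩ := ‹Nonempty A›
  obtain ⟨c₀⟩ := ‹Nonempty C›
  set q : B → ℝ := margB P with hq
  -- An empty bin receives a point mass, for which rows and columns are independent, so it never has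
  -- to be excluded later.
  set p : B → A × C → ℝ := fun b z =>
    if q b = 0 then delta z (a₀, c₀) else P (z.1, b, z.2) / q b with hpdef
  have hq0 : ∀ b, 0 ≤ q b := fun b =>
    Finset.sum_nonneg fun a _ => Finset.sum_nonneg fun c _ => hP.1 _
  have hqsum : ∀ b, ∑ z : A × C, P (z.1, b, z.2) = q b := fun b => by
    rw [Fintype.sum_prod_type]; rfl
  have hPz : ∀ b, q b = 0 → ∀ z : A × C, P (z.1, b, z.2) = 0 := fun b hb z => by
    have := hqsum b
    rw [hb, Finset.sum_eq_zero_iff_of_nonneg fun z _ => hP.1 _] at this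
    exact this z (Finset.mem_univ _)
  have hp : ∀ b, p b ∈ stdSimplex ℝ (A × C) := fun b => by
    by_cases hb : q b = 0
    · simp only [hpdef, hb, if_true]
      exact ⟨fun z => by dsimp only [delta]; split_ifs <;> norm_num, by simp [delta]⟩
    · simp only [hpdef, hb, if_false]
      refine ⟨fun z => div_nonneg (hP.1 _) (hq0 b), ?_⟩
      rw [← Finset.sum_div, hqsum, div_self hb]
  have hjoint : ∀ a b c, P (a, b, c) = q b * p b (a, c) := fun a b c => by
    by_cases hb : q b = 0
    · rw [hb, zero_mul]; exact hPz b hb (a, c)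
    · simp only [hpdef, hb, if_false]
      rw [mul_div_cancel₀ _ hb]
  have hAB : ∀ a b, margAB P a b = q b * margFst (p b) a := fun a b => by
    simp [margAB, margFst, hjoint, Finset.mul_sum]
  have hBC : ∀ b c, margBC P b c = q b * margSnd (p b) c := fun b c => by
    simp [margBC, margSnd, hjoint, Finset.mul_sum]
  refine ⟨q, ⟨hq0, ?_⟩, p, hp, ?_, ?_, ?_⟩
  · rw [← hP.2, Fintype.sum_equiv (binFirst A B C) P (fun y => P (y.2.1, y.1, y.2.2)) fun _ => rfl,
      Fintype.sum_prod_type]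
    exact Finset.sum_congr rfl fun b _ => (hqsum b).symm
  · ext ⟨a, b, c⟩; exact hjoint a b c
  · rintro ⟨a, b, c⟩
    simp only [markovRef, condCB, hAB, hBC, ← hq]
    by_cases hb : q b = 0
    · simp [hb]
    · field_simp
  · intro b hb z
    simp only [depend, hpdef, hb, margFst, margSnd, delta, Prod.ext_iff, ite_and, if_true,
      Finset.sum_ite_eq', Finset.mem_univ, Finset.sum_ite_irrel, Finset.sum_const_zero]
    by_cases h1 : z.1 = a₀ <;> by_cases h2 : z.2 = c₀ <;> simp [h1, h2]

lemma hellingerSq_joint {q : B → ℝ} (hq : q ∈ stdSimplex ℝ B) (p : B → A × C → ℝ)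
    {Q : A × B × C → ℝ}
    (hQ : ∀ x, Q x = q x.2.1 * (margFst (p x.2.1) x.1 * margSnd (p x.2.1) x.2.2)) :
    hellingerSq (joint q p) Q = (1 / 2) * ∑ b, q b * ∑ z, cellHell (p b) z := by
  unfold hellingerSq
  congr 1
  refine (Fintype.sum_equiv (binFirst A B C) _
    (fun y => q y.1 * cellHell (p y.1) y.2) fun x => ?_).trans ?_
  · have h0 := hq.1 x.2.1
    rw [hQ, joint, Real.sqrt_mul h0, Real.sqrt_mul h0, ← mul_sub, mul_pow, Real.sq_sqrt h0]
    rfl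
  · rw [Fintype.sum_prod_type]
    simp [Finset.mul_sum]

lemma depend_eq_zero_of_hellingerSq_eq_zero {q : B → ℝ} (hq : q ∈ stdSimplex ℝ B)
    {p : B → A × C → ℝ} (hp : ∀ b, p b ∈ stdSimplex ℝ (A × C))
    (h0 : ∀ b, q b = 0 → ∀ z, depend (p b) z = 0)
    (h : (1 / 2) * ∑ b, q b * ∑ z, cellHell (p b) z = 0) (b : B) (z : A × C) :
    depend (p b) z = 0 := by
  by_cases hb : q b = 0
  · exact h0 b hb z
  have hs : ∀ b, 0 ≤ ∑ z, cellHell (p b) z := fun b =>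
    Finset.sum_nonneg fun z _ => cellHell_nonneg _ _
  have h1 : ∑ b, q b * ∑ z, cellHell (p b) z = 0 := by linarith
  rw [Finset.sum_eq_zero_iff_of_nonneg fun b _ => mul_nonneg (hq.1 b) (hs b)] at h1
  have h2 := (mul_eq_zero.1 (h1 b (Finset.mem_univ b))).resolve_left hb
  rw [Finset.sum_eq_zero_iff_of_nonneg fun z _ => cellHell_nonneg _ _] at h2
  have h3 := h2 z (Finset.mem_univ z)
  have hq0 := mul_nonneg ((margFst_mem (hp b)).1 z.1) ((margSnd_mem (hp b)).1 z.2)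
  have h4 := sub_eq_zero.1 (pow_eq_zero_iff two_ne_zero |>.1 h3)
  rw [depend, (Real.sqrt_inj ((hp b).1 z) hq0).1 h4, sub_self]

end Factor

/-! ### Union of finitely many tests -/

section Combine

/-- Rejecting if one of finitely many tests rejects. -/
lemma scCIndep_le_of_rejections {A B C κ : Type} [Fintype A] [Fintype B] [Fintype C] [Fintype κ]
    {ε : ℝ} {N : ℕ} [Nonempty κ]
    {Δ : (A × B × C → ℝ) → (A × B × C → ℝ) → ℝ}
    (Rej : κ → (Fin N → A × B × C) → Prop)
    (h0 : ∀ P ∈ stdSimplex ℝ (A × B × C), Δ P (markovRef P) = 0 → ∀ t,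
      prob (piWeight fun _ : Fin N => P) (Rej t) ≤ 1 / (3 * Fintype.card κ))
    (h1 : ∀ P ∈ stdSimplex ℝ (A × B × C), ε ≤ Δ P (markovRef P) → ∃ t,
      2 / 3 ≤ prob (piWeight fun _ : Fin N => P) (Rej t)) :
    scCIndep Δ ε ≤ N := by
  classical
  refine sInf_le ⟨N, rfl, fun s => if ∃ t ∈ (Finset.univ : Finset κ), Rej t s then 0 else 1,
    fun P hP => ?_⟩
  have hw := piWeight_mem_stdSimplex (ι := Fin N) fun _ => hP
  have hyes : yesProb P (fun s => if ∃ t ∈ (Finset.univ : Finset κ), Rej t s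
      then (0 : unitInterval) else 1) =
      1 - prob (piWeight fun _ : Fin N => P)
        (fun s => ∃ t ∈ (Finset.univ : Finset κ), Rej t s) := by
    rw [← prob_not hw]
    refine Finset.sum_congr rfl fun s _ => ?_
    dsimp only [piWeight]
    by_cases h : ∃ t ∈ (Finset.univ : Finset κ), Rej t s
    · rw [if_pos h, if_neg (not_not.2 h)]; simp
    · rw [if_neg h, if_pos h]; simp
  rw [hyes]
  refine ⟨fun h => ?_, fun h => ?_⟩
  · have h2 := prob_exists_le hw Finset.univ Rej
    have h3 := Finset.sum_le_sum fun t (_ : t ∈ (Finset.univ : Finset κ)) => h0 P hP h t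
    have hc : (0 : ℝ) < Fintype.card κ := by exact_mod_cast Fintype.card_pos
    have h4 : ∑ _t : κ, 1 / (3 * (Fintype.card κ : ℝ)) = 1 / 3 := by
      simp
    linarith
  · obtain ⟨t, ht⟩ := h1 P hP h
    have := prob_mono hw (S := Rej t) (S' := fun s => ∃ t ∈ (Finset.univ : Finset κ), Rej t s)
      fun s hs => ⟨t, Finset.mem_univ _, hs⟩
    linarith

end Combine

/-! ### Dyadic scales of bins and levels of cells -/

/-- The dyadic level of a marginal probability, cut off at `j`. -/
lemma exists_level {x : ℝ} (h0 : 0 ≤ x) (j : ℕ) :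
    ∃ i ≤ j, ((2 : ℝ) ^ i - 1) * x ≤ 1 / 80 ∧ (i = j ∨ 1 / 80 ≤ (2 : ℝ) ^ (i + 1) * x) := by
  induction j with
  | zero => exact ⟨0, le_rfl, by norm_num, Or.inl rfl⟩
  | succ j ih =>
    obtain ⟨i, hij, h1, h2 | h2⟩ := ih
    · subst h2
      by_cases h : ((2 : ℝ) ^ (i + 1) - 1) * x ≤ 1 / 80
      · exact ⟨i + 1, le_rfl, h, Or.inl rfl⟩
      · exact ⟨i, Nat.le_succ i, h1, Or.inr (by linarith)⟩
    · exact ⟨i, hij.trans (Nat.le_succ j), h1, Or.inr h2⟩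

/-- Markov's inequality for counting: points of large mass are few because the total mass is one. -/
lemma card_filter_mul_le {X : Type} [Fintype X] {p : X → ℝ} (hp : p ∈ stdSimplex ℝ X) {s t : ℝ}
    (hs : 0 ≤ s) [DecidablePred fun x => t ≤ s * p x] :
    ((Finset.univ.filter fun x => t ≤ s * p x).card : ℝ) * t ≤ s := by
  calc ((Finset.univ.filter fun x => t ≤ s * p x).card : ℝ) * t
      = ∑ _x ∈ Finset.univ.filter (fun x => t ≤ s * p x), t := by simp
    _ ≤ ∑ x ∈ Finset.univ.filter (fun x => t ≤ s * p x), s * p x :=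
      Finset.sum_le_sum fun x hx => (Finset.mem_filter.1 hx).2
    _ ≤ ∑ x, s * p x := Finset.sum_le_sum_of_subset_of_nonneg (Finset.subset_univ _)
      fun x _ _ => mul_nonneg hs (hp.1 x)
    _ = s := by rw [← Finset.mul_sum, hp.2, mul_one]

section Heavy

variable {A B C : Type} [Fintype A] [Fintype B] [Fintype C]

/-- The cells selected for the scale `2 ^ j` and the levels `i`, `i'`. -/
structure IsScaleCells (q : B → ℝ) (p : B → A × C → ℝ) (m j i i' : ℕ)
    (cells : B → Finset (A × C)) : Prop where
  bin : ∀ b, ∀ z ∈ cells b, (2 : ℝ) ^ j ≤ m * q b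
  fst_le : ∀ b, ∀ z ∈ cells b, ((2 : ℝ) ^ i - 1) * margFst (p b) z.1 ≤ 1 / 80
  snd_le : ∀ b, ∀ z ∈ cells b, ((2 : ℝ) ^ i' - 1) * margSnd (p b) z.2 ≤ 1 / 80
  le_fst : ∀ b, ∀ z ∈ cells b, i = j ∨ 1 / 80 ≤ (2 : ℝ) ^ (i + 1) * margFst (p b) z.1
  le_snd : ∀ b, ∀ z ∈ cells b, i' = j ∨ 1 / 80 ≤ (2 : ℝ) ^ (i' + 1) * margSnd (p b) z.2

/-- Pigeonhole over scales and levels. -/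
lemma exists_isScaleCells {q : B → ℝ} (hq : q ∈ stdSimplex ℝ B) {p : B → A × C → ℝ}
    (hp : ∀ b, p b ∈ stdSimplex ℝ (A × C)) {m : ℕ} (hm : 1 ≤ m) {ε : ℝ} (hε : 0 < ε)
    [DecidablePred fun b => 1 ≤ (m : ℝ) * q b]
    (hfar : ε ≤ ∑ b ∈ Finset.univ.filter (fun b => 1 ≤ (m : ℝ) * q b),
      q b * ∑ z, cellHell (p b) z) :
    ∃ j ≤ Nat.log 2 m, ∃ i ≤ j, ∃ i' ≤ j, ∃ cells : B → Finset (A × C),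
      IsScaleCells q p m j i i' cells ∧
      m * ε / (2 * 2 ^ j * (Nat.log 2 m + 1) ^ 3) ≤ ∑ b, ∑ z ∈ cells b, cellHell (p b) z := by
  classical
  choose! lev hlev using fun (j : ℕ) (x : ℝ) (h : 0 ≤ x) => exists_level h j
  have hA := fun b => (margFst_mem (hp b)).1
  have hC := fun b => (margSnd_mem (hp b)).1
  set L := Nat.log 2 m with hL
  let sc : B → ℕ := fun b => Nat.log 2 ⌊(m : ℝ) * q b⌋₊
  have hsc : ∀ b, 1 ≤ (m : ℝ) * q b →
      (2 : ℝ) ^ sc b ≤ m * q b ∧ (m : ℝ) * q b < 2 ^ (sc b + 1) ∧ sc b ≤ L := fun b hb => by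
    have hfl : ⌊(m : ℝ) * q b⌋₊ ≠ 0 := by
      have := Nat.le_floor (n := 1) (by simpa using hb); omega
    refine ⟨?_, ?_, ?_⟩
    · have h1 := Nat.pow_log_le_self 2 hfl
      have h2 := Nat.floor_le (show 0 ≤ (m : ℝ) * q b by linarith)
      calc (2 : ℝ) ^ sc b = ((2 ^ sc b : ℕ) : ℝ) := by push_cast; rfl
        _ ≤ (⌊(m : ℝ) * q b⌋₊ : ℝ) := by exact_mod_cast h1
        _ ≤ _ := h2
    · have h1 := Nat.lt_pow_succ_log_self (b := 2) one_lt_two ⌊(m : ℝ) * q b⌋₊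
      have h2 := (Nat.floor_lt (show 0 ≤ (m : ℝ) * q b by linarith)).1 h1
      exact_mod_cast h2
    · refine Nat.log_mono_right ?_
      have hq1 : q b ≤ 1 := by
        rw [← hq.2]; exact Finset.single_le_sum (fun y _ => hq.1 y) (Finset.mem_univ b)
      have : (m : ℝ) * q b ≤ m := by nlinarith [(Nat.cast_nonneg m : (0 : ℝ) ≤ m)]
      calc ⌊(m : ℝ) * q b⌋₊ ≤ ⌊(m : ℝ)⌋₊ := Nat.floor_mono this
        _ = m := Nat.floor_natCast m
  let label : B × (A × C) → ℕ × ℕ × ℕ := fun x =>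
    (sc x.1, lev (sc x.1) (margFst (p x.1) x.2.1), lev (sc x.1) (margSnd (p x.1) x.2.2))
  set Hv := Finset.univ.filter (fun b => 1 ≤ (m : ℝ) * q b) with hHv
  set D : Finset (B × (A × C)) := Hv ×ˢ Finset.univ with hD
  set R : Finset (ℕ × ℕ × ℕ) :=
    Finset.range (L + 1) ×ˢ Finset.range (L + 1) ×ˢ Finset.range (L + 1) with hR
  have hmaps : ∀ x ∈ D, label x ∈ R := fun x hx => by
    have hb := (Finset.mem_filter.1 (Finset.mem_product.1 hx).1).2
    have h1 := (hsc x.1 hb).2.2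
    have h2 := (hlev (sc x.1) _ (hA x.1 x.2.1)).1
    have h3 := (hlev (sc x.1) _ (hC x.1 x.2.2)).1
    simp only [hR, label, Finset.mem_product, Finset.mem_range]
    omega
  have hsum := Finset.sum_fiberwise_of_maps_to hmaps
    (fun x => q x.1 * cellHell (p x.1) x.2)
  have htot : ∑ x ∈ D, q x.1 * cellHell (p x.1) x.2 =
      ∑ b ∈ Hv, q b * ∑ z, cellHell (p b) z := by
    rw [hD, Finset.sum_product]; simp [Finset.mul_sum]
  have hRcard : (R.card : ℝ) = (L + 1) ^ 3 := by
    simp only [hR, Finset.card_product, Finset.card_range]; push_cast; ring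
  have hRne : R.Nonempty := ⟨(0, 0, 0), by simp [hR]⟩
  obtain ⟨t, htR, ht⟩ := Finset.exists_le_of_sum_le hRne
    (f := fun _ => ε / ((L : ℝ) + 1) ^ 3) (by
      rw [hsum, htot]
      refine le_trans (le_of_eq ?_) hfar
      rw [Finset.sum_const, nsmul_eq_mul, hRcard, mul_div_cancel₀]
      positivity)
  obtain ⟨j, i, i'⟩ := t
  have hWpos : (0 : ℝ) < ((L : ℝ) + 1) ^ 3 := by positivity
  -- `R` is the full cube of labels; the constraints `j ≤ Nat.log 2 m` and `i, i' ≤ j` are read off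
  -- a cell that carries the label.
  have hne : ∃ x ∈ D, label x = (j, i, i') := by
    by_contra hcon
    push Not at hcon
    rw [Finset.filter_false_of_mem hcon, Finset.sum_empty] at ht
    have : 0 < ε / ((L : ℝ) + 1) ^ 3 := by positivity
    linarith
  obtain ⟨x, hxD, hx⟩ := hne
  have hxb := (Finset.mem_filter.1 (Finset.mem_product.1 hxD).1).2
  simp only [label, Prod.mk.injEq] at hx
  obtain ⟨hxj, hxi, hxi'⟩ := hx
  refine ⟨j, hxj ▸ (hsc x.1 hxb).2.2, i, ?_, i', ?_,
    fun b => Finset.univ.filter fun z => b ∈ Hv ∧ label (b, z) = (j, i, i'), ?_, ?_⟩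
  · rw [← hxi, ← hxj]; exact (hlev (sc x.1) _ (hA x.1 x.2.1)).1
  · rw [← hxi', ← hxj]; exact (hlev (sc x.1) _ (hC x.1 x.2.2)).1
  · have hz : ∀ b z, z ∈ Finset.univ.filter (fun z => b ∈ Hv ∧ label (b, z) = (j, i, i')) →
        1 ≤ (m : ℝ) * q b ∧ sc b = j ∧ lev j (margFst (p b) z.1) = i ∧
          lev j (margSnd (p b) z.2) = i' := fun b z h => by
      obtain ⟨h1, h2⟩ := (Finset.mem_filter.1 h).2
      simp only [label, Prod.mk.injEq] at h2
      obtain ⟨h3, h4, h5⟩ := h2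
      rw [h3] at h4 h5
      exact ⟨(Finset.mem_filter.1 h1).2, h3, h4, h5⟩
    refine ⟨fun b z h => ?_, fun b z h => ?_, fun b z h => ?_, fun b z h => ?_, fun b z h => ?_⟩
    · obtain ⟨h1, h2, -, -⟩ := hz b z h
      rw [← h2]; exact (hsc b h1).1
    · obtain ⟨-, -, h3, -⟩ := hz b z h
      rw [← h3]; exact (hlev j _ (hA b z.1)).2.1
    · obtain ⟨-, -, -, h4⟩ := hz b z h
      rw [← h4]; exact (hlev j _ (hC b z.2)).2.1
    · obtain ⟨-, -, h3, -⟩ := hz b z h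
      rw [← h3]; exact (hlev j _ (hA b z.1)).2.2
    · obtain ⟨-, -, -, h4⟩ := hz b z h
      rw [← h4]; exact (hlev j _ (hC b z.2)).2.2
  · have hm0 : (0 : ℝ) < m := by exact_mod_cast hm
    -- A bin of scale `j` has `m * q b < 2 * 2 ^ j`, so its weight is replaced by a constant.
    have hfib : ∑ x ∈ D with label x = (j, i, i'), q x.1 * cellHell (p x.1) x.2 ≤
        ∑ b, ∑ z ∈ Finset.univ.filter (fun z => b ∈ Hv ∧ label (b, z) = (j, i, i')),
          2 * 2 ^ j / m * cellHell (p b) z := by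
      rw [Finset.sum_sigma']
      refine le_trans (Finset.sum_le_sum fun x hx => ?_) (le_of_eq (Finset.sum_nbij'
        (fun x => ⟨x.1, x.2⟩) (fun y => (y.1, y.2)) ?_ ?_ ?_ ?_
        (g := fun y : (_ : B) × (A × C) => 2 * 2 ^ j / m * cellHell (p y.1) y.2)
        (f := fun x : B × (A × C) => 2 * 2 ^ j / m * cellHell (p x.1) x.2) ?_))
      · obtain ⟨h1, h2⟩ := Finset.mem_filter.1 hx
        have hb := (Finset.mem_filter.1 (Finset.mem_product.1 h1).1).2
        have h3 := (hsc x.1 hb).2.1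
        simp only [label, Prod.mk.injEq] at h2
        rw [h2.1] at h3
        refine mul_le_mul_of_nonneg_right ?_ (cellHell_nonneg _ _)
        rw [le_div_iff₀ hm0]
        rw [pow_succ] at h3
        linarith
      · intro x hx
        obtain ⟨h1, h2⟩ := Finset.mem_filter.1 hx
        simp [h2, (Finset.mem_product.1 h1).1]
      · intro y hy
        simp only [Finset.mem_sigma, Finset.mem_filter, Finset.mem_univ, true_and] at hy
        simp [hD, hy.1, hy.2]
      · intro x _; rfl
      · intro y _; rfl
      · intro x _; rfl
    have h5 := ht.trans hfib
    simp only [← Finset.mul_sum] at h5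
    have h2j : (0 : ℝ) < 2 ^ j := by positivity
    calc m * ε / (2 * 2 ^ j * ((L : ℝ) + 1) ^ 3) = (m / (2 * 2 ^ j)) * (ε / ((L : ℝ) + 1) ^ 3) := by
          field_simp
      _ ≤ (m / (2 * 2 ^ j)) * (2 * 2 ^ j / m *
          ∑ b, ∑ z ∈ Finset.univ.filter (fun z => b ∈ Hv ∧ label (b, z) = (j, i, i')),
            cellHell (p b) z) := mul_le_mul_of_nonneg_left h5 (by positivity)
      _ = _ := by field_simp

/-- Number of selected cells. -/
lemma IsScaleCells.card_le {q : B → ℝ} (hq : q ∈ stdSimplex ℝ B) {p : B → A × C → ℝ}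
    (hp : ∀ b, p b ∈ stdSimplex ℝ (A × C)) {m j i i' : ℕ} {cells : B → Finset (A × C)}
    (h : IsScaleCells q p m j i i' cells) {M JA JC : ℝ}
    (hM : min (Fintype.card B : ℝ) (m / 2 ^ j) ≤ M)
    (hJA : JA = Fintype.card A ∨ i ≠ j ∧ JA = 160 * 2 ^ i)
    (hJC : JC = Fintype.card C ∨ i' ≠ j ∧ JC = 160 * 2 ^ i') :
    ∑ b, ((cells b).card : ℝ) ≤ M * JA * JC := by
  classical
  set s := Finset.univ.filter fun b => (2 : ℝ) ^ j ≤ m * q b with hs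
  have hsM : (s.card : ℝ) ≤ M := by
    refine le_trans (le_min ?_ ?_) hM
    · exact_mod_cast Finset.card_le_univ s
    · rw [le_div_iff₀ (by positivity)]
      exact card_filter_mul_le hq (Nat.cast_nonneg m)
  have hJA0 : 0 ≤ JA := by rcases hJA with h | ⟨-, h⟩ <;> rw [h] <;> positivity
  have hJC0 : 0 ≤ JC := by rcases hJC with h | ⟨-, h⟩ <;> rw [h] <;> positivity
  have hcell : ∀ b, ((cells b).card : ℝ) ≤ JA * JC := fun b => by
    -- A level below the cutoff forces every row to have mass at least `1 / (160 * 2 ^ i)`, hence at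
    -- most `160 * 2 ^ i` rows occur. The columns are treated alike.
    have hrow : (((cells b).image Prod.fst).card : ℝ) ≤ JA := by
      rcases hJA with h' | ⟨hne, h'⟩
      · rw [h']; exact_mod_cast Finset.card_le_univ _
      · have h1 := card_filter_mul_le (margFst_mem (hp b)) (s := 2 ^ (i + 1)) (t := 1 / 80)
          (by positivity)
        have h2 : (cells b).image Prod.fst ⊆
            Finset.univ.filter fun a => 1 / 80 ≤ (2 : ℝ) ^ (i + 1) * margFst (p b) a := by
          intro a ha
          obtain ⟨z, hz, rfl⟩ := Finset.mem_image.1 ha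
          exact Finset.mem_filter.2 ⟨Finset.mem_univ _, (h.le_fst b z hz).resolve_left hne⟩
        have h3 : (((cells b).image Prod.fst).card : ℝ) ≤ _ :=
          Nat.cast_le.2 (Finset.card_le_card h2)
        rw [h']
        rw [pow_succ] at h1
        rw [pow_succ] at h3
        linarith
    have hcol : (((cells b).image Prod.snd).card : ℝ) ≤ JC := by
      rcases hJC with h' | ⟨hne, h'⟩
      · rw [h']; exact_mod_cast Finset.card_le_univ _
      · have h1 := card_filter_mul_le (margSnd_mem (hp b)) (s := 2 ^ (i' + 1)) (t := 1 / 80)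
          (by positivity)
        have h2 : (cells b).image Prod.snd ⊆
            Finset.univ.filter fun a => 1 / 80 ≤ (2 : ℝ) ^ (i' + 1) * margSnd (p b) a := by
          intro a ha
          obtain ⟨z, hz, rfl⟩ := Finset.mem_image.1 ha
          exact Finset.mem_filter.2 ⟨Finset.mem_univ _, (h.le_snd b z hz).resolve_left hne⟩
        have h3 : (((cells b).image Prod.snd).card : ℝ) ≤ _ :=
          Nat.cast_le.2 (Finset.card_le_card h2)
        rw [h']
        rw [pow_succ] at h1
        rw [pow_succ] at h3
        linarith
    have hsub : cells b ⊆ (cells b).image Prod.fst ×ˢ (cells b).image Prod.snd := fun z hz =>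
      Finset.mem_product.2 ⟨Finset.mem_image_of_mem _ hz, Finset.mem_image_of_mem _ hz⟩
    calc ((cells b).card : ℝ) ≤
        (((cells b).image Prod.fst ×ˢ (cells b).image Prod.snd).card : ℝ) :=
          Nat.cast_le.2 (Finset.card_le_card hsub)
      _ = ((cells b).image Prod.fst).card * ((cells b).image Prod.snd).card := by
          rw [Finset.card_product]; push_cast; rfl
      _ ≤ JA * JC := mul_le_mul hrow hcol (Nat.cast_nonneg _) hJA0
  calc ∑ b, ((cells b).card : ℝ) = ∑ b ∈ s, ((cells b).card : ℝ) := by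
        refine (Finset.sum_subset (Finset.subset_univ s) fun b _ hb => ?_).symm
        have : cells b = ∅ := Finset.eq_empty_of_forall_notMem fun z hz =>
          hb (Finset.mem_filter.2 ⟨Finset.mem_univ _, h.bin b z hz⟩)
        simp [this]
    _ ≤ ∑ _b ∈ s, JA * JC := Finset.sum_le_sum fun b _ => hcell b
    _ = s.card * (JA * JC) := by simp
    _ ≤ M * (JA * JC) := mul_le_mul_of_nonneg_right hsM (mul_nonneg hJA0 hJC0)
    _ = _ := by ring

/-- Comparison of the Hellinger and the quadratic measure of dependence when all marginals of the
selected cells are of known size. -/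
lemma IsScaleCells.sum_cellHell_le {q : B → ℝ} {p : B → A × C → ℝ}
    (hp : ∀ b, p b ∈ stdSimplex ℝ (A × C)) {m j i i' : ℕ} {cells : B → Finset (A × C)}
    (h : IsScaleCells q p m j i i' cells) (hi : i ≠ j) (hi' : i' ≠ j) :
    ∑ b, ∑ z ∈ cells b, cellHell (p b) z ≤
      25600 * 2 ^ i * 2 ^ i' * ∑ b, ∑ z ∈ cells b, depend (p b) z ^ 2 := by
  simp only [Finset.mul_sum]
  refine Finset.sum_le_sum fun b _ => Finset.sum_le_sum fun z hz => ?_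
  have h1 := (h.le_fst b z hz).resolve_left hi
  have h2 := (h.le_snd b z hz).resolve_left hi'
  have h3 := mul_cellHell_le (hp b) z
  have h4 : (1 / 80 : ℝ) * (1 / 80) ≤
      (2 ^ (i + 1) * margFst (p b) z.1) * (2 ^ (i' + 1) * margSnd (p b) z.2) :=
    mul_le_mul h1 h2 (by norm_num) (by linarith)
  have h5 := mul_le_mul_of_nonneg_right h4 (cellHell_nonneg (p b) z)
  have hK : (0 : ℝ) ≤ 25600 * 2 ^ i * 2 ^ i' := by positivity
  have h6 := mul_le_mul_of_nonneg_left h3 hK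
  rw [pow_succ, pow_succ] at h5
  linarith

end Heavy

/-! ### Signal against noise at one scale -/

lemma mul_sqrt_flatNorm_le {K : ℕ} (hK : 1 ≤ K) (d : ℕ) :
    (K : ℝ) * Real.sqrt (flatNorm d K) ≤ Real.sqrt (min (K : ℝ) d) := by
  have hK0 : (0 : ℝ) < K := by exact_mod_cast hK
  refine Real.le_sqrt_of_sq_le ?_
  rw [mul_pow, Real.sq_sqrt (flatNorm_nonneg d K), flatNorm, mul_min_of_nonneg _ _ (sq_nonneg _)]
  refine le_of_eq ?_
  congr 1 <;> field_simp

lemma mul_sqrt_flatNorm_le_sqrt {K : ℕ} (hK : 1 ≤ K) (d : ℕ) :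
    (K : ℝ) * Real.sqrt (flatNorm d K) ≤ Real.sqrt d :=
  (mul_sqrt_flatNorm_le hK d).trans (Real.sqrt_le_sqrt (min_le_right _ _))

/-- Flattening both sides as strongly as there are pairs brings the noise down to a constant,
whatever the alphabets. -/
lemma mul_sqrt_flatNorm_mul_le_one {K : ℕ} (hK : 1 ≤ K) (d d' : ℕ) :
    (K : ℝ) * (Real.sqrt (flatNorm d K) * Real.sqrt (flatNorm d' K)) ≤ 1 := by
  have hK0 : (0 : ℝ) < K := by exact_mod_cast hK
  have h : ∀ d, Real.sqrt (flatNorm d K) ≤ Real.sqrt (1 / K) := fun d =>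
    Real.sqrt_le_sqrt (min_le_left _ _)
  calc (K : ℝ) * (Real.sqrt (flatNorm d K) * Real.sqrt (flatNorm d' K))
      ≤ K * (Real.sqrt (1 / K) * Real.sqrt (1 / K)) := by
        refine mul_le_mul_of_nonneg_left ?_ hK0.le
        exact mul_le_mul (h d) (h d') (Real.sqrt_nonneg _) (Real.sqrt_nonneg _)
    _ = 1 := by rw [Real.mul_self_sqrt (by positivity)]; field_simp

/-- The noise level of the statistic at a scale. -/
def noise (k KA KC dA dC : ℕ) : ℝ :=
  max 1 (k * (Real.sqrt (flatNorm dA KA) * Real.sqrt (flatNorm dC KC)))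

lemma one_le_noise (k KA KC dA dC : ℕ) : 1 ≤ noise k KA KC dA dC := le_max_left _ _

/-- The signal of the selected cells dominates the noise. Here `S₁` and `S₂` stand for the Hellinger
and the quadratic measure of dependence. -/
lemma noise_mul_le_of_signal {k KA KC dA dC : ℕ} {b M W X S₁ S₂ : ℝ} (hk : 1 ≤ k)
    (hKA : 1 ≤ KA) (hKC : 1 ≤ KC) (hdC : 1 ≤ dC) (hCA : dC ≤ dA) (hM : 0 < M) (hMb : M ≤ b)
    (hb : 1 ≤ b) (hW : 1 ≤ W) (hX : 0 < X) (hS₁ : X / (2 * k * W) ≤ S₁) (hS₂ : 0 ≤ S₂)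
    (hfull : S₁ ^ 2 ≤ M * dA * dC * S₂)
    (hcase : (KA = k ∧ KC = k) ∨ S₁ ≤ 25600 * KA * KC * S₂ ∨
      (KA = k ∧ S₁ ^ 2 ≤ M * dA * (160 * KC) * S₂) ∨ (KC = k ∧ S₁ ^ 2 ≤ M * (160 * KA) * dC * S₂))
    (hsym : 10 ^ 23 * W ^ 4 * (b * Real.sqrt b) * (dA * dC) ≤ X ^ 2)
    (hasym : 1280000000 * W ^ 3 * (M * Real.sqrt M) * (dA * Real.sqrt dC) *
      Real.sqrt (min (k : ℝ) dA) ≤ X ^ 2) :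
    2 * 10 ^ 6 * W * Real.sqrt M * noise k KA KC dA dC ≤ (k : ℝ) ^ 2 * S₂ := by
  have hk0 : (0 : ℝ) < k := by exact_mod_cast hk
  have hKA0 : (0 : ℝ) < KA := by exact_mod_cast hKA
  have hKC0 : (0 : ℝ) < KC := by exact_mod_cast hKC
  have hc0 : (1 : ℝ) ≤ dC := by exact_mod_cast hdC
  have hca : (dC : ℝ) ≤ dA := by exact_mod_cast hCA
  have ha0 : (1 : ℝ) ≤ dA := hc0.trans hca
  have hW0 : 0 < W := by linarith
  have hsM : 0 < Real.sqrt M := Real.sqrt_pos.2 hM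
  have hsMb : Real.sqrt M ≤ Real.sqrt b := Real.sqrt_le_sqrt hMb
  set V := (k : ℝ) ^ 2 * S₂ with hV
  have hV0 : 0 ≤ V := by positivity
  have hXS : X ≤ 2 * k * W * S₁ := by
    rw [div_le_iff₀ (by positivity)] at hS₁; linarith
  have hX2 : X ^ 2 ≤ 4 * W ^ 2 * ((k : ℝ) ^ 2 * S₁ ^ 2) := by
    calc X ^ 2 ≤ (2 * k * W * S₁) ^ 2 := pow_le_pow_left₀ hX.le hXS 2
      _ = _ := by ring
  have hjb : ∀ {J : ℝ}, S₁ ^ 2 ≤ J * S₂ → X ^ 2 ≤ 4 * W ^ 2 * (J * V) := fun {J} h => by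
    calc X ^ 2 ≤ 4 * W ^ 2 * ((k : ℝ) ^ 2 * S₁ ^ 2) := hX2
      _ ≤ 4 * W ^ 2 * ((k : ℝ) ^ 2 * (J * S₂)) := by gcongr
      _ = _ := by rw [hV]; ring
  have hMM : M * Real.sqrt M ≤ b * Real.sqrt b := mul_le_mul hMb hsMb hsM.le (by linarith)
  -- The part of the noise equal to `1`: Cauchy-Schwarz over all `M * dA * dC` cells and the
  -- balanced condition suffice.
  have hone : 2 * 10 ^ 6 * W * Real.sqrt M ≤ V := by
    have h1 := hjb hfull
    have h2 : 10 ^ 23 * W ^ 4 * (M * Real.sqrt M) * (dA * dC) ≤ X ^ 2 := by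
      refine le_trans ?_ hsym; gcongr
    have h3 : 4 * W ^ 2 * (M * dA * dC) * (2 * 10 ^ 6 * W * Real.sqrt M) ≤
        4 * W ^ 2 * (M * dA * dC) * V := by
      calc 4 * W ^ 2 * (M * dA * dC) * (2 * 10 ^ 6 * W * Real.sqrt M)
          = 8 * 10 ^ 6 * W ^ 3 * (M * Real.sqrt M) * (dA * dC) := by ring
        _ ≤ 10 ^ 23 * W ^ 4 * (M * Real.sqrt M) * (dA * dC) := by
          have : W ^ 3 ≤ W ^ 4 := pow_le_pow_right₀ hW (by norm_num)
          have : 8 * 10 ^ 6 * W ^ 3 ≤ 10 ^ 23 * W ^ 4 := by nlinarith [pow_pos hW0 3]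
          gcongr
        _ ≤ X ^ 2 := h2
        _ ≤ _ := by linarith
    exact le_of_mul_le_mul_left h3 (by positivity)
  rw [noise, mul_max_of_nonneg _ _ (by positivity)]
  refine max_le (by linarith) ?_
  set sA := Real.sqrt (flatNorm dA KA) with hsA
  set sC := Real.sqrt (flatNorm dC KC) with hsC
  have hsA0 : 0 ≤ sA := Real.sqrt_nonneg _
  have hsC0 : 0 ≤ sC := Real.sqrt_nonneg _
  rcases hcase with ⟨h1, h2⟩ | h | ⟨h1, h⟩ | ⟨h1, h⟩
  -- Both levels at the cutoff: the noise is at most `1`, and `hone` applies.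
  · have h3 : (k : ℝ) * (sA * sC) ≤ 1 := by
      rw [hsA, hsC, h1, h2]; exact mul_sqrt_flatNorm_mul_le_one hk dA dC
    calc _ ≤ 2 * 10 ^ 6 * W * Real.sqrt M * 1 := mul_le_mul_of_nonneg_left h3 (by positivity)
      _ ≤ V := by linarith
  -- Both levels below the cutoff: the comparison of the measures is linear. The factors `KA * KC`
  -- cancel against flattening, leaving the square root of the balanced condition.
  · have h1 : (KA : ℝ) * sA ≤ Real.sqrt dA := mul_sqrt_flatNorm_le_sqrt hKA dA
    have h2 : (KC : ℝ) * sC ≤ Real.sqrt dC := mul_sqrt_flatNorm_le_sqrt hKC dC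
    have h3 : k * X ≤ 51200 * W * (KA * KC) * V := by
      calc k * X ≤ k * (2 * k * W * S₁) := by gcongr
        _ ≤ k * (2 * k * W * (25600 * KA * KC * S₂)) := by gcongr
        _ = _ := by rw [hV]; ring
    have h4 : 2 * 10 ^ 11 * W ^ 2 * Real.sqrt M * (Real.sqrt dA * Real.sqrt dC) ≤ X := by
      refine abs_le_of_sq_le_sq' ?_ hX.le |>.2
      refine le_trans ?_ hsym
      have hb1 : M ≤ b * Real.sqrt b := by
        have : 1 ≤ Real.sqrt b := Real.one_le_sqrt.2 hb
        nlinarith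
      calc (2 * 10 ^ 11 * W ^ 2 * Real.sqrt M * (Real.sqrt dA * Real.sqrt dC)) ^ 2
          = 4 * 10 ^ 22 * W ^ 4 * Real.sqrt M ^ 2 * (Real.sqrt dA ^ 2 * Real.sqrt dC ^ 2) := by ring
        _ = 4 * 10 ^ 22 * W ^ 4 * M * (dA * dC) := by
          rw [Real.sq_sqrt hM.le, Real.sq_sqrt (by linarith), Real.sq_sqrt (by linarith)]
        _ ≤ 10 ^ 23 * W ^ 4 * (b * Real.sqrt b) * (dA * dC) := by
          have : (4 * 10 ^ 22 : ℝ) ≤ 10 ^ 23 := by norm_num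
          gcongr
    have h5 : (KA * KC : ℝ) * (2 * 10 ^ 6 * W * Real.sqrt M * (k * (sA * sC))) ≤
        (KA * KC) * V := by
      have h6 : (KA * KC : ℝ) * (2 * 10 ^ 6 * W * Real.sqrt M * (k * (sA * sC))) ≤
          2 * 10 ^ 6 * W * Real.sqrt M * k * (Real.sqrt dA * Real.sqrt dC) := by
        calc (KA * KC : ℝ) * (2 * 10 ^ 6 * W * Real.sqrt M * (k * (sA * sC)))
            = 2 * 10 ^ 6 * W * Real.sqrt M * k * ((KA * sA) * (KC * sC)) := by ring
          _ ≤ _ := by gcongr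
      have h7 : 51200 * W * (2 * 10 ^ 6 * W * Real.sqrt M * k * (Real.sqrt dA * Real.sqrt dC)) ≤
          51200 * W * ((KA * KC) * V) := by
        calc 51200 * W * (2 * 10 ^ 6 * W * Real.sqrt M * k * (Real.sqrt dA * Real.sqrt dC))
            = k * (1024 * 10 ^ 8 * W ^ 2 * Real.sqrt M * (Real.sqrt dA * Real.sqrt dC)) := by ring
          _ ≤ k * X := by
            refine mul_le_mul_of_nonneg_left (le_trans ?_ h4) hk0.le
            have : (1024 * 10 ^ 8 : ℝ) ≤ 2 * 10 ^ 11 := by norm_num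
            gcongr
          _ ≤ _ := by linarith
      exact h6.trans (le_of_mul_le_mul_left h7 (by positivity))
    exact le_of_mul_le_mul_left h5 (by positivity)
  -- Only the column level is below the cutoff: few columns but possibly all rows occur, and the
  -- asymmetric condition is needed.
  · have h2 : (k : ℝ) * sA ≤ Real.sqrt (min (k : ℝ) dA) := by
      rw [hsA, h1]; exact mul_sqrt_flatNorm_le hk dA
    have h3 : (KC : ℝ) * sC ≤ Real.sqrt dC := mul_sqrt_flatNorm_le_sqrt hKC dC
    have h4 := hjb h
    have h5 : 640 * W ^ 2 * M * dA * (KC * (2 * 10 ^ 6 * W * Real.sqrt M * (k * (sA * sC)))) ≤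
        640 * W ^ 2 * M * dA * (KC * V) := by
      calc 640 * W ^ 2 * M * dA * (KC * (2 * 10 ^ 6 * W * Real.sqrt M * (k * (sA * sC))))
          = 1280000000 * W ^ 3 * (M * Real.sqrt M) * dA * ((KC * sC) * (k * sA)) := by ring
        _ ≤ 1280000000 * W ^ 3 * (M * Real.sqrt M) * dA *
            (Real.sqrt dC * Real.sqrt (min (k : ℝ) dA)) := by gcongr
        _ = 1280000000 * W ^ 3 * (M * Real.sqrt M) * (dA * Real.sqrt dC) *
            Real.sqrt (min (k : ℝ) dA) := by ring
        _ ≤ X ^ 2 := hasym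
        _ ≤ _ := by linarith
    exact le_of_mul_le_mul_left (le_of_mul_le_mul_left h5 (by positivity)) hKC0
  · have h2 : (k : ℝ) * sC ≤ Real.sqrt (min (k : ℝ) dA) := by
      rw [hsC, h1]
      exact (mul_sqrt_flatNorm_le hk dC).trans (Real.sqrt_le_sqrt (min_le_min_left _ hca))
    have h3 : (KA : ℝ) * sA ≤ Real.sqrt dA := mul_sqrt_flatNorm_le_sqrt hKA dA
    have h4 := hjb h
    -- The mirrored case is no harder than the previous one because `dC ≤ dA`.
    have h6 : dC * Real.sqrt dA ≤ dA * Real.sqrt dC := by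
      have e1 : (dC : ℝ) = Real.sqrt dC * Real.sqrt dC := (Real.mul_self_sqrt (by linarith)).symm
      have e2 : (dA : ℝ) = Real.sqrt dA * Real.sqrt dA := (Real.mul_self_sqrt (by linarith)).symm
      have e3 : Real.sqrt dC ≤ Real.sqrt dA := Real.sqrt_le_sqrt hca
      calc dC * Real.sqrt dA = Real.sqrt dC * (Real.sqrt dC * Real.sqrt dA) := by
            rw [← mul_assoc, ← e1]
        _ ≤ Real.sqrt dC * (Real.sqrt dA * Real.sqrt dA) := by gcongr
        _ = _ := by rw [← e2, mul_comm]
    have h5 : 640 * W ^ 2 * M * dC * (KA * (2 * 10 ^ 6 * W * Real.sqrt M * (k * (sA * sC)))) ≤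
        640 * W ^ 2 * M * dC * (KA * V) := by
      calc 640 * W ^ 2 * M * dC * (KA * (2 * 10 ^ 6 * W * Real.sqrt M * (k * (sA * sC))))
          = 1280000000 * W ^ 3 * (M * Real.sqrt M) * dC * ((KA * sA) * (k * sC)) := by ring
        _ ≤ 1280000000 * W ^ 3 * (M * Real.sqrt M) * dC *
            (Real.sqrt dA * Real.sqrt (min (k : ℝ) dA)) := by gcongr
        _ = 1280000000 * W ^ 3 * (M * Real.sqrt M) * (dC * Real.sqrt dA) *
            Real.sqrt (min (k : ℝ) dA) := by ring
        _ ≤ 1280000000 * W ^ 3 * (M * Real.sqrt M) * (dA * Real.sqrt dC) *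
            Real.sqrt (min (k : ℝ) dA) := by gcongr
        _ ≤ X ^ 2 := hasym
        _ ≤ _ := by linarith
    exact le_of_mul_le_mul_left (le_of_mul_le_mul_left h5 (by positivity)) hKA0

/-! ### Probability of being used, and the signal of light bins -/

/-- A bin that is hit many times on average per block is used with high probability. -/
lemma le_hitProb {R n : ℕ} {x ℓ : ℝ} (hx0 : 0 ≤ x) (hx1 : x ≤ 1) (hn : ℓ ≤ n * x)
    (hR : 20 * R ≤ Real.exp ℓ) : 19 / 20 ≤ hitProb R n x := by
  have h1 : (1 - x) ^ n ≤ Real.exp (-ℓ) := by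
    calc (1 - x) ^ n ≤ Real.exp (-x) ^ n :=
          pow_le_pow_left₀ (by linarith) (by linarith [Real.add_one_le_exp (-x)]) n
      _ = Real.exp (n * -x) := (Real.exp_nat_mul _ _).symm
      _ ≤ _ := Real.exp_le_exp.2 (by linarith)
  have h2 : 1 + (R : ℝ) * (-(1 - x) ^ n) ≤ (1 + -(1 - x) ^ n) ^ R :=
    one_add_mul_le_pow (by linarith [pow_le_one₀ (n := n) (sub_nonneg.2 hx1) (by linarith)]) R
  have h3 : (R : ℝ) * (1 - x) ^ n ≤ 1 / 20 := by
    calc (R : ℝ) * (1 - x) ^ n ≤ R * Real.exp (-ℓ) := by gcongr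
      _ = R / Real.exp ℓ := by rw [Real.exp_neg]; rfl
      _ ≤ 1 / 20 := by rw [div_le_iff₀ (Real.exp_pos _)]; linarith
  rw [hitProb, sub_eq_add_neg]
  linarith

/-- By Bernoulli, `(1 - x) ^ m ≤ 1 / (1 + m * x)`, which is at most `1 - m * x / 2` while `m * x ≤
1`. All four blocks have to hit. -/
lemma le_hitProb_four {n m : ℕ} {x : ℝ} (hx0 : 0 ≤ x) (hx1 : x ≤ 1) (hmn : m ≤ n)
    (hmx : m * x ≤ 1) : (m * x / 2) ^ 4 ≤ hitProb 4 n x := by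
  have h0 : 0 ≤ m * x := by positivity
  have h1 : (1 - x) ^ n ≤ (1 - x) ^ m :=
    pow_le_pow_of_le_one (by linarith) (by linarith) hmn
  have h2 : (1 + m * x) * (1 - x) ^ m ≤ 1 := by
    have hb : 1 + (m : ℝ) * x ≤ (1 + x) ^ m := one_add_mul_le_pow (by linarith) m
    have hm : (1 + x) ^ m * (1 - x) ^ m ≤ 1 := by
      rw [← mul_pow]; exact pow_le_one₀ (by nlinarith) (by nlinarith)
    exact (mul_le_mul_of_nonneg_right hb (pow_nonneg (by linarith) m)).trans hm
  have h3 : 0 ≤ (1 - x) ^ m := pow_nonneg (by linarith) m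
  have h4 : (1 - x) ^ m ≤ 1 - m * x / 2 := by
    by_contra hcon
    push Not at hcon
    nlinarith
  exact pow_le_pow_left₀ (by positivity) (by linarith) 4

lemma pow_four_sum_le {ι : Type} (s : Finset ι) (x : ι → ℝ) :
    (∑ i ∈ s, x i) ^ 4 ≤ (s.card : ℝ) ^ 3 * ∑ i ∈ s, x i ^ 4 := by
  have h1 : (∑ i ∈ s, x i) ^ 2 ≤ s.card * ∑ i ∈ s, x i ^ 2 := sq_sum_le_card_mul_sum_sq
  have h2 : (∑ i ∈ s, x i ^ 2) ^ 2 ≤ s.card * ∑ i ∈ s, (x i ^ 2) ^ 2 := sq_sum_le_card_mul_sum_sq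
  calc (∑ i ∈ s, x i) ^ 4 = ((∑ i ∈ s, x i) ^ 2) ^ 2 := by ring
    _ ≤ (s.card * ∑ i ∈ s, x i ^ 2) ^ 2 := pow_le_pow_left₀ (sq_nonneg _) h1 2
    _ = (s.card : ℝ) ^ 2 * (∑ i ∈ s, x i ^ 2) ^ 2 := by ring
    _ ≤ (s.card : ℝ) ^ 2 * (s.card * ∑ i ∈ s, (x i ^ 2) ^ 2) := by gcongr
    _ = _ := by simp only [← pow_mul]; ring

section LightCells

variable {A B C : Type} [Fintype A] [Fintype B] [Fintype C] [Nonempty A] [Nonempty B] [Nonempty C]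

/-- The expected signal of bins with few samples. -/
lemma le_light_signal {q : B → ℝ} (hq : q ∈ stdSimplex ℝ B) {p : B → A × C → ℝ}
    (hp : ∀ b, p b ∈ stdSimplex ℝ (A × C)) {m n : ℕ} (hmn : m ≤ n) {ε : ℝ} (hε : 0 < ε)
    (hfar : ε ≤ ∑ b with ¬ 1 ≤ (m : ℝ) * q b, q b * ∑ z, cellHell (p b) z) :
    (m * ε) ^ 4 / (64 * ((Fintype.card B : ℝ) ^ 3 * (Fintype.card A * Fintype.card C))) ≤
      ∑ b, (∑ z, depend (p b) z ^ 2) * hitProb 4 n (q b) := by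
  classical
  have hq1 : ∀ b, q b ≤ 1 := fun b => by
    rw [← hq.2]; exact Finset.single_le_sum (fun y _ => hq.1 y) (Finset.mem_univ b)
  have ha : (0 : ℝ) < Fintype.card A := by exact_mod_cast Fintype.card_pos
  have hb : (0 : ℝ) < Fintype.card B := by exact_mod_cast Fintype.card_pos
  have hc : (0 : ℝ) < Fintype.card C := by exact_mod_cast Fintype.card_pos
  set s := Finset.univ.filter fun b => ¬ 1 ≤ (m : ℝ) * q b with hs
  set h : B → ℝ := fun b => ∑ z, cellHell (p b) z with hh
  have hh0 : ∀ b, 0 ≤ h b := fun b => Finset.sum_nonneg fun z _ => cellHell_nonneg _ _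
  have hcs : ∀ b, h b ^ 2 / (Fintype.card A * Fintype.card C) ≤ ∑ z, depend (p b) z ^ 2 :=
    fun b => by
      have := sq_sum_cellHell_le (I := Unit) (p := fun _ => p b) (fun _ => hp b)
        (fun _ => Finset.univ) (J := Fintype.card A * Fintype.card C) (by simp)
      rw [div_le_iff₀ (by positivity), mul_comm]
      simpa using this
  -- Since `h b ≤ 2`, two powers of `h b` can be added at a factor `4`. The fourth power then
  -- matches the hit probability; with its `2 ^ 4` this makes `64`.
  have hterm : ∀ b ∈ s, (m * (q b * h b)) ^ 4 / (64 * (Fintype.card A * Fintype.card C)) ≤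
      (∑ z, depend (p b) z ^ 2) * hitProb 4 n (q b) := fun b hbs => by
    have h1 := le_hitProb_four (hq.1 b) (hq1 b) hmn (not_le.1 (Finset.mem_filter.1 hbs).2).le
    have h2 := hcs b
    have h3 : h b ≤ 2 := sum_cellHell_le (hp b)
    have h4 : h b ^ 4 ≤ 4 * h b ^ 2 := by
      have : h b ^ 2 ≤ 4 := by nlinarith [hh0 b]
      nlinarith [sq_nonneg (h b)]
    calc (m * (q b * h b)) ^ 4 / (64 * (Fintype.card A * Fintype.card C))
        = (m * q b) ^ 4 * h b ^ 4 / (64 * (Fintype.card A * Fintype.card C)) := by ring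
      _ ≤ (m * q b) ^ 4 * (4 * h b ^ 2) / (64 * (Fintype.card A * Fintype.card C)) := by gcongr
      _ = h b ^ 2 / (Fintype.card A * Fintype.card C) * (m * q b / 2) ^ 4 := by
        field_simp; ring
      _ ≤ _ := mul_le_mul h2 h1 (by positivity) (Finset.sum_nonneg fun z _ => sq_nonneg _)
  have hnn : ∀ b, 0 ≤ (∑ z, depend (p b) z ^ 2) * hitProb 4 n (q b) := fun b =>
    mul_nonneg (Finset.sum_nonneg fun z _ => sq_nonneg _)
      (pow_nonneg (sub_nonneg.2 (pow_le_one₀ (by linarith [hq1 b]) (by linarith [hq.1 b]))) 4)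
  have hsum : m * ε ≤ ∑ b ∈ s, m * (q b * h b) := by
    rw [← Finset.mul_sum]; gcongr
  have hcard : (s.card : ℝ) ≤ Fintype.card B := by exact_mod_cast Finset.card_le_univ s
  have h5 : (m * ε) ^ 4 ≤ (Fintype.card B : ℝ) ^ 3 * ∑ b ∈ s, (m * (q b * h b)) ^ 4 := by
    calc (m * ε) ^ 4 ≤ (∑ b ∈ s, m * (q b * h b)) ^ 4 :=
          pow_le_pow_left₀ (by positivity) hsum 4
      _ ≤ (s.card : ℝ) ^ 3 * ∑ b ∈ s, (m * (q b * h b)) ^ 4 := pow_four_sum_le _ _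
      _ ≤ _ := by
        refine mul_le_mul_of_nonneg_right (pow_le_pow_left₀ (Nat.cast_nonneg _) hcard 3) ?_
        exact Finset.sum_nonneg fun b _ => by positivity
  calc (m * ε) ^ 4 / (64 * ((Fintype.card B : ℝ) ^ 3 * (Fintype.card A * Fintype.card C)))
      ≤ (Fintype.card B : ℝ) ^ 3 * (∑ b ∈ s, (m * (q b * h b)) ^ 4) /
        (64 * ((Fintype.card B : ℝ) ^ 3 * (Fintype.card A * Fintype.card C))) := by gcongr
    _ = ∑ b ∈ s, (m * (q b * h b)) ^ 4 / (64 * (Fintype.card A * Fintype.card C)) := by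
      rw [← Finset.sum_div]; field_simp
    _ ≤ ∑ b ∈ s, (∑ z, depend (p b) z ^ 2) * hitProb 4 n (q b) := Finset.sum_le_sum hterm
    _ ≤ _ := Finset.sum_le_sum_of_subset_of_nonneg (Finset.subset_univ _) fun b _ _ => hnn b

end LightCells

/-! ### The Hellinger tester under numerical conditions on the base number of samples -/

/-- Length of the blocks at the scale `k`. -/
def blockLength (m ℓ k : ℕ) : ℕ := ℓ * m / k + 1

lemma le_blockLength {m ℓ k : ℕ} (hk : 1 ≤ k) : (ℓ * m / k : ℝ) ≤ blockLength m ℓ k := by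
  have hk0 : (0 : ℝ) < k := by exact_mod_cast hk
  rw [div_le_iff₀ hk0]
  have h : ℓ * m ≤ (ℓ * m / k + 1) * k := by
    have h1 := Nat.div_add_mod (ℓ * m) k
    have h2 := Nat.mod_lt (ℓ * m) hk
    nlinarith
  unfold blockLength
  exact_mod_cast h

/-- The added one costs only `k`, which is at most `ℓ * m`. -/
lemma blockLength_le {m ℓ k : ℕ} (hkm : k ≤ m) (hℓ : 1 ≤ ℓ) :
    (blockLength m ℓ k : ℝ) * k ≤ 2 * (ℓ * m) := by
  have h : (ℓ * m / k + 1) * k ≤ 2 * (ℓ * m) := by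
    have h1 := Nat.div_mul_le_self (ℓ * m) k
    nlinarith
  unfold blockLength
  exact_mod_cast h

set_option maxHeartbeats 1000000 in
/-- Upper bound for the sample complexity in terms of numerical conditions on the base number `m` of
samples. -/
theorem scHellinger_le {dA dB dC m ℓ : ℕ} {ε W : ℝ} (hB : 1 ≤ dB) (hC : 1 ≤ dC) (hCA : dC ≤ dA)
    (hε : 0 < ε) (hm : 1 ≤ m) (hℓ : 1 ≤ ℓ) (hW : W = ((Nat.log 2 m : ℝ) + 1) ^ 3)
    (hexp : 160 * (m : ℝ) ≤ Real.exp ℓ)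
    (hsym : 10 ^ 23 * W ^ 4 * (dB * Real.sqrt dB) * (dA * dC) ≤ (m * ε) ^ 2)
    (hasym : 1280000000 * W ^ 3 * (dB * Real.sqrt dB) * (dA * Real.sqrt dC) * Real.sqrt dA ≤
        (m * ε) ^ 2 ∨
      1280000000 * W ^ 3 * (dB * Real.sqrt (2 * (ℓ * m))) * (dA * Real.sqrt dC) ≤ (m * ε) ^ 2)
    (hlight : 128000000 * W * ((dB : ℝ) ^ 3 * (dA * dC)) *
      Real.sqrt (min (dB : ℝ) (2 * (ℓ * m))) ≤ (m * ε) ^ 4) :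
    scHellinger ε dA dB dC ≤ ((16 * (ℓ * m) : ℕ) : ℕ∞) := by
  classical
  set L := Nat.log 2 m with hL
  have hA : 1 ≤ dA := hC.trans hCA
  have : NeZero dA := ⟨by omega⟩
  have : NeZero dB := ⟨by omega⟩
  have : NeZero dC := ⟨by omega⟩
  have hW1 : 1 ≤ W := by
    rw [hW]; exact one_le_pow₀ (by linarith [(Nat.cast_nonneg L : (0 : ℝ) ≤ L)])
  have hm0 : (0 : ℝ) < m := by exact_mod_cast hm
  have hB1 : (1 : ℝ) ≤ dB := by exact_mod_cast hB
  have hA1 : (1 : ℝ) ≤ dA := by exact_mod_cast hA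
  have hC1 : (1 : ℝ) ≤ dC := by exact_mod_cast hC
  have hℓ1 : (1 : ℝ) ≤ ℓ := by exact_mod_cast hℓ
  have hkm : ∀ j, j ≤ L → 2 ^ j ≤ m := fun j hj =>
    (Nat.pow_le_pow_right two_pos hj).trans (Nat.pow_log_le_self 2 (by omega))
  let κ : Type := Fin (L + 1) × Fin (L + 1) × Fin (L + 1)
  have hκ : (Fintype.card κ : ℝ) = W := by
    simp only [κ, Fintype.card_prod, Fintype.card_fin, hW]; push_cast; ring
  let k : κ → ℕ := fun t => 2 ^ (t.1 : ℕ)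
  -- The minimum keeps `KA ≤ k` for every index, which bounds the number of roles by `8 * k`; for
  -- labels from the pigeonhole it has no effect.
  let KA : κ → ℕ := fun t => 2 ^ min (t.2.1 : ℕ) t.1
  let KC : κ → ℕ := fun t => 2 ^ min (t.2.2 : ℕ) t.1
  let n : κ → ℕ := fun t => blockLength m ℓ (k t)
  let M : κ → ℝ := fun t => min (dB : ℝ) (n t)
  let ρ : κ → ℝ := fun t => Real.sqrt (M t) * noise (k t) (KA t) (KC t) dA dC
  have hk1 : ∀ t, 1 ≤ k t := fun t => Nat.one_le_two_pow
  have hM1 : ∀ t, 1 ≤ M t := fun t =>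
    le_min hB1 (by simp only [n, blockLength]; exact_mod_cast Nat.succ_le_succ (Nat.zero_le _))
  have hρ1 : ∀ t, 1 ≤ ρ t := fun t =>
    one_le_mul_of_one_le_of_one_le (Real.one_le_sqrt.2 (hM1 t)) (one_le_noise _ _ _ _ _)
  -- The threshold `20 * W * ρ` makes each false alarm at most `128 / (400 * W ^ 2) ≤ 1 / (3 * W)`,
  -- as the union over `W` tests requires.
  have htests : ∀ t : κ, _ := fun t => exists_scale_test (A := Fin dA) (B := Fin dB)
    (C := Fin dC) (N := 16 * (ℓ * m)) (n := n t) (k := k t) (KA := KA t) (KC := KC t)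
    (ρ := ρ t) (T := 20 * W * ρ t) (hk1 t) Nat.one_le_two_pow Nat.one_le_two_pow
    (by
      have h1 : KA t ≤ k t := Nat.pow_le_pow_right two_pos (min_le_right _ _)
      have h2 : KC t ≤ k t := Nat.pow_le_pow_right two_pos (min_le_right _ _)
      have h3 := blockLength_le (hkm t.1 (by omega)) hℓ
      have h4 : blockLength m ℓ (k t) * k t ≤ 2 * (ℓ * m) := by exact_mod_cast h3
      calc (2 * (KA t - 1) + 2 * (KC t - 1) + 4 * k t) * n t ≤ (8 * k t) * n t :=
            Nat.mul_le_mul_right _ (by omega)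
        _ = 8 * (blockLength m ℓ (k t) * k t) := by simp only [n]; ring
        _ ≤ _ := by omega)
    (by have := hρ1 t; positivity) (hρ1 t)
    (by
      simp only [Fintype.card_fin]
      have hM0 : 0 ≤ M t := by linarith [hM1 t]
      have h1 : (k t * (Real.sqrt (flatNorm dA (KA t)) * Real.sqrt (flatNorm dC (KC t)))) ^ 2 ≤
          noise (k t) (KA t) (KC t) dA dC ^ 2 :=
        pow_le_pow_left₀ (by positivity) (le_max_right _ _) 2
      rw [mul_pow, mul_pow, Real.sq_sqrt (flatNorm_nonneg _ _),
        Real.sq_sqrt (flatNorm_nonneg _ _)] at h1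
      simp only [ρ]
      rw [mul_pow, Real.sq_sqrt hM0]
      calc _ = M t * ((k t : ℝ) ^ 2 * (flatNorm dA (KA t) * flatNorm dC (KC t))) := by
            simp only [M]; ring
        _ ≤ _ := mul_le_mul_of_nonneg_left h1 hM0)
  choose Rej hRej using htests
  refine scCIndep_le_of_rejections Rej (fun P hP h0 t => ?_) (fun P hP hfar => ?_)
  · obtain ⟨q, hq, p, hp, rfl, hmk, hz⟩ := exists_joint hP
    rw [hellingerSq_joint hq p hmk] at h0
    refine ((hRej t q hq p hp).1 (depend_eq_zero_of_hellingerSq_eq_zero hq hp hz h0)).trans ?_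
    have := hρ1 t
    rw [hκ, div_le_div_iff₀ (by positivity) (by positivity)]
    nlinarith [sq_nonneg (ρ t), mul_le_mul_of_nonneg_left hW1 (show 0 ≤ W * ρ t ^ 2 by positivity)]
  · obtain ⟨q, hq, p, hp, rfl, hmk, hz⟩ := exists_joint hP
    rw [hellingerSq_joint hq p hmk] at hfar
    have hq1 : ∀ b, q b ≤ 1 := fun b => by
      rw [← hq.2]; exact Finset.single_le_sum (fun y _ => hq.1 y) (Finset.mem_univ b)
    have hsplit := Finset.sum_filter_add_sum_filter_not Finset.univ
      (fun b => 1 ≤ (m : ℝ) * q b) (fun b => q b * ∑ z, cellHell (p b) z)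
    -- The normalization `1 / 2` of the distance makes the full sum at least `2 * ε`, so the heavy
    -- or the light bins contribute `ε`.
    by_cases hheavy : ε ≤ ∑ b with 1 ≤ (m : ℝ) * q b, q b * ∑ z, cellHell (p b) z
    · obtain ⟨j, hj, i, hi, i', hi', cells, hcells, hS⟩ := exists_isScaleCells hq hp hm hε hheavy
      let t : κ := (⟨j, by omega⟩, ⟨i, by omega⟩, ⟨i', by omega⟩)
      have hkt : (k t : ℝ) = 2 ^ j := by simp [k, t]
      have hKAt : (KA t : ℝ) = 2 ^ i := by simp [KA, t, min_eq_left hi]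
      have hKCt : (KC t : ℝ) = 2 ^ i' := by simp [KC, t, min_eq_left hi']
      refine ⟨t, ?_⟩
      have hM : min (Fintype.card (Fin dB) : ℝ) (m / 2 ^ j) ≤ M t := by
        simp only [Fintype.card_fin]
        refine min_le_min_left _ (le_trans ?_ (le_blockLength (hk1 t)))
        rw [hkt]
        gcongr
        nlinarith
      have hM0 : 0 < M t := by linarith [hM1 t]
      set S₁ := ∑ b, ∑ z ∈ cells b, cellHell (p b) z with hS₁
      set S₂ := ∑ b, ∑ z ∈ cells b, depend (p b) z ^ 2 with hS₂
      have hS₂0 : 0 ≤ S₂ := Finset.sum_nonneg fun b _ => Finset.sum_nonneg fun z _ => sq_nonneg _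
      have hcs : ∀ JA JC : ℝ, (JA = dA ∨ i ≠ j ∧ JA = 160 * 2 ^ i) →
          (JC = dC ∨ i' ≠ j ∧ JC = 160 * 2 ^ i') → S₁ ^ 2 ≤ M t * JA * JC * S₂ :=
        fun JA JC h1 h2 => sq_sum_cellHell_le hp cells
          (hcells.card_le hq hp hM (by simpa using h1) (by simpa using h2))
      have hsig : 2 * 10 ^ 6 * W * Real.sqrt (M t) * noise (k t) (KA t) (KC t) dA dC ≤
          (k t : ℝ) ^ 2 * S₂ := by
        refine noise_mul_le_of_signal (b := dB) (X := m * ε) (S₁ := S₁) (hk1 t)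
          Nat.one_le_two_pow Nat.one_le_two_pow hC hCA hM0 (min_le_left _ _) hB1 hW1
          (by positivity) ?_ hS₂0 (hcs _ _ (Or.inl rfl) (Or.inl rfl)) ?_ hsym ?_
        · rw [hkt, hW]; exact hS
        · by_cases h1 : i = j
          · by_cases h2 : i' = j
            · left
              constructor
              · simp [KA, k, t, h1]
              · simp [KC, k, t, h2]
            · right; right; left
              refine ⟨by simp [KA, k, t, h1], ?_⟩
              rw [hKCt]
              exact hcs _ _ (Or.inl rfl) (Or.inr ⟨h2, rfl⟩)
          · by_cases h2 : i' = j
            · right; right; right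
              refine ⟨by simp [KC, k, t, h2], ?_⟩
              rw [hKAt]
              exact hcs _ _ (Or.inr ⟨h1, rfl⟩) (Or.inl rfl)
            · right; left
              rw [hKAt, hKCt]
              exact hcells.sum_cellHell_le hp h1 h2
        · have hMB : M t ≤ dB := min_le_left _ _
          rcases hasym with h | h
          · refine le_trans ?_ h
            gcongr
            exact min_le_right _ _
          · refine le_trans ?_ h
            -- The sparse alternative: `M t` is at most the block length, whose product with `k` is
            -- at most `2 * ℓ * m`.
            have h1 : Real.sqrt (M t) * Real.sqrt (min (k t : ℝ) dA) ≤
                Real.sqrt (2 * (ℓ * m)) := by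
              rw [← Real.sqrt_mul hM0.le]
              refine Real.sqrt_le_sqrt (le_trans ?_
                (blockLength_le (hkm j hj) hℓ))
              exact mul_le_mul (min_le_right _ _) (min_le_left _ _) (by positivity)
                (Nat.cast_nonneg _)
            calc _ = 1280000000 * W ^ 3 * (M t * (Real.sqrt (M t) *
                  Real.sqrt (min (k t : ℝ) dA))) * (dA * Real.sqrt dC) := by ring
              _ ≤ _ := by gcongr
      have hsum : ∑ b, (k t : ℝ) ^ 2 * ∑ z ∈ cells b, depend (p b) z ^ 2 =
          (k t : ℝ) ^ 2 * S₂ := by rw [← Finset.mul_sum]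
      have hρt : 2 * 10 ^ 6 * W * ρ t ≤ (k t : ℝ) ^ 2 * S₂ := by
        simp only [ρ]; linarith
      have hρ1t := hρ1 t
      have hWρ : ρ t ≤ W * ρ t := le_mul_of_one_le_left (by linarith) hW1
      refine (hRej t q hq p hp).2 cells (fun b z hbz => ?_) (fun b z hbz => ?_)
        ((∑ b, (k t : ℝ) ^ 2 * ∑ z ∈ cells b, depend (p b) z ^ 2) / 2) ?_ ?_
        (prob_sum_usedBins_lt_le' hq (fun b => mul_nonneg (sq_nonneg _)
          (Finset.sum_nonneg fun z _ => sq_nonneg _)) ?_ fun b hb => ?_)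
      · rw [hKAt]; exact hcells.fst_le b z hbz
      · rw [hKCt]; exact hcells.snd_le b z hbz
      · rw [hsum]; linarith
      · rw [hsum]; linarith
      · rw [hsum]; linarith
      · have hne : (cells b).Nonempty := by
          by_contra hcon
          rw [Finset.not_nonempty_iff_eq_empty] at hcon
          exact hb (by simp [hcon])
        obtain ⟨z, hzb⟩ := hne
        have hbin := hcells.bin b z hzb
        refine le_hitProb (ℓ := ℓ) (hq.1 b) (hq1 b) ?_ ?_
        · have h1 := le_blockLength (m := m) (ℓ := ℓ) (hk1 t)
          rw [hkt] at h1
          have h2 := mul_le_mul_of_nonneg_right h1 (hq.1 b)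
          refine le_trans ?_ h2
          rw [div_mul_eq_mul_div, le_div_iff₀ (by positivity)]
          nlinarith
        · refine le_trans ?_ hexp
          have h1 : KA t ≤ k t := Nat.pow_le_pow_right two_pos (min_le_right _ _)
          have h2 : KC t ≤ k t := Nat.pow_le_pow_right two_pos (min_le_right _ _)
          have h3 : k t ≤ m := hkm j hj
          have h4 : Fintype.card (Role (2 * (KA t - 1)) (2 * (KC t - 1)) (k t)) ≤ 8 * m := by
            simp only [Fintype.card_sum, Fintype.card_fin]; omega
          have h5 : (Fintype.card (Role (2 * (KA t - 1)) (2 * (KC t - 1)) (k t)) : ℝ) ≤ 8 * m := by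
            exact_mod_cast h4
          linarith
    · have hlt : ε ≤ ∑ b with ¬ 1 ≤ (m : ℝ) * q b, q b * ∑ z, cellHell (p b) z := by
        push Not at hheavy
        linarith
      -- At scale one there is no selection: four roles, one product of two pairs per bin, and all
      -- cells are kept.
      let t : κ := (0, 0, 0)
      have hkt : k t = 1 := by simp [k, t]
      have hKAt : KA t = 1 := by simp [KA, t]
      have hKCt : KC t = 1 := by simp [KC, t]
      refine ⟨t, ?_⟩
      have hnt : m ≤ n t := by
        simp only [n, hkt, blockLength, Nat.div_one]
        exact (Nat.le_mul_of_pos_left m (by omega)).trans (Nat.le_succ _)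
      have hE := le_light_signal hq hp hnt hε hlt
      simp only [Fintype.card_fin] at hE
      set E := ∑ b, (∑ z, depend (p b) z ^ 2) * hitProb 4 (n t) (q b) with hEdef
      have hcard : Fintype.card (Role (2 * (KA t - 1)) (2 * (KC t - 1)) (k t)) = 4 := by
        simp only [Fintype.card_sum, Fintype.card_fin, hkt, hKAt, hKCt]
      have hnoise : noise (k t) (KA t) (KC t) dA dC = 1 := by
        rw [hkt, hKAt, hKCt]
        exact max_eq_left (mul_sqrt_flatNorm_mul_le_one le_rfl dA dC)
      have hMt : M t ≤ min (dB : ℝ) (2 * (ℓ * m)) := by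
        refine min_le_min_left _ ?_
        have := blockLength_le (m := m) (ℓ := ℓ) (hkt ▸ hm) hℓ
        rw [hkt] at this
        simpa [n, hkt] using this
      have hρt : 2 * 10 ^ 6 * W * ρ t ≤ E := by
        refine le_trans ?_ hE
        rw [le_div_iff₀ (by positivity)]
        refine le_trans ?_ hlight
        simp only [ρ, hnoise, mul_one]
        calc 2 * 10 ^ 6 * W * Real.sqrt (M t) * (64 * ((dB : ℝ) ^ 3 * (dA * dC)))
            = 128000000 * W * ((dB : ℝ) ^ 3 * (dA * dC)) * Real.sqrt (M t) := by ring
          _ ≤ _ := by gcongr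
      have hρ1t := hρ1 t
      have hWρ : ρ t ≤ W * ρ t := le_mul_of_one_le_left (by linarith) hW1
      have hQ : ∀ b, (k t : ℝ) ^ 2 * ∑ z ∈ (Finset.univ : Finset (Fin dA × Fin dC)),
          depend (p b) z ^ 2 = ∑ z, depend (p b) z ^ 2 := fun b => by simp [hkt]
      refine (hRej t q hq p hp).2 (fun _ => Finset.univ) (fun b z _ => ?_) (fun b z _ => ?_)
        (E / 2) ?_ ?_ ?_
      · rw [hKAt]; norm_num
      · rw [hKCt]; norm_num
      · linarith
      · linarith
      · simp only [hQ]
        refine prob_sum_usedBins_lt_le hq (fun b => Finset.sum_nonneg fun z _ => sq_nonneg _)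
          (D := 4) (fun b => sum_depend_sq_le (hp b)) ?_ ?_ ?_
        · rw [hcard]
        · linarith
        · linarith

/-! ### From the rates to the numerical conditions -/

section Rates

variable {a b c ε : ℝ}

/-- This and the next four lemmas clear fractional exponents by integer powers, since the tester's
conditions involve only integer powers and square roots. -/
lemma sq_rate_balanced (ha : 0 ≤ a) (hb : 0 ≤ b) (hc : 0 ≤ c) :
    (a ^ (1 / 2 : ℝ) * b ^ (3 / 4 : ℝ) * c ^ (1 / 2 : ℝ)) ^ 2 = b * Real.sqrt b * (a * c) := by
  rw [mul_pow, mul_pow, ← Real.rpow_mul_natCast ha, ← Real.rpow_mul_natCast hb,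
    ← Real.rpow_mul_natCast hc, Real.sqrt_eq_rpow]
  have h : b ^ (3 / 4 * ((2 : ℕ) : ℝ) : ℝ) = b * b ^ (1 / 2 : ℝ) := by
    rw [show (3 / 4 * ((2 : ℕ) : ℝ) : ℝ) = 1 + 1 / 2 by norm_num,
      Real.rpow_add_of_nonneg hb (by norm_num) (by norm_num), Real.rpow_one]
  rw [h]
  norm_num
  ring

lemma pow_four_rate_dense (ha : 0 ≤ a) (hb : 0 ≤ b) (hc : 0 ≤ c) :
    (a ^ (1 / 4 : ℝ) * b ^ (7 / 8 : ℝ) * c ^ (1 / 4 : ℝ)) ^ 4 =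
      b ^ 3 * (a * c) * Real.sqrt b := by
  rw [mul_pow, mul_pow, ← Real.rpow_mul_natCast ha, ← Real.rpow_mul_natCast hb,
    ← Real.rpow_mul_natCast hc, Real.sqrt_eq_rpow]
  have h : b ^ (7 / 8 * ((4 : ℕ) : ℝ) : ℝ) = b ^ 3 * b ^ (1 / 2 : ℝ) := by
    rw [show (7 / 8 * ((4 : ℕ) : ℝ) : ℝ) = (3 : ℕ) + 1 / 2 by norm_num,
      Real.rpow_add_of_nonneg hb (by norm_num) (by norm_num), Real.rpow_natCast]
  rw [h]
  norm_num
  ring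

lemma pow_seven_rate_sparse (ha : 0 ≤ a) (hb : 0 ≤ b) (hc : 0 ≤ c) (hε : 0 ≤ ε) :
    (a ^ (2 / 7 : ℝ) * b ^ (6 / 7 : ℝ) * c ^ (2 / 7 : ℝ) / ε ^ (8 / 7 : ℝ)) ^ 7 =
      a ^ 2 * b ^ 6 * c ^ 2 / ε ^ 8 := by
  rw [div_pow, mul_pow, mul_pow, ← Real.rpow_mul_natCast ha, ← Real.rpow_mul_natCast hb,
    ← Real.rpow_mul_natCast hc, ← Real.rpow_mul_natCast hε]
  rw [show (2 / 7 * ((7 : ℕ) : ℝ) : ℝ) = (2 : ℕ) by norm_num,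
    show (6 / 7 * ((7 : ℕ) : ℝ) : ℝ) = (6 : ℕ) by norm_num,
    show (8 / 7 * ((7 : ℕ) : ℝ) : ℝ) = (8 : ℕ) by norm_num]
  simp only [Real.rpow_natCast]

lemma sq_rate_asym_dense (ha : 0 ≤ a) (hb : 0 ≤ b) (hc : 0 ≤ c) :
    (a ^ (3 / 4 : ℝ) * b ^ (3 / 4 : ℝ) * c ^ (1 / 4 : ℝ)) ^ 2 =
      b * Real.sqrt b * (a * Real.sqrt c) * Real.sqrt a := by
  rw [mul_pow, mul_pow, ← Real.rpow_mul_natCast ha, ← Real.rpow_mul_natCast hb,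
    ← Real.rpow_mul_natCast hc, Real.sqrt_eq_rpow, Real.sqrt_eq_rpow, Real.sqrt_eq_rpow]
  have h : ∀ {x : ℝ}, 0 ≤ x → x ^ (3 / 4 * ((2 : ℕ) : ℝ) : ℝ) = x * x ^ (1 / 2 : ℝ) :=
    fun {x} hx => by
      rw [show (3 / 4 * ((2 : ℕ) : ℝ) : ℝ) = 1 + 1 / 2 by norm_num,
        Real.rpow_add_of_nonneg hx (by norm_num) (by norm_num), Real.rpow_one]
  rw [h ha, h hb, show (1 / 4 * ((2 : ℕ) : ℝ) : ℝ) = 1 / 2 by norm_num]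
  ring

lemma pow_three_rate_asym_sparse (ha : 0 ≤ a) (hb : 0 ≤ b) (hc : 0 ≤ c) (hε : 0 ≤ ε) :
    (a ^ (2 / 3 : ℝ) * b ^ (2 / 3 : ℝ) * c ^ (1 / 3 : ℝ) / ε ^ (4 / 3 : ℝ)) ^ 3 =
      a ^ 2 * b ^ 2 * c / ε ^ 4 := by
  rw [div_pow, mul_pow, mul_pow, ← Real.rpow_mul_natCast ha, ← Real.rpow_mul_natCast hb,
    ← Real.rpow_mul_natCast hc, ← Real.rpow_mul_natCast hε]
  rw [show (2 / 3 * ((3 : ℕ) : ℝ) : ℝ) = (2 : ℕ) by norm_num,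
    show (1 / 3 * ((3 : ℕ) : ℝ) : ℝ) = (1 : ℕ) by norm_num,
    show (4 / 3 * ((3 : ℕ) : ℝ) : ℝ) = (4 : ℕ) by norm_num]
  simp only [Real.rpow_natCast, pow_one]

lemma max_rate_le (ha : 1 ≤ a) (hb : 1 ≤ b) (hc : 1 ≤ c) (hε : 0 < ε) :
    max (fSym ε a b c) (fAsym ε a b c) ≤ a * b * c / ε := by
  have h : ∀ {x y : ℝ}, 1 ≤ x → y ≤ 1 → x ^ y ≤ x := fun {x y} hx hy => by
    calc x ^ y ≤ x ^ (1 : ℝ) := Real.rpow_le_rpow_of_exponent_le hx hy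
      _ = x := Real.rpow_one x
  refine max_le (max_le ?_ ((min_le_left _ _).trans ?_)) ((min_le_left _ _).trans ?_)
  all_goals
    refine div_le_div_of_nonneg_right ?_ hε.le
    exact mul_le_mul (mul_le_mul (h ha (by norm_num)) (h hb (by norm_num)) (by positivity)
      (by positivity)) (h hc (by norm_num)) (by positivity) (by positivity)

lemma one_le_max_rate (ha : 1 ≤ a) (hb : 1 ≤ b) (hc : 1 ≤ c) (hε : 0 < ε) (hε1 : ε ≤ 1) :
    1 ≤ max (fSym ε a b c) (fAsym ε a b c) := by
  refine le_trans ?_ ((le_max_left _ _).trans (le_max_left _ _))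
  rw [le_div_iff₀ hε, one_mul]
  refine hε1.trans ?_
  exact one_le_mul_of_one_le_of_one_le (one_le_mul_of_one_le_of_one_le
    (Real.one_le_rpow ha (by norm_num)) (Real.one_le_rpow hb (by norm_num)))
    (Real.one_le_rpow hc (by norm_num))

variable {D m : ℝ}

lemma sym_cond (ha : 0 ≤ a) (hb : 0 ≤ b) (hc : 0 ≤ c) (hε : 0 < ε) (hD : 0 ≤ D)
    (hm : D * max (fSym ε a b c) (fAsym ε a b c) ≤ m) :
    D ^ 2 * (b * Real.sqrt b * (a * c)) ≤ (m * ε) ^ 2 := by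
  rw [← sq_rate_balanced ha hb hc, ← mul_pow]
  refine pow_le_pow_left₀ (by positivity) ?_ 2
  have h1 : D * (a ^ (1 / 2 : ℝ) * b ^ (3 / 4 : ℝ) * c ^ (1 / 2 : ℝ) / ε) ≤ m :=
    (mul_le_mul_of_nonneg_left ((le_max_left _ _).trans (le_max_left _ _)) hD).trans hm
  rwa [← mul_div_assoc, div_le_iff₀ hε] at h1

/-- The alternative follows the branch attained in `fAsym`. In the sparse branch the cube of the
rate bounds `a ^ 2 * b ^ 2 * c` by `m ^ 3 * ε ^ 4`; taking the square root and multiplying by `√m`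
gives the second form. -/
lemma asym_cond (ha : 0 ≤ a) (hb : 0 ≤ b) (hc : 0 ≤ c) (hε : 0 < ε) (hD : 1 ≤ D)
    (hm0 : 0 ≤ m) (hm : D * max (fSym ε a b c) (fAsym ε a b c) ≤ m) :
    D * (b * Real.sqrt b * (a * Real.sqrt c) * Real.sqrt a) ≤ (m * ε) ^ 2 ∨
      D * (b * Real.sqrt m * (a * Real.sqrt c)) ≤ (m * ε) ^ 2 := by
  have hD0 : 0 ≤ D := by linarith
  rcases min_choice (a ^ (3 / 4 : ℝ) * b ^ (3 / 4 : ℝ) * c ^ (1 / 4 : ℝ) / ε)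
    (a ^ (2 / 3 : ℝ) * b ^ (2 / 3 : ℝ) * c ^ (1 / 3 : ℝ) / ε ^ (4 / 3 : ℝ)) with h | h
  · left
    have h1 : D * (a ^ (3 / 4 : ℝ) * b ^ (3 / 4 : ℝ) * c ^ (1 / 4 : ℝ) / ε) ≤ m := by
      rw [← h]; exact (mul_le_mul_of_nonneg_left (le_max_right _ _) hD0).trans hm
    rw [← mul_div_assoc, div_le_iff₀ hε] at h1
    have h2 := pow_le_pow_left₀ (by positivity) h1 2
    rw [mul_pow, sq_rate_asym_dense ha hb hc] at h2
    refine le_trans (mul_le_mul_of_nonneg_right ?_ (by positivity)) h2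
    nlinarith
  · right
    have h1 : D * (a ^ (2 / 3 : ℝ) * b ^ (2 / 3 : ℝ) * c ^ (1 / 3 : ℝ) / ε ^ (4 / 3 : ℝ)) ≤ m := by
      rw [← h]; exact (mul_le_mul_of_nonneg_left (le_max_right _ _) hD0).trans hm
    have h2 := pow_le_pow_left₀ (by positivity) h1 3
    rw [mul_pow, pow_three_rate_asym_sparse ha hb hc hε.le, ← mul_div_assoc,
      div_le_iff₀ (by positivity)] at h2
    have h3 : D * (b * (a * Real.sqrt c)) ≤ m * Real.sqrt m * ε ^ 2 := by
      refine abs_le_of_sq_le_sq' ?_ (by positivity) |>.2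
      calc (D * (b * (a * Real.sqrt c))) ^ 2 = D ^ 2 * (a ^ 2 * b ^ 2 * Real.sqrt c ^ 2) := by ring
        _ = D ^ 2 * (a ^ 2 * b ^ 2 * c) := by rw [Real.sq_sqrt hc]
        _ ≤ D ^ 3 * (a ^ 2 * b ^ 2 * c) := by
          refine mul_le_mul_of_nonneg_right ?_ (by positivity)
          exact pow_le_pow_right₀ hD (by norm_num)
        _ ≤ m ^ 3 * ε ^ 4 := h2
        _ = m ^ 2 * Real.sqrt m ^ 2 * ε ^ 4 := by rw [Real.sq_sqrt hm0]; ring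
        _ = _ := by ring
    calc D * (b * Real.sqrt m * (a * Real.sqrt c))
        = Real.sqrt m * (D * (b * (a * Real.sqrt c))) := by ring
      _ ≤ Real.sqrt m * (m * Real.sqrt m * ε ^ 2) := by gcongr
      _ = m * (Real.sqrt m * Real.sqrt m) * ε ^ 2 := by ring
      _ = _ := by rw [Real.mul_self_sqrt hm0]; ring

/-- Same scheme for the inner minimum of `fSym`, with the fourth power in the dense and the seventh
in the sparse branch. -/
lemma light_cond (ha : 0 ≤ a) (hb : 0 ≤ b) (hc : 0 ≤ c) (hε : 0 < ε) (hD : 1 ≤ D)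
    (hm0 : 0 ≤ m) (hm : D * max (fSym ε a b c) (fAsym ε a b c) ≤ m) :
    D * (b ^ 3 * (a * c) * Real.sqrt b) ≤ (m * ε) ^ 4 ∨
      D * (b ^ 3 * (a * c) * Real.sqrt m) ≤ (m * ε) ^ 4 := by
  have hD0 : 0 ≤ D := by linarith
  rcases min_choice (a ^ (1 / 4 : ℝ) * b ^ (7 / 8 : ℝ) * c ^ (1 / 4 : ℝ) / ε)
    (a ^ (2 / 7 : ℝ) * b ^ (6 / 7 : ℝ) * c ^ (2 / 7 : ℝ) / ε ^ (8 / 7 : ℝ)) with h | h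
  · left
    have h1 : D * (a ^ (1 / 4 : ℝ) * b ^ (7 / 8 : ℝ) * c ^ (1 / 4 : ℝ) / ε) ≤ m := by
      rw [← h]
      exact (mul_le_mul_of_nonneg_left ((le_max_right _ _).trans (le_max_left _ _)) hD0).trans hm
    rw [← mul_div_assoc, div_le_iff₀ hε] at h1
    have h2 := pow_le_pow_left₀ (by positivity) h1 4
    rw [mul_pow, pow_four_rate_dense ha hb hc] at h2
    refine le_trans (mul_le_mul_of_nonneg_right ?_ (by positivity)) h2
    exact le_self_pow₀ hD (by norm_num)
  · right
    have h1 : D * (a ^ (2 / 7 : ℝ) * b ^ (6 / 7 : ℝ) * c ^ (2 / 7 : ℝ) / ε ^ (8 / 7 : ℝ)) ≤ m := by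
      rw [← h]
      exact (mul_le_mul_of_nonneg_left ((le_max_right _ _).trans (le_max_left _ _)) hD0).trans hm
    have h2 := pow_le_pow_left₀ (by positivity) h1 7
    rw [mul_pow, pow_seven_rate_sparse ha hb hc hε.le, ← mul_div_assoc,
      div_le_iff₀ (by positivity)] at h2
    have h3 : D * (b ^ 3 * (a * c)) ≤ m ^ 3 * Real.sqrt m * ε ^ 4 := by
      refine abs_le_of_sq_le_sq' ?_ (by positivity) |>.2
      calc (D * (b ^ 3 * (a * c))) ^ 2 = D ^ 2 * (a ^ 2 * b ^ 6 * c ^ 2) := by ring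
        _ ≤ D ^ 7 * (a ^ 2 * b ^ 6 * c ^ 2) := by
          refine mul_le_mul_of_nonneg_right ?_ (by positivity)
          exact pow_le_pow_right₀ hD (by norm_num)
        _ ≤ m ^ 7 * ε ^ 8 := h2
        _ = m ^ 6 * Real.sqrt m ^ 2 * ε ^ 8 := by rw [Real.sq_sqrt hm0]; ring
        _ = _ := by ring
    calc D * (b ^ 3 * (a * c) * Real.sqrt m)
        = Real.sqrt m * (D * (b ^ 3 * (a * c))) := by ring
      _ ≤ Real.sqrt m * (m ^ 3 * Real.sqrt m * ε ^ 4) := by gcongr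
      _ = m ^ 3 * (Real.sqrt m * Real.sqrt m) * ε ^ 4 := by ring
      _ = _ := by rw [Real.mul_self_sqrt hm0]; ring

end Rates

/-! ### Choice of the number of samples -/

lemma natLog_le {m : ℕ} (hm : 1 ≤ m) {y : ℝ} (h : (m : ℝ) ≤ Real.exp y) :
    (Nat.log 2 m : ℝ) ≤ 2 * y := by
  have h1 : ((2 ^ Nat.log 2 m : ℕ) : ℝ) ≤ m := Nat.cast_le.2 (Nat.pow_log_le_self 2 (by omega))
  have h2 : Real.exp (1 / 2) ≤ 2 := by
    rw [← Real.le_log_iff_exp_le (by norm_num)]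
    linarith [Real.log_two_gt_d9]
  have h3 : Real.exp (Nat.log 2 m * (1 / 2)) ≤ Real.exp y := by
    rw [Real.exp_nat_mul]
    push_cast at h1
    exact ((pow_le_pow_left₀ (Real.exp_pos _).le h2 _).trans h1).trans h
  have := Real.exp_le_exp.1 h3
  linarith

/-- The sample complexity of testing in squared Hellinger distance for thresholds at most one. -/
theorem exists_scHellinger_le {dA dB dC : ℕ} {ε : ℝ} (hB : 1 ≤ dB) (hC : 1 ≤ dC) (hCA : dC ≤ dA)
    (hε : 0 < ε) (hε1 : ε ≤ 1) :
    ∃ N : ℕ, scHellinger ε dA dB dC ≤ N ∧ (N : ℝ) ≤ rate (10 ^ 50) 11 ε dA dB dC := by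
  have hB1 : (1 : ℝ) ≤ dB := by exact_mod_cast hB
  have hC1 : (1 : ℝ) ≤ dC := by exact_mod_cast hC
  have hA1 : (1 : ℝ) ≤ dA := by exact_mod_cast hC.trans hCA
  set F := max (fSym ε dA dB dC) (fAsym ε dA dB dC) with hF
  have hF1 : 1 ≤ F := one_le_max_rate hA1 hB1 hC1 hε hε1
  set x := 2 + (dA * dB * dC : ℝ) / ε with hx
  have hFx : F ≤ x := (max_rate_le hA1 hB1 hC1 hε).trans (by rw [hx]; linarith)
  have hx3 : 3 ≤ x := by linarith [max_rate_le hA1 hB1 hC1 hε]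
  have hlog1 : 1 ≤ Real.log x := by
    rw [Real.le_log_iff_exp_le (by linarith)]
    linarith [Real.exp_one_lt_d9]
  set L : ℕ := ⌈Real.log x⌉₊ with hL
  have hLx : Real.log x ≤ L := Nat.le_ceil _
  have hL2 : (L : ℝ) ≤ 2 * Real.log x := by
    have := Nat.ceil_lt_add_one (show 0 ≤ Real.log x by linarith)
    linarith
  have hL1 : (1 : ℝ) ≤ L := hlog1.trans hLx
  have hL1n : 1 ≤ L := by exact_mod_cast hL1
  have hxL : x ≤ Real.exp L := by
    rw [← Real.log_le_iff_le_exp (by linarith)]; exact hLx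
  -- `W` grows like `L ^ 3`, so the heaviest requirement, `W ^ 3 * L`, has order `L ^ 10`.
  -- Multiplication by the block factor `ℓ` gives the final exponent `11`.
  set D : ℝ := 10 ^ 40 * L ^ 10 with hD
  have hLp : ∀ n : ℕ, (1 : ℝ) ≤ (L : ℝ) ^ n := fun n => one_le_pow₀ hL1
  have hD1 : 1 ≤ D := by
    rw [hD]; nlinarith [hLp 10]
  set m : ℕ := ⌈D * F⌉₊ with hmdef
  have hmlow : D * F ≤ m := Nat.le_ceil _
  have hm1' : (1 : ℝ) ≤ m := le_trans (one_le_mul_of_one_le_of_one_le hD1 hF1) hmlow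
  have hm1 : 1 ≤ m := by exact_mod_cast hm1'
  have hmup : (m : ℝ) ≤ 2 * (D * F) := by
    have h1 := Nat.ceil_lt_add_one (show 0 ≤ D * F by positivity)
    have h2 := one_le_mul_of_one_le_of_one_le hD1 hF1
    linarith
  have hmexp : (m : ℝ) ≤ Real.exp (111 * L) := by
    have h100 : (2 * 10 ^ 40 : ℝ) ≤ Real.exp (100 * L) := by
      calc (2 * 10 ^ 40 : ℝ) ≤ 2.7 ^ 100 := by norm_num
        _ ≤ Real.exp 1 ^ 100 := by
          refine pow_le_pow_left₀ (by norm_num) ?_ 100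
          linarith [Real.exp_one_gt_d9]
        _ = Real.exp 100 := by rw [← Real.exp_nat_mul]; norm_num
        _ ≤ _ := Real.exp_le_exp.2 (by linarith)
    have h10 : (L : ℝ) ^ 10 ≤ Real.exp (10 * L) := by
      have : (L : ℝ) ≤ Real.exp L := by linarith [Real.add_one_le_exp (L : ℝ)]
      calc (L : ℝ) ^ 10 ≤ Real.exp L ^ 10 := pow_le_pow_left₀ (by positivity) this 10
        _ = _ := by rw [← Real.exp_nat_mul]; norm_num
    calc (m : ℝ) ≤ 2 * (D * F) := hmup
      _ = 2 * 10 ^ 40 * (L : ℝ) ^ 10 * F := by rw [hD]; ring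
      _ ≤ Real.exp (100 * L) * Real.exp (10 * L) * Real.exp L := by
        gcongr
        exact hFx.trans hxL
      _ = _ := by rw [← Real.exp_add, ← Real.exp_add]; ring_nf
  set W : ℝ := ((Nat.log 2 m : ℝ) + 1) ^ 3 with hW
  -- From `m ≤ exp (111 * L)`: twice `111 * L` bounds the binary logarithm, and `1 ≤ L`.
  have hWL : W ≤ (223 * L) ^ 3 := by
    refine pow_le_pow_left₀ (by positivity) ?_ 3
    linarith [natLog_le hm1 hmexp]
  have hW0 : 0 ≤ W := by positivity
  have hW1 : 1 ≤ W := one_le_pow₀ (by linarith [(Nat.cast_nonneg (Nat.log 2 m) : (0 : ℝ) ≤ _)])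
  -- The block factor `117 * L` consists of `111 * L` for `m` and `6 * L` for the constant `160`.
  have hexp : 160 * (m : ℝ) ≤ Real.exp ((117 * L : ℕ) : ℝ) := by
    have h6 : (160 : ℝ) ≤ Real.exp (6 * L) := by
      calc (160 : ℝ) ≤ 2.7 ^ 6 := by norm_num
        _ ≤ Real.exp 1 ^ 6 := by
          refine pow_le_pow_left₀ (by norm_num) ?_ 6
          linarith [Real.exp_one_gt_d9]
        _ = Real.exp 6 := by rw [← Real.exp_nat_mul]; norm_num
        _ ≤ _ := Real.exp_le_exp.2 (by linarith)
    calc 160 * (m : ℝ) ≤ Real.exp (6 * L) * Real.exp (111 * L) := by gcongr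
      _ = _ := by rw [← Real.exp_add]; push_cast; ring_nf
  have hsqrt : Real.sqrt (2 * (((117 * L : ℕ) : ℝ) * m)) ≤ 234 * L * Real.sqrt m := by
    rw [show 2 * (((117 * L : ℕ) : ℝ) * m) = (234 * L) * m by push_cast; ring,
      Real.sqrt_mul (by positivity)]
    refine mul_le_mul_of_nonneg_right ?_ (Real.sqrt_nonneg _)
    rw [Real.sqrt_le_left (by positivity)]
    nlinarith
  have hW4 : 10 ^ 23 * W ^ 4 ≤ D ^ 2 := by
    calc 10 ^ 23 * W ^ 4 ≤ 10 ^ 23 * ((223 * L) ^ 3) ^ 4 := by gcongr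
      _ = 10 ^ 23 * 223 ^ 12 * (L : ℝ) ^ 12 := by ring
      _ ≤ 10 ^ 80 * (L : ℝ) ^ 20 := by
        gcongr
        · norm_num
        · norm_num
      _ = D ^ 2 := by rw [hD]; ring
  have hW3 : 1280000000 * W ^ 3 * (234 * L) ≤ D := by
    calc 1280000000 * W ^ 3 * (234 * L) ≤ 1280000000 * ((223 * L) ^ 3) ^ 3 * (234 * L) := by gcongr
      _ = 1280000000 * 223 ^ 9 * 234 * (L : ℝ) ^ 10 := by ring
      _ ≤ D := by
        rw [hD]; gcongr; norm_num
  have hW3' : 1280000000 * W ^ 3 ≤ D := by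
    refine le_trans (le_mul_of_one_le_right (by positivity) ?_) hW3
    linarith
  have hWl : 128000000 * W * (234 * L) ≤ D := by
    refine le_trans ?_ hW3
    have h1 : W ≤ W ^ 3 := le_self_pow₀ hW1 (by norm_num)
    gcongr
    norm_num
  have hWl' : 128000000 * W ≤ D := by
    refine le_trans (le_mul_of_one_le_right (by positivity) ?_) hWl
    linarith
  have hD0 : 0 ≤ D := by linarith
  refine ⟨16 * (117 * L * m), scHellinger_le hB hC hCA hε hm1 (by omega) hW hexp ?_ ?_ ?_, ?_⟩
  · refine le_trans ?_ (sym_cond (by linarith) (by linarith) (by linarith) hε hD0 hmlow)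
    rw [mul_assoc]
    gcongr
  · rcases asym_cond (by linarith) (by linarith) (by linarith) hε hD1 (by linarith) hmlow
      with h | h
    · left
      refine le_trans (le_of_eq ?_) (le_trans (mul_le_mul_of_nonneg_right hW3' ?_) h)
      · ring
      · positivity
    · right
      calc _ ≤ 1280000000 * W ^ 3 * (dB * (234 * L * Real.sqrt m)) * (dA * Real.sqrt dC) := by
            gcongr
        _ = 1280000000 * W ^ 3 * (234 * L) * (dB * Real.sqrt m * (dA * Real.sqrt dC)) := by ring
        _ ≤ _ := mul_le_mul_of_nonneg_right hW3 (by positivity)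
        _ ≤ _ := h
  · rcases light_cond (by linarith) (by linarith) (by linarith) hε hD1 (by linarith) hmlow
      with h | h
    · calc _ ≤ 128000000 * W * ((dB : ℝ) ^ 3 * (dA * dC)) * Real.sqrt dB := by
            gcongr; exact min_le_left _ _
        _ = 128000000 * W * ((dB : ℝ) ^ 3 * (dA * dC) * Real.sqrt dB) := by ring
        _ ≤ _ := mul_le_mul_of_nonneg_right hWl' (by positivity)
        _ ≤ _ := h
    · calc _ ≤ 128000000 * W * ((dB : ℝ) ^ 3 * (dA * dC)) *
            Real.sqrt (2 * (((117 * L : ℕ) : ℝ) * m)) := by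
            gcongr; exact min_le_right _ _
        _ ≤ 128000000 * W * ((dB : ℝ) ^ 3 * (dA * dC)) * (234 * L * Real.sqrt m) := by gcongr
        _ = 128000000 * W * (234 * L) * ((dB : ℝ) ^ 3 * (dA * dC) * Real.sqrt m) := by ring
        _ ≤ _ := mul_le_mul_of_nonneg_right hWl (by positivity)
        _ ≤ _ := h
  · unfold rate
    push_cast
    calc 16 * (117 * (L : ℝ) * m) ≤ 16 * (117 * (L : ℝ) * (2 * (D * F))) := by gcongr
      _ = 3744 * 10 ^ 40 * (L : ℝ) ^ 11 * F := by rw [hD]; ring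
      _ ≤ 3744 * 10 ^ 40 * (2 * Real.log x) ^ 11 * F := by gcongr
      _ = 3744 * 10 ^ 40 * 2 ^ 11 * Real.log x ^ 11 * F := by ring
      _ ≤ 10 ^ 50 * Real.log x ^ 11 * F := by
        have : (0 : ℝ) ≤ Real.log x := by linarith
        gcongr
        norm_num

/-! ### Kullback-Leibler divergence against Hellinger distance -/

section Divergence

lemma sq_sqrt_sub_sqrt_le_log {p r : ℝ} (hp : 0 ≤ p) (hr : 0 ≤ r) (hpr : r = 0 → p = 0) :
    (Real.sqrt p - Real.sqrt r) ^ 2 ≤ p * Real.log (p / r) - p + r := by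
  rcases hp.eq_or_lt with rfl | hp'
  · simp [Real.sq_sqrt hr]
  have hr' : 0 < r := lt_of_le_of_ne hr fun h => hp'.ne' (hpr h.symm)
  have hs : 0 < Real.sqrt r / Real.sqrt p := div_pos (Real.sqrt_pos.2 hr') (Real.sqrt_pos.2 hp')
  have h1 := Real.log_le_sub_one_of_pos hs
  rw [← Real.sqrt_div' _ hp, Real.log_sqrt (by positivity), Real.sqrt_div' _ hp,
    ← inv_div p r, Real.log_inv] at h1
  have h2 : p * (Real.sqrt r / Real.sqrt p) = Real.sqrt p * Real.sqrt r := by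
    have := Real.sqrt_pos.2 hp'
    field_simp
    rw [Real.sq_sqrt hp]
  have h3 := mul_le_mul_of_nonneg_left h1 hp
  nlinarith [Real.sq_sqrt hp, Real.sq_sqrt hr]

/-- For `√p ≤ 2 * √r`, the bound `log x ≤ x - 1` yields the chi-square term `(p - r) ^ 2 / r`, at
most `9` Hellinger terms. Otherwise `p` itself is at most `4` Hellinger terms, and the logarithm is
at most `2 * log M`. -/
lemma log_sub_add_le {p r M : ℝ} (hp : 0 ≤ p) (hr : 0 < r) (hM : 2 ≤ M) (h : p ≤ M ^ 2 * r) :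
    p * Real.log (p / r) - p + r ≤ (9 + 8 * Real.log M) * (Real.sqrt p - Real.sqrt r) ^ 2 := by
  have hlogM : 0 ≤ Real.log M := Real.log_nonneg (by linarith)
  rcases hp.eq_or_lt with rfl | hp'
  · simp only [zero_mul, Real.sqrt_zero, zero_sub, neg_sq, Real.sq_sqrt hr.le]
    nlinarith
  set s := Real.sqrt p with hs
  set t := Real.sqrt r with ht
  have hs0 : 0 < s := Real.sqrt_pos.2 hp'
  have ht0 : 0 < t := Real.sqrt_pos.2 hr
  have hps : p = s ^ 2 := (Real.sq_sqrt hp).symm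
  have hrt : r = t ^ 2 := (Real.sq_sqrt hr.le).symm
  have hst : 0 ≤ (s - t) ^ 2 := sq_nonneg _
  rcases le_total s (2 * t) with h2 | h2
  · have h3 : p * Real.log (p / r) ≤ p * (p / r - 1) :=
      mul_le_mul_of_nonneg_left (Real.log_le_sub_one_of_pos (by positivity)) hp
    have h4 : p * (p / r - 1) - p + r = (s - t) ^ 2 * ((s + t) / t) ^ 2 := by
      rw [hps, hrt]; field_simp; ring
    have h5 : ((s + t) / t) ^ 2 ≤ 9 := by
      have : (s + t) / t ≤ 3 := by rw [div_le_iff₀ ht0]; linarith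
      have h6 : 0 ≤ (s + t) / t := by positivity
      nlinarith
    have h6 := mul_le_mul_of_nonneg_left h5 hst
    have h7 := mul_nonneg hlogM hst
    linarith
  · have h3 : Real.log (p / r) ≤ 2 * Real.log M := by
      rw [← Real.log_rpow (by linarith)]
      refine Real.log_le_log (by positivity) ?_
      rw [div_le_iff₀ hr]
      exact_mod_cast h
    have h4 : p ≤ 4 * (s - t) ^ 2 := by rw [hps]; nlinarith
    have h5 : p * Real.log (p / r) ≤ 4 * (s - t) ^ 2 * (2 * Real.log M) :=
      (mul_le_mul_of_nonneg_left h3 hp).trans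
        (mul_le_mul_of_nonneg_right h4 (by linarith))
    have h6 : r ≤ p := by rw [hps, hrt]; nlinarith
    linarith

lemma mul_log_inv_le {x M : ℝ} (hx : 0 < x) (hM : 0 < M) (h : x ≤ 1 / M ^ 2) :
    x * Real.log (1 / x) ≤ 2 / M := by
  have hs : 0 < Real.sqrt x := Real.sqrt_pos.2 hx
  have h1 : Real.log (1 / x) ≤ 2 * (1 / Real.sqrt x) := by
    have h2 := Real.log_le_sub_one_of_pos (show 0 < 1 / Real.sqrt x by positivity)
    have h3 : Real.log (1 / x) = 2 * Real.log (1 / Real.sqrt x) := by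
      rw [one_div, one_div, Real.log_inv, Real.log_inv, Real.log_sqrt hx.le]; ring
    linarith
  have h4 : Real.sqrt x ≤ 1 / M := by
    rw [Real.sqrt_le_left (by positivity), div_pow, one_pow]; exact h
  calc x * Real.log (1 / x) ≤ x * (2 * (1 / Real.sqrt x)) := mul_le_mul_of_nonneg_left h1 hx.le
    _ = 2 * Real.sqrt x := by
      nth_rewrite 1 [← Real.sq_sqrt hx.le]; field_simp
    _ ≤ 2 * (1 / M) := by linarith
    _ = 2 / M := by ring

variable {A B C : Type} [Fintype A] [Fintype B] [Fintype C]

lemma le_margFst {p : A × C → ℝ} (hp : p ∈ stdSimplex ℝ (A × C)) (z : A × C) :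
    p z ≤ margFst p z.1 :=
  Finset.single_le_sum (f := fun c => p (z.1, c)) (fun _ _ => hp.1 _) (Finset.mem_univ z.2)

lemma le_margSnd {p : A × C → ℝ} (hp : p ∈ stdSimplex ℝ (A × C)) (z : A × C) :
    p z ≤ margSnd p z.2 :=
  Finset.single_le_sum (f := fun a => p (a, z.2)) (fun _ _ => hp.1 _) (Finset.mem_univ z.1)

lemma eq_zero_of_marg_mul_eq_zero {p : A × C → ℝ} (hp : p ∈ stdSimplex ℝ (A × C)) (z : A × C)
    (h : margFst p z.1 * margSnd p z.2 = 0) : p z = 0 := by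
  refine le_antisymm ?_ (hp.1 z)
  rcases mul_eq_zero.1 h with h | h
  · exact (le_margFst hp z).trans h.le
  · exact (le_margSnd hp z).trans h.le

lemma cellHell_le_log {p : A × C → ℝ} (hp : p ∈ stdSimplex ℝ (A × C)) (z : A × C) :
    cellHell p z ≤ p z * Real.log (p z / (margFst p z.1 * margSnd p z.2)) - p z +
      margFst p z.1 * margSnd p z.2 :=
  sq_sqrt_sub_sqrt_le_log (hp.1 z) (mul_nonneg ((margFst_mem hp).1 _) ((margSnd_mem hp).1 _))
    (eq_zero_of_marg_mul_eq_zero hp z)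

/-- If `p z` exceeds `M ^ 2` times the product of the marginals, then `p z ≤ margFst` forces
`margSnd ≤ 1 / M ^ 2`. The logarithmic term is then at most `x * log (1 / x)` at `x = margSnd`,
which is small. Otherwise `log_sub_add_le` applies. -/
lemma log_le_cellHell {p : A × C → ℝ} (hp : p ∈ stdSimplex ℝ (A × C)) (z : A × C) {M : ℝ}
    (hM : 2 ≤ M) :
    p z * Real.log (p z / (margFst p z.1 * margSnd p z.2)) - p z +
      margFst p z.1 * margSnd p z.2 ≤ (9 + 8 * Real.log M) * cellHell p z + 2 / M := by
  have hlogM : 0 ≤ Real.log M := Real.log_nonneg (by linarith)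
  have hA := (margFst_mem hp).1 z.1
  have hC := (margSnd_mem hp).1 z.2
  have hM2 : 0 ≤ 2 / M := by positivity
  have hcell : 0 ≤ (9 + 8 * Real.log M) * cellHell p z :=
    mul_nonneg (by linarith) (cellHell_nonneg _ _)
  rcases (mul_nonneg hA hC).eq_or_lt with hr | hr
  · rw [← hr, eq_zero_of_marg_mul_eq_zero hp z hr.symm]; simp only [zero_mul]; linarith
  rcases le_or_gt (p z) (M ^ 2 * (margFst p z.1 * margSnd p z.2)) with h | h
  · have := log_sub_add_le (hp.1 z) hr hM h
    rw [cellHell]; linarith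
  · have hA' : 0 < margFst p z.1 := lt_of_le_of_ne hA fun h => by rw [← h] at hr; simp at hr
    have hC' : 0 < margSnd p z.2 := lt_of_le_of_ne hC fun h => by rw [← h] at hr; simp at hr
    have hpz : 0 < p z := lt_of_le_of_lt (by positivity) h
    have hx : margSnd p z.2 ≤ 1 / M ^ 2 := by
      rw [le_div_iff₀ (by positivity)]
      have h1 := h.trans_le (le_margFst hp z)
      by_contra hcon
      push Not at hcon
      nlinarith [mul_lt_mul_of_pos_left hcon hA']
    have hlog : Real.log (p z / (margFst p z.1 * margSnd p z.2)) ≤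
        Real.log (1 / margSnd p z.2) := by
      refine Real.log_le_log (by positivity) ?_
      rw [div_le_div_iff₀ hr hC', one_mul]
      exact mul_le_mul_of_nonneg_right (le_margFst hp z) hC
    have hlog0 : 0 ≤ Real.log (1 / margSnd p z.2) := by
      refine Real.log_nonneg ?_
      rw [one_le_div hC']
      refine hx.trans ?_
      rw [div_le_one (by positivity)]
      nlinarith
    have h2 : p z * Real.log (p z / (margFst p z.1 * margSnd p z.2)) ≤ 2 / M :=
      (mul_le_mul_of_nonneg_left hlog hpz.le).trans
        ((mul_le_mul_of_nonneg_right (le_margSnd hp z) hlog0).trans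
          (mul_log_inv_le hC' (by linarith) hx))
    have h3 : margFst p z.1 * margSnd p z.2 ≤ p z := by
      refine le_trans (le_mul_of_one_le_left hr.le ?_) h.le
      nlinarith
    linarith

/-- Mutual information of a distribution of pairs. -/
def mutualInfo (p : A × C → ℝ) : ℝ :=
  ∑ z, p z * Real.log (p z / (margFst p z.1 * margSnd p z.2))

/-- The corrections cancel in total, as both distributions have mass one, and allow termwise
comparison with Hellinger contributions. -/
lemma mutualInfo_eq {p : A × C → ℝ} (hp : p ∈ stdSimplex ℝ (A × C)) :
    mutualInfo p = ∑ z, (p z * Real.log (p z / (margFst p z.1 * margSnd p z.2)) - p z +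
      margFst p z.1 * margSnd p z.2) := by
  rw [Finset.sum_add_distrib, Finset.sum_sub_distrib, hp.2, sum_margFst_mul_margSnd hp, mutualInfo]
  ring

lemma sum_cellHell_le_mutualInfo {p : A × C → ℝ} (hp : p ∈ stdSimplex ℝ (A × C)) :
    ∑ z, cellHell p z ≤ mutualInfo p := by
  rw [mutualInfo_eq hp]
  exact Finset.sum_le_sum fun z _ => cellHell_le_log hp z

lemma mutualInfo_le {p : A × C → ℝ} (hp : p ∈ stdSimplex ℝ (A × C)) {M : ℝ} (hM : 2 ≤ M) :
    mutualInfo p ≤ (9 + 8 * Real.log M) * ∑ z, cellHell p z +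
      Fintype.card A * Fintype.card C * (2 / M) := by
  rw [mutualInfo_eq hp]
  refine (Finset.sum_le_sum fun z _ => log_le_cellHell hp z hM).trans (le_of_eq ?_)
  rw [Finset.sum_add_distrib, Finset.mul_sum]
  simp

lemma klDivergence_joint (q : B → ℝ) (p : B → A × C → ℝ) {Q : A × B × C → ℝ}
    (hQ : ∀ x, Q x = q x.2.1 * (margFst (p x.2.1) x.1 * margSnd (p x.2.1) x.2.2)) :
    klDivergence (joint q p) Q = ∑ b, q b * mutualInfo (p b) := by
  unfold klDivergence
  refine (Fintype.sum_equiv (binFirst A B C) _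
    (fun y => q y.1 * (p y.1 y.2 * Real.log
      (p y.1 y.2 / (margFst (p y.1) y.2.1 * margSnd (p y.1) y.2.2)))) fun x => ?_).trans ?_
  · rw [hQ, joint]
    by_cases hb : q x.2.1 = 0
    · simp [hb, binFirst]
    · rw [mul_div_mul_left _ _ hb, mul_assoc]; rfl
  · rw [Fintype.sum_prod_type]
    simp [Finset.mul_sum, mutualInfo]

variable [Nonempty A] [Nonempty C]

lemma hellingerSq_nonneg {X : Type} [Fintype X] (P Q : X → ℝ) : 0 ≤ hellingerSq P Q :=
  mul_nonneg (by norm_num) (Finset.sum_nonneg fun _ _ => sq_nonneg _)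

lemma hellingerSq_markovRef_le_one {P : A × B × C → ℝ} (hP : P ∈ stdSimplex ℝ (A × B × C)) :
    hellingerSq P (markovRef P) ≤ 1 := by
  obtain ⟨q, hq, p, hp, hPq, hQ, -⟩ := exists_joint hP
  rw [hPq] at hQ ⊢
  rw [hellingerSq_joint hq p hQ]
  have h : ∑ b, q b * ∑ z, cellHell (p b) z ≤ ∑ b, q b * 2 :=
    Finset.sum_le_sum fun b _ => mul_le_mul_of_nonneg_left (sum_cellHell_le (hp b)) (hq.1 b)
  rw [← Finset.sum_mul, hq.2] at h
  linarith

lemma two_mul_hellingerSq_le {P : A × B × C → ℝ} (hP : P ∈ stdSimplex ℝ (A × B × C)) :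
    2 * hellingerSq P (markovRef P) ≤ klDivergence P (markovRef P) := by
  obtain ⟨q, hq, p, hp, hPq, hQ, -⟩ := exists_joint hP
  rw [hPq] at hQ ⊢
  rw [hellingerSq_joint hq p hQ, klDivergence_joint q p hQ]
  have h : ∑ b, q b * ∑ z, cellHell (p b) z ≤ ∑ b, q b * mutualInfo (p b) :=
    Finset.sum_le_sum fun b _ =>
      mul_le_mul_of_nonneg_left (sum_cellHell_le_mutualInfo (hp b)) (hq.1 b)
  linarith

lemma klDivergence_le {P : A × B × C → ℝ} (hP : P ∈ stdSimplex ℝ (A × B × C)) {M : ℝ}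
    (hM : 2 ≤ M) :
    klDivergence P (markovRef P) ≤ (9 + 8 * Real.log M) * (2 * hellingerSq P (markovRef P)) +
      Fintype.card A * Fintype.card C * (2 / M) := by
  obtain ⟨q, hq, p, hp, hPq, hQ, -⟩ := exists_joint hP
  rw [hPq] at hQ ⊢
  rw [hellingerSq_joint hq p hQ, klDivergence_joint q p hQ]
  refine (Finset.sum_le_sum fun b _ =>
    mul_le_mul_of_nonneg_left (mutualInfo_le (hp b) hM) (hq.1 b)).trans (le_of_eq ?_)
  simp only [mul_add, Finset.sum_add_distrib, ← Finset.sum_mul, hq.2]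
  rw [one_mul, ← mul_assoc 2, show (2 : ℝ) * (1 / 2) = 1 by norm_num, one_mul, Finset.mul_sum]
  simp only [mul_left_comm]

end Divergence

/-! ### Transfer to CMI testing -/

lemma half_le_log {u : ℝ} (hu : 0 ≤ u) : 1 / 2 ≤ Real.log (2 + u) := by
  have h := Real.log_le_log (by norm_num) (show (2 : ℝ) ≤ 2 + u by linarith)
  linarith [Real.log_two_gt_d9]

/-- A lower bound on the conditional mutual information gives one on the Hellinger distance. -/
lemma le_hellingerSq {A B C : Type} [Fintype A] [Fintype B] [Fintype C] [Nonempty A] [Nonempty C]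
    {P : A × B × C → ℝ} (hP : P ∈ stdSimplex ℝ (A × B × C)) {ε : ℝ} (hε : 0 < ε)
    (h : ε ≤ klDivergence P (markovRef P)) :
    ε / (168 * Real.log (2 + Fintype.card A * Fintype.card C / ε)) ≤
      hellingerSq P (markovRef P) := by
  set u : ℝ := Fintype.card A * Fintype.card C / ε with hu
  have hu0 : 0 ≤ u := by positivity
  have hl := half_le_log hu0
  have hH := hellingerSq_nonneg P (markovRef P)
  -- With `M = 2 + 4 * u` the error over all cells is at most `ε / 2`. The other half leads to `168
  -- = 2 * 2 * 42`, where `42 = 18 + 24` bounds `9 + 8 * log M` in units of `log (2 + u) ≥ 1 / 2`.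
  have h1 := klDivergence_le hP (show (2 : ℝ) ≤ 2 + 4 * u by linarith)
  have h2 : (Fintype.card A : ℝ) * Fintype.card C * (2 / (2 + 4 * u)) ≤ ε / 2 := by
    have : (Fintype.card A : ℝ) * Fintype.card C = u * ε := by rw [hu]; field_simp
    rw [this, mul_div_assoc', div_le_div_iff₀ (by positivity) (by norm_num)]
    nlinarith
  have h3 : Real.log (2 + 4 * u) ≤ 3 * Real.log (2 + u) := by
    rw [show (3 : ℝ) = (3 : ℕ) by norm_num, ← Real.log_pow]
    refine Real.log_le_log (by positivity) ?_
    nlinarith [pow_nonneg hu0 3, pow_nonneg hu0 2]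
  have h4 : (9 + 8 * Real.log (2 + 4 * u)) * (2 * hellingerSq P (markovRef P)) ≤
      (42 * Real.log (2 + u)) * (2 * hellingerSq P (markovRef P)) :=
    mul_le_mul_of_nonneg_right (by linarith) (by linarith)
  rw [div_le_iff₀ (by positivity)]
  linarith

/-- The same tester works: zero CMI implies zero Hellinger distance, and large CMI implies Hellinger
distance above the reduced threshold. -/
lemma scCMI_le_scHellinger {dA dB dC : ℕ} {ε : ℝ} (hA : 1 ≤ dA) (hC : 1 ≤ dC) (hε : 0 < ε) :
    scCMI ε dA dB dC ≤ scHellinger (ε / (168 * Real.log (2 + dA * dC / ε))) dA dB dC := by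
  have : Nonempty (Fin dA) := ⟨⟨0, hA⟩⟩
  have : Nonempty (Fin dC) := ⟨⟨0, hC⟩⟩
  refine sInf_le_sInf ?_
  rintro n ⟨N, rfl, T, hT⟩
  refine ⟨N, rfl, T, fun P hP => ⟨fun h => (hT P hP).1 ?_, fun h => (hT P hP).2 ?_⟩⟩
  · have := two_mul_hellingerSq_le hP
    linarith [hellingerSq_nonneg P (markovRef P)]
  · simpa using le_hellingerSq hP hε h

/-- The squared Hellinger distance never exceeds one, so the tester that always accepts needs no
samples. -/
lemma scHellinger_eq_zero {dA dB dC : ℕ} {ε : ℝ} (hA : 1 ≤ dA) (hC : 1 ≤ dC) (hε : 1 < ε) :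
    scHellinger ε dA dB dC = 0 := by
  have : Nonempty (Fin dA) := ⟨⟨0, hA⟩⟩
  have : Nonempty (Fin dC) := ⟨⟨0, hC⟩⟩
  refine nonpos_iff_eq_zero.1 (sInf_le ⟨0, rfl, fun _ => 1, fun P hP => ⟨fun _ => ?_, fun h => ?_⟩⟩)
  · simp only [yesProb]; norm_num
  · linarith [hellingerSq_markovRef_le_one hP]

lemma coe_scHellinger_le {dA dB dC : ℕ} {ε : ℝ} (hB : 1 ≤ dB) (hC : 1 ≤ dC) (hCA : dC ≤ dA)
    (hε : 0 < ε) :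
    (scHellinger ε dA dB dC : ℝ≥0∞) ≤ ENNReal.ofReal (rate (10 ^ 50) 11 ε dA dB dC) := by
  rcases le_or_gt ε 1 with h | h
  · obtain ⟨N, h1, h2⟩ := exists_scHellinger_le hB hC hCA hε h
    calc (scHellinger ε dA dB dC : ℝ≥0∞) ≤ ((N : ℕ∞) : ℝ≥0∞) := ENat.toENNReal_mono h1
      _ = ENNReal.ofReal N := by simp
      _ ≤ _ := ENNReal.ofReal_le_ofReal h2
  · rw [scHellinger_eq_zero (hC.trans hCA) hC h]; simp

lemma div_div_rpow_le {X ε R s : ℝ} (hX : 0 ≤ X) (hε : 0 < ε) (hR : 1 ≤ R) (hs : s ≤ 2) :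
    X / (ε / R) ^ s ≤ R ^ 2 * (X / ε ^ s) := by
  have hR0 : 0 ≤ R := by linarith
  rw [Real.div_rpow hε.le hR0, div_div_eq_mul_div, mul_comm X, mul_div_assoc]
  refine mul_le_mul_of_nonneg_right ?_ (by positivity)
  rw [← Real.rpow_natCast R 2]
  exact Real.rpow_le_rpow_of_exponent_le hR (by exact_mod_cast hs)

/-- Every exponent of `ε` in the rates is at most `2`, so one factor `R ^ 2` covers all terms. -/
lemma max_rate_div_le {a b c ε R : ℝ} (ha : 0 ≤ a) (hb : 0 ≤ b) (hc : 0 ≤ c) (hε : 0 < ε)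
    (hR : 1 ≤ R) :
    max (fSym (ε / R) a b c) (fAsym (ε / R) a b c) ≤
      R ^ 2 * max (fSym ε a b c) (fAsym ε a b c) := by
  have hR2 : 0 ≤ R ^ 2 := sq_nonneg R
  have h1 : ∀ X : ℝ, 0 ≤ X → X / (ε / R) ≤ R ^ 2 * (X / ε) := fun X hX => by
    simpa using div_div_rpow_le (s := 1) hX hε hR (by norm_num)
  unfold fSym fAsym
  simp only [mul_max_of_nonneg _ _ hR2, mul_min_of_nonneg _ _ hR2]
  refine max_le_max (max_le_max (h1 _ (by positivity)) (min_le_min (h1 _ (by positivity)) ?_))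
    (min_le_min (h1 _ (by positivity)) ?_)
  · exact div_div_rpow_le (by positivity) hε hR (by norm_num)
  · exact div_div_rpow_le (by positivity) hε hR (by norm_num)

lemma rate_div_le {a b c ε R : ℝ} (ha : 0 ≤ a) (hb : 0 ≤ b) (hc : 0 ≤ c) (hε : 0 < ε)
    (hR : 1 ≤ R) (hRL : R ≤ 168 * Real.log (2 + a * b * c / ε)) :
    rate (10 ^ 50) 11 (ε / R) a b c ≤ rate (10 ^ 66) 13 ε a b c := by
  unfold rate
  set y := a * b * c / ε with hy
  have hy0 : 0 ≤ y := by positivity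
  set L := Real.log (2 + y) with hL
  have hL0 : 1 / 2 ≤ L := half_le_log hy0
  have hLy : L ≤ 2 + y := by
    linarith [Real.log_le_sub_one_of_pos (show 0 < 2 + y by linarith)]
  set F := max (fSym ε a b c) (fAsym ε a b c) with hF
  have hF0 : 0 ≤ F := le_max_of_le_left (le_max_of_le_left (by positivity))
  have hlog0 : 0 ≤ Real.log (2 + a * b * c / (ε / R)) :=
    Real.log_nonneg (by
      have : 0 ≤ a * b * c / (ε / R) := by positivity
      linarith)
  -- `R` is at most a multiple of `2 + y`, so the new argument is at most `(2 + y) ^ 10`. The factor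
  -- `R ^ 2` adds two logarithms, turning `11` into `13`.
  have hlog : Real.log (2 + a * b * c / (ε / R)) ≤ 10 * L := by
    rw [hL, show (10 : ℝ) = (10 : ℕ) by norm_num, ← Real.log_pow]
    refine Real.log_le_log (by positivity) ?_
    rw [div_div_eq_mul_div, mul_comm, mul_div_assoc, ← hy]
    have h1 : R * y ≤ 168 * (2 + y) * (2 + y) :=
      mul_le_mul (by linarith) (by linarith) hy0 (by linarith)
    calc 2 + R * y ≤ 2 ^ 8 * (2 + y) ^ 2 := by nlinarith
      _ ≤ (2 + y) ^ 8 * (2 + y) ^ 2 := by gcongr; linarith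
      _ = (2 + y) ^ 10 := by ring
  calc 10 ^ 50 * Real.log (2 + a * b * c / (ε / R)) ^ 11 *
        max (fSym (ε / R) a b c) (fAsym (ε / R) a b c)
      ≤ 10 ^ 50 * (10 * L) ^ 11 * (R ^ 2 * F) := by
        gcongr
        · exact le_max_of_le_left (le_max_of_le_left (by positivity))
        · exact max_rate_div_le ha hb hc hε hR
    _ ≤ 10 ^ 50 * (10 * L) ^ 11 * ((168 * L) ^ 2 * F) := by gcongr
    _ = 10 ^ 50 * 10 ^ 11 * 168 ^ 2 * L ^ 13 * F := by ring
    _ ≤ 10 ^ 66 * L ^ 13 * F := by gcongr; norm_num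

lemma coe_scCMI_le {dA dB dC : ℕ} {ε : ℝ} (hB : 1 ≤ dB) (hC : 1 ≤ dC) (hCA : dC ≤ dA)
    (hε : 0 < ε) :
    (scCMI ε dA dB dC : ℝ≥0∞) ≤ ENNReal.ofReal (rate (10 ^ 66) 13 ε dA dB dC) := by
  have hl := half_le_log (show (0 : ℝ) ≤ dA * dC / ε by positivity)
  have hR : 1 ≤ 168 * Real.log (2 + dA * dC / ε) := by linarith
  have hB' : (1 : ℝ) ≤ dB := by exact_mod_cast hB
  refine (ENat.toENNReal_mono (scCMI_le_scHellinger (hC.trans hCA) hC hε)).trans ?_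
  refine (coe_scHellinger_le hB hC hCA (by positivity)).trans (ENNReal.ofReal_le_ofReal ?_)
  refine rate_div_le (by positivity) (by positivity) (by positivity) hε hR ?_
  have : Real.log (2 + dA * dC / ε) ≤ Real.log (2 + dA * dB * dC / ε) := by
    refine Real.log_le_log (by positivity) ?_
    gcongr
    exact le_mul_of_one_le_right (by positivity) hB'
  linarith

end CMITest

end

theorem mainTheorem2 :
    -- conditional independence testing in squared Hellinger distance
    (∃ (K : ℝ) (k : ℕ), 0 < K ∧
      ∀ (dA dB dC : ℕ) (ε : ℝ), 1 ≤ dB → 1 ≤ dC → dC ≤ dA → 0 < ε →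
        (CMITest.scHellinger ε dA dB dC : ℝ≥0∞) ≤
          ENNReal.ofReal (CMITest.rate K k ε dA dB dC)) ∧
    -- CMI testing
    (∃ (K : ℝ) (k : ℕ), 0 < K ∧
      ∀ (dA dB dC : ℕ) (ε : ℝ), 1 ≤ dB → 1 ≤ dC → dC ≤ dA → 0 < ε →
        (CMITest.scCMI ε dA dB dC : ℝ≥0∞) ≤
          ENNReal.ofReal (CMITest.rate K k ε dA dB dC)) ∧
    -- CMI testing costs no more than testing in squared Hellinger distance, up to a logarithmic
    -- factor in the threshold
    (∃ K : ℝ, 0 < K ∧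
      ∀ (dA dB dC : ℕ) (ε : ℝ), 1 ≤ dB → 1 ≤ dC → dC ≤ dA → 0 < ε →
        CMITest.scCMI ε dA dB dC ≤
          CMITest.scHellinger (ε / (K * Real.log (2 + dA * dC / ε))) dA dB dC) := by
  refine ⟨⟨10 ^ 50, 11, by positivity, fun dA dB dC ε hB hC hCA hε => ?_⟩,
    ⟨10 ^ 66, 13, by positivity, fun dA dB dC ε hB hC hCA hε => ?_⟩,
    ⟨168, by norm_num, fun dA dB dC ε _ hC hCA hε => ?_⟩⟩
  · exact CMITest.coe_scHellinger_le hB hC hCA hε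
  · exact CMITest.coe_scCMI_le hB hC hCA hε
  · exact CMITest.scCMI_le_scHellinger (hC.trans hCA) hC hε
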